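/- Let $\lambda>0$, let $f$ be a probability density on $(0,\infty)$, and let $\mathcal D\subset(0,\infty)^2$ be Borel and symmetric ($(z,\tilde z)\in\mathcal D\Rightarrow(\tilde z,z)\in\mathcal D$). Let $\Phi$ be an independently marked homogeneous Poisson point process: the positions of its atoms (base stations) form a homogeneous Poisson process on $\mathbb R^2$ of density $\lambda$, and the marks are independent of the positions and i.i.d. with law $f(z)\,dz$. An atom with position $\hat a\in\mathbb R^2$ and mark $z$ is regarded as the point $a=(\hat a,z)$ of $\mathbb H^3=\mathbb R^2\times(0,\infty)$. The hyperbolic distance between $a=(\hat a,z)$ and $b=(\hat b,\tilde z)$ is $\varrho(|\hat a-\hat b|,z,\tilde z)$, where $$\varrho(s,z,\tilde z)=\operatorname{arcosh}\Big(\frac{s^2}{2z\tilde z}+\frac12\Big(\frac z{\tilde z}+\frac{\tilde z}z\Big)\Big).$$ Two different atoms $a=(\hat a,z)$ and $b=(\hat b,\tilde z)$ of $\Phi$ cooperate if each is the (unique) nearest neighbour of the other in $\Phi$ for the hyperbolic distance and $(z,\tilde z)\in\mathcal D$. An atom that cooperates with no other atom is a single. For Borel $A\subset\mathbb R^2$ let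 $M^{(1)}(A)$ and $M^{(2)}(A)$ be the expected numbers of singles and of cooperating atoms, respectively, with position in $A$, and let $\mathcal S(A)$ be the Lebesgue measure of $A$. For $s,z,\tilde z>0$ put $R=\varrho(s,z,\tilde z)$, $d=\sqrt{s^2+(z-\tilde z)^2\cosh^2R}$, $r=z\sinh R$, $\tilde r=\tilde z\sinh R$, $c=z\cosh R$, $\tilde c=\tilde z\cosh R$, $$h=\frac{(\tilde r-r+d)(r+\tilde r-d)}{2d},\quad \tilde h=\frac{(r-\tilde r+d)(r+\tilde r-d)}{2d},\quad \delta=\frac\pi2-\arcsin\frac{\tilde c-c}d,\quad \tilde\delta=\frac\pi2-\arcsin\frac{c-\tilde c}d,$$ and $$\begin{aligned}F(s,z,\tilde z)={}&\pi\int_{-r}^{r}f(w+c)(r^2-w^2)\,dw+\pi\int_{-\tilde r}^{\tilde r}f(w+\tilde c)(\tilde r^2-w^2)\,dw\\&-\int_{r-h}^{r}\int_0^{2\pi}\int_0^{\sqrt{r^2-w^2}}f(c+w\cos\delta-t\cos\theta\sin\delta)\,t\,dt\,d\theta\,dw\\&-\int_{\tilde r-\tilde h}^{\tilde r}\int_0^{2\pi}\int_0^{\sqrt{\tilde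 r^2-w^2}}f(\tilde c+w\cos\tilde\delta-t\cos\theta\sin\tilde\delta)\,t\,dt\,d\theta\,dw.\end{aligned}$$ Then there is a number $P_{\mathcal D}(\lambda,f)\in[0,1]$, depending only on $\lambda$, $f$ and $\mathcal D$, such that for every Borel set $A\subset\mathbb R^2$ $$M^{(1)}(A)=(1-P_{\mathcal D}(\lambda,f))\,\lambda\,\mathcal S(A),\qquad M^{(2)}(A)=P_{\mathcal D}(\lambda,f)\,\lambda\,\mathcal S(A)$$ (with the convention $0\cdot\infty=0$). Furthermore, with the integral convergent, $$P_{\mathcal D}(\lambda,f)=2\pi\lambda\int_0^\infty\mathbb E\big[e^{-\lambda F(s,Z,\tilde Z)}\mathbf 1_{\{(Z,\tilde Z)\in\mathcal D\}}\big]\,s\,ds,$$ where $Z$ and $\tilde Z$ are independent random variables with common law $f(z)\,dz$. -/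

import Mathlib

open MeasureTheory ProbabilityTheory Set
open scoped ENNReal NNReal

universe u

noncomputable section

namespace MNNR

/-- The Euclidean plane `ℝ²` of base-station positions. -/
abbrev Plane : Type := EuclideanSpace ℝ (Fin 2)

/-- An atom: a position in the plane together with a resource mark. The points with positive mark
form the half-space `ℍ³`. -/
abbrev Atom : Type := Plane × ℝ

/-- Hyperbolic distance of two points of `ℍ³` at planar Euclidean distance `s`, with third
coordinates `z` and `z'`. -/
def hypDistOf (s z z' : ℝ) : ℝ :=
  Real.arcosh (s ^ 2 / (2 * z * z') + (1 / 2) * (z / z' + z' / z))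

/-- The hyperbolic distance on `ℍ³`. -/
def hypDist (a b : Atom) : ℝ := hypDistOf (dist a.1 b.1) a.2 b.2

/-- `b` is the nearest neighbour (unique minimiser of the hyperbolic distance) of `a` in `φ`. -/
def IsNearestNeighbor (φ : Set Atom) (a b : Atom) : Prop :=
  b ∈ φ ∧ b ≠ a ∧ ∀ c ∈ φ, c ≠ a → c ≠ b → hypDist a b < hypDist a c

/-- `a` and `b` are in mutually nearest neighbour relation in `φ` with control set `D`,
that is, they cooperate. -/
def Cooperate (D : Set (ℝ × ℝ)) (φ : Set Atom) (a b : Atom) : Prop :=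
  a ∈ φ ∧ b ∈ φ ∧ a ≠ b ∧ IsNearestNeighbor φ a b ∧ IsNearestNeighbor φ b a ∧ (a.2, b.2) ∈ D

/-- The atoms of `φ` that cooperate with another atom of `φ`. -/
def cooperating (D : Set (ℝ × ℝ)) (φ : Set Atom) : Set Atom :=
  {a | a ∈ φ ∧ ∃ b ∈ φ, Cooperate D φ a b}

/-- The atoms of `φ` that cooperate with no other atom of `φ`. -/
def singles (D : Set (ℝ × ℝ)) (φ : Set Atom) : Set Atom :=
  {a | a ∈ φ ∧ ¬ ∃ b ∈ φ, Cooperate D φ a b}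

/-- Number of atoms of `ψ` whose position lies in `A`. -/
def countIn (ψ : Set Atom) (A : Set Plane) : ℝ≥0∞ :=
  (({a ∈ ψ | a.1 ∈ A}.encard : ℕ∞) : ℝ≥0∞)

/-- The probability law `f(z) dz` on `(0, ∞)`. -/
def resourceLaw (f : ℝ → ℝ) : Measure ℝ :=
  (volume.restrict (Ioi 0)).withDensity (fun z => ENNReal.ofReal (f z))

/-- Number of points, counted with multiplicity, that the process `∑ₙ δ_(x n)` has in `B`. -/
def pointCount {Ω : Type u} (x : ℕ → Ω → Plane) (B : Set Plane) (ω : Ω) : ℕ∞ :=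
  {n | x n ω ∈ B}.encard

/-- The points `x n` form a homogeneous Poisson point process on the plane with density `lam`:
the numbers of points in bounded Borel sets are Poisson with mean `lam * area`, and are
independent for disjoint sets. Since the number of points of such a process is almost surely
infinite, its points can be enumerated by `ℕ`. -/
structure IsHomogeneousPPP {Ω : Type u} [MeasurableSpace Ω] (P : Measure Ω) (lam : ℝ)
    (x : ℕ → Ω → Plane) : Prop where
  measurable : ∀ n, Measurable (x n)
  poisson : ∀ B : Set Plane, MeasurableSet B → Bornology.IsBounded B →
    HasLaw (pointCount x B)
      ((poissonMeasure (ENNReal.ofReal lam * volume B).toNNReal).map (Nat.cast : ℕ → ℕ∞)) P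
  indep : ∀ (k : ℕ) (B : Fin k → Set Plane), (∀ i, MeasurableSet (B i)) →
    (∀ i, Bornology.IsBounded (B i)) → Pairwise (fun i j => Disjoint (B i) (B j)) →
    iIndepFun (fun i => pointCount x (B i)) P

/-- An independently marked homogeneous Poisson point process: positions `x n` forming a Poisson
process of density `lam`, and positive marks `Z n` that are i.i.d. with law `f(z) dz` and
independent of the positions. -/
structure IsMarkedPPP {Ω : Type u} [MeasurableSpace Ω] (P : Measure Ω) (lam : ℝ) (f : ℝ → ℝ)
    (x : ℕ → Ω → Plane) (Z : ℕ → Ω → ℝ) : Prop where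
  positions : IsHomogeneousPPP P lam x
  mark_measurable : ∀ n, Measurable (Z n)
  mark_pos : ∀ n ω, 0 < Z n ω
  mark_law : ∀ n, HasLaw (Z n) (resourceLaw f) P
  mark_indep : iIndepFun Z P
  indep_positions : IndepFun (fun ω n => x n ω) (fun ω n => Z n ω) P

/-- The random configuration `Φ` of all atoms of the marked process. -/
def configuration {Ω : Type u} (x : ℕ → Ω → Plane) (Z : ℕ → Ω → ℝ) (ω : Ω) : Set Atom :=
  range fun n => (x n ω, Z n ω)

/-- `M⁽¹⁾(A)`: the mean number of singles with position in `A`. -/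
def meanSingles {Ω : Type u} [MeasurableSpace Ω] (P : Measure Ω) (D : Set (ℝ × ℝ))
    (x : ℕ → Ω → Plane) (Z : ℕ → Ω → ℝ) (A : Set Plane) : ℝ≥0∞ :=
  ∫⁻ ω, countIn (singles D (configuration x Z ω)) A ∂P

/-- `M⁽²⁾(A)`: the mean number of cooperating atoms with position in `A`. -/
def meanCooperating {Ω : Type u} [MeasurableSpace Ω] (P : Measure Ω) (D : Set (ℝ × ℝ))
    (x : ℕ → Ω → Plane) (Z : ℕ → Ω → ℝ) (A : Set Plane) : ℝ≥0∞ :=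
  ∫⁻ ω, countIn (cooperating D (configuration x Z ω)) A ∂P

/-- The integral, in cylindrical coordinates, of `f` (of the third coordinate) over a cap of
height `h` of the ball of radius `ρ` whose centre has third coordinate `c`; the axis of the cap
makes the angle `δ` with the third coordinate axis. -/
def capIntegral (f : ℝ → ℝ) (c ρ h δ : ℝ) : ℝ :=
  ∫ w in (ρ - h)..ρ, ∫ θ in (0 : ℝ)..(2 * Real.pi), ∫ t in (0 : ℝ)..(Real.sqrt (ρ ^ 2 - w ^ 2)),
    f (c + w * Real.cos δ - t * Real.cos θ * Real.sin δ) * t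

/-- The function `F(s, z, z')`. -/
def F (f : ℝ → ℝ) (s z z' : ℝ) : ℝ :=
  let R := hypDistOf s z z'
  let d := Real.sqrt (s ^ 2 + (z - z') ^ 2 * Real.cosh R ^ 2)
  let r := z * Real.sinh R
  let r' := z' * Real.sinh R
  let c := z * Real.cosh R
  let c' := z' * Real.cosh R
  let h := (r' - r + d) * (r + r' - d) / (2 * d)
  let h' := (r - r' + d) * (r + r' - d) / (2 * d)
  let δ := Real.pi / 2 - Real.arcsin ((c' - c) / d)
  let δ' := Real.pi / 2 - Real.arcsin ((c - c') / d)
  Real.pi * (∫ w in (-r)..r, f (w + c) * (r ^ 2 - w ^ 2))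
    + Real.pi * (∫ w in (-r')..r', f (w + c') * (r' ^ 2 - w ^ 2))
    - capIntegral f c r h δ - capIntegral f c' r' h' δ'

/-- The random variable `exp (-lam F(s, Z, Z')) 1_D(Z, Z')` as a function of `p = (Z, Z')`. -/
def cooperationWeight (lam : ℝ) (f : ℝ → ℝ) (D : Set (ℝ × ℝ)) (s : ℝ) (p : ℝ × ℝ) : ℝ :=
  D.indicator (fun q => Real.exp (-lam * F f s q.1 q.2)) p

/-- Its expectation, where `Z` and `Z'` are independent with law `f(z) dz`, i.e. the pair
`(Z, Z')` has the product law. -/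
def meanWeight (lam : ℝ) (f : ℝ → ℝ) (D : Set (ℝ × ℝ)) (s : ℝ) : ℝ :=
  ∫ p, cooperationWeight lam f D s p ∂((resourceLaw f).prod (resourceLaw f))

end MNNR

end

/-! An atom has at most one partner (`coopEvent_unique`), so the mean number of cooperating atoms
over `A` is the mean number of ordered pairs of mutually nearest atoms with marks in `D` and the
first atom over `A`. Atoms a, b at hyperbolic distance R are mutually nearest exactly when no third
atom lies in the closed balls of radius R about them. With Λ = `intensity lam f` and U(a, b) the
union of the two balls, the second order Campbell formula gives such pairs the density exp(-Λ(U(a,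
b))) with respect to Λ ⊗ Λ.

That formula is derived from the Poisson laws of the counts. When the avoided set is a finite union
of boxes, the plane is cut into cells over which the forbidden marks are constant. Given the
positions, each further point of a cell contributes a factor v, and E[N(N-1)...(N-e+1) v^(N-e)] =
m^e exp(-m(1-v)) for a Poisson variable N of mean m finishes the computation
(`IsMarkedPPP.pairMeasure_prod`). An open avoided set that varies with the pair is exhausted from
inside by finite unions of boxes (`IsMarkedPPP.avoidMeasure_of_isOpen`), and the closed balls are
squeezed between open ones (`IsMarkedPPP.avoidMeasure_closedBalls`), spheres being null.

A hyperbolic ball is a Euclidean ball with a raised centre (`ball_iff_of_cosh`). The union of two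
such balls has the measure of both, less the two caps that their radical plane cuts off; each cap is
integrated in cylindrical coordinates about the line of centres. Hence Λ(U(a, b)) = λF
(`heightMeasure_openBalls`). The density depends on the positions through their distance only, so
cooperating atoms have as intensity a multiple of Lebesgue measure, and polar coordinates produce 2π
s ds. The singles make up the rest of the intensity λ.

The constant must be fixed before any process is given, so the bound by one is proved for measures
alone: if G(b) = m{q ≤ q(b)}, then ∫ exp(-G) dm ≤ 1 (`lintegral_expNeg_sublevel_le_one`), because
m{G < u} ≤ u. -/

namespace MNNR

/-! ### Factorial moments of the Poisson law and counting of pairs in cells -/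

/-- `exp (-t)` for finite `t`, as an extended nonnegative real. -/
noncomputable def expNeg (t : ℝ≥0∞) : ℝ≥0∞ := ENNReal.ofReal (Real.exp (-t.toReal))

lemma lintegral_poissonMeasure (m : ℝ≥0) (g : ℕ → ℝ≥0∞) :
    ∫⁻ n, g n ∂(poissonMeasure m)
      = ∑' n : ℕ, ENNReal.ofReal (Real.exp (-m) * m ^ n / n.factorial) * g n := by
  simp [poissonMeasure, lintegral_sum_measure, lintegral_smul_measure]

/-- This is the `e`-th derivative in `v` of the generating function exp(-m(1-v)). The first `e`
terms vanish, and the others form a multiple of the exponential series of m v. -/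
lemma hasSum_poisson_descFactorial (m v : ℝ) (e : ℕ) :
    HasSum (fun n : ℕ => Real.exp (-m) * m ^ n / n.factorial * (n.descFactorial e * v ^ (n - e)))
      (m ^ e * Real.exp (-(m * (1 - v)))) := by
  rw [← hasSum_nat_add_iff' e]
  have h0 : ∑ i ∈ Finset.range e,
      (Real.exp (-m) * m ^ i / i.factorial * (i.descFactorial e * v ^ (i - e))) = 0 := by
    refine Finset.sum_eq_zero fun i hi => ?_
    rw [Nat.descFactorial_eq_zero_iff_lt.2 (Finset.mem_range.1 hi)]
    simp
  rw [h0, sub_zero]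
  have h1 := (NormedSpace.expSeries_div_hasSum_exp (m * v)).mul_left (m ^ e * Real.exp (-m))
  have h2 : m ^ e * Real.exp (-m) * NormedSpace.exp (m * v)
      = m ^ e * Real.exp (-(m * (1 - v))) := by
    rw [← Real.exp_eq_exp_ℝ, mul_assoc, ← Real.exp_add]
    congr 2
    ring
  rw [h2] at h1
  refine h1.congr_fun fun k => ?_
  have h3 : ((k.factorial : ℝ)) * (k + e).descFactorial e = (k + e).factorial := by
    have := Nat.factorial_mul_descFactorial (Nat.le_add_left e k)
    rw [Nat.add_sub_cancel] at this
    exact_mod_cast this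
  have h4 : ((k + e).factorial : ℝ) ≠ 0 := by positivity
  have h5 : (k.factorial : ℝ) ≠ 0 := by positivity
  rw [Nat.add_sub_cancel, mul_pow, pow_add]
  field_simp
  rw [← h3]
  ring

lemma lintegral_poisson_descFactorial (m : ℝ≥0) (v : ℝ≥0) (hv : v ≤ 1) (e : ℕ) :
    ∫⁻ n, (n.descFactorial e : ℝ≥0∞) * (v : ℝ≥0∞) ^ (n - e) ∂(poissonMeasure m)
      = (m : ℝ≥0∞) ^ e * expNeg (m * (1 - v)) := by
  have hs := hasSum_poisson_descFactorial m v e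
  rw [lintegral_poissonMeasure]
  have : ∀ n : ℕ, ENNReal.ofReal (Real.exp (-m) * m ^ n / n.factorial) *
      ((n.descFactorial e : ℝ≥0∞) * (v : ℝ≥0∞) ^ (n - e))
      = ENNReal.ofReal (Real.exp (-m) * m ^ n / n.factorial *
        (n.descFactorial e * (v : ℝ) ^ (n - e))) := by
    intro n
    rw [ENNReal.ofReal_mul (by positivity), ENNReal.ofReal_mul (by positivity),
      ENNReal.ofReal_natCast, ENNReal.ofReal_pow (by positivity), ENNReal.ofReal_coe_nnreal]
  simp_rw [this]
  rw [← ENNReal.ofReal_tsum_of_nonneg (fun n => by positivity) hs.summable, hs.tsum_eq,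
    ENNReal.ofReal_mul (by positivity), ENNReal.ofReal_pow (by positivity),
    ENNReal.ofReal_coe_nnreal, expNeg]
  congr 4
  rw [ENNReal.toReal_mul, ENNReal.toReal_sub_of_le (by exact_mod_cast hv) (by simp)]
  simp

/-- Sum over ordered pairs of distinct points in two cells, of the product of the weights of all
other points. -/
lemma sum_pairs_prod_weight {ι : Type*} [Fintype ι] [DecidableEq ι] (S : Finset ℕ) (κ : ℕ → ι)
    (v : ι → ℝ≥0∞) (i j : ι) :
    ∑ n ∈ S, ∑ m ∈ S.erase n, (if κ n = i ∧ κ m = j then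
        ∏ k ∈ (S.erase n).erase m, v (κ k) else 0)
      = ∏ l, (((S.filter (κ · = l)).card.descFactorial
            ((if l = i then 1 else 0) + (if l = j then 1 else 0)) : ℕ) : ℝ≥0∞)
          * v l ^ ((S.filter (κ · = l)).card
            - ((if l = i then 1 else 0) + (if l = j then 1 else 0))) := by
  -- Deleting `n` and `m` takes from the fibre over `l` one point for each of `l = i` and `l = j`,
  -- so the product is the same for all admissible pairs.
  have key : ∀ n ∈ S, ∀ m ∈ S.erase n, κ n = i → κ m = j →
      ∏ k ∈ (S.erase n).erase m, v (κ k) = ∏ l, v l ^ ((S.filter (κ · = l)).card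
            - ((if l = i then 1 else 0) + (if l = j then 1 else 0))) := by
    intro n hn m hm hi hj
    rw [← Finset.prod_fiberwise_of_maps_to (g := κ) (t := Finset.univ) (by simp)]
    refine Finset.prod_congr rfl fun l _ => ?_
    rw [Finset.prod_congr rfl (g := fun _ => v l)
      (fun k hk => by rw [(Finset.mem_filter.1 hk).2]), Finset.prod_const]
    congr 1
    rw [Finset.filter_erase, Finset.filter_erase, Finset.card_erase_eq_ite,
      Finset.card_erase_eq_ite]
    simp only [Finset.mem_erase, Finset.mem_filter] at hm ⊢
    grind
  have h1 : ∑ n ∈ S, ∑ m ∈ S.erase n, (if κ n = i ∧ κ m = j then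
        ∏ k ∈ (S.erase n).erase m, v (κ k) else 0)
      = (∑ n ∈ S, ∑ m ∈ S.erase n, (if κ n = i ∧ κ m = j then 1 else 0)) *
        ∏ l, v l ^ ((S.filter (κ · = l)).card
            - ((if l = i then 1 else 0) + (if l = j then 1 else 0))) := by
    rw [Finset.sum_mul]
    refine Finset.sum_congr rfl fun n hn => ?_
    rw [Finset.sum_mul]
    refine Finset.sum_congr rfl fun m hm => ?_
    split_ifs with h
    · rw [key n hn m hm h.1 h.2, one_mul]
    · rw [zero_mul]
  rw [h1, Finset.prod_mul_distrib]
  congr 1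
  -- Once `n` is chosen over `i`, one candidate for `m` is lost exactly when `i = j`.
  have h2 : ∀ n ∈ S, ∑ m ∈ S.erase n, (if κ n = i ∧ κ m = j then (1 : ℝ≥0∞) else 0)
      = if κ n = i then (((S.filter (κ · = j)).card - (if i = j then 1 else 0) : ℕ) : ℝ≥0∞)
        else 0 := by
    intro n hn
    by_cases h : κ n = i
    · simp only [h, true_and, if_true]
      rw [Finset.sum_boole, Finset.filter_erase, Finset.card_erase_eq_ite]
      congr 1
      simp only [Finset.mem_filter, hn, h, true_and]
      split_ifs <;> simp
    · simp [h]
  rw [Finset.sum_congr rfl h2, ← Finset.sum_filter, Finset.sum_const, nsmul_eq_mul]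
  norm_cast
  by_cases hij : i = j
  · subst hij
    rw [Finset.prod_eq_single i (by intro b _ hb; simp [hb]) (by simp)]
    simp [Nat.descFactorial, mul_comm]
  · rw [← Finset.prod_subset (Finset.subset_univ {i, j}) (by
      intro b _ hb
      simp only [Finset.mem_insert, Finset.mem_singleton, not_or] at hb
      simp [hb.1, hb.2]), Finset.prod_pair hij]
    simp [hij, Ne.symm hij, Nat.descFactorial]

end MNNR

/-! ### Averaging over the marks at fixed positions -/

namespace MNNR

open scoped Classical in
/-- For a fixed sequence of positions `y` and i.i.d. marks, the sum over ordered pairs of the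
probability that the two points have prescribed marks and that no other point lies in `G`. -/
lemma tsum_pairs_marks {Ω : Type u} [MeasurableSpace Ω] {P : Measure Ω} [IsProbabilityMeasure P]
    {Z : ℕ → Ω → ℝ} {π : Measure ℝ} (hZ : ∀ n, Measurable (Z n)) (hlaw : ∀ n, HasLaw (Z n) π P)
    (hind : iIndepFun Z P) (y : ℕ → Plane)
    {ι : Type*} [Fintype ι] (B : ι → Set Plane)
    (hdisj : Pairwise fun i j => Disjoint (B i) (B j))
    (hfin : ∀ l, {k | y k ∈ B l}.Finite)
    {G : Set Atom} (hG : MeasurableSet G) (v : ι → ℝ≥0∞)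
    (hv : ∀ l, ∀ a ∈ B l, π {z | (a, z) ∉ G} = v l)
    (hout : ∀ a z, (a, z) ∈ G → ∃ l, a ∈ B l)
    (i j : ι) {M₁ M₂ : Set ℝ} (hM₁ : MeasurableSet M₁) (hM₂ : MeasurableSet M₂) :
    ∑' n, ∑' m, P {ω | n ≠ m ∧ y n ∈ B i ∧ y m ∈ B j ∧ Z n ω ∈ M₁ ∧ Z m ω ∈ M₂ ∧
        ∀ k, k ≠ n → k ≠ m → (y k, Z k ω) ∉ G}
      = π M₁ * π M₂ * ∏ l, (((({k | y k ∈ B l}.ncard).descFactorial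
            ((if l = i then 1 else 0) + (if l = j then 1 else 0)) : ℕ) : ℝ≥0∞)
          * v l ^ ({k | y k ∈ B l}.ncard
            - ((if l = i then 1 else 0) + (if l = j then 1 else 0)))) := by
  -- By `hout` a point outside all cells cannot lie in `G`, so the infinitely many constraints
  -- reduce to the finitely many indices in `S`.
  have hSfin : {k | ∃ l, y k ∈ B l}.Finite := by
    have : {k | ∃ l, y k ∈ B l} = ⋃ l, {k | y k ∈ B l} := by ext; simp
    rw [this]
    exact Set.finite_iUnion hfin
  set S := hSfin.toFinset with hS
  have hmS : ∀ k, k ∈ S ↔ ∃ l, y k ∈ B l := by simp [hS]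
  -- The default `i` is taken only off `S`, where the value plays no role.
  let κ : ℕ → ι := fun k => if h : ∃ l, y k ∈ B l then h.choose else i
  have hκ : ∀ k l, y k ∈ B l → κ k = l := by
    intro k l hl
    have h : ∃ l, y k ∈ B l := ⟨l, hl⟩
    by_contra hne
    have h1 : y k ∈ B (κ k) := by
      simp only [κ, dif_pos h]; exact h.choose_spec
    exact Set.disjoint_left.1 (hdisj hne) h1 hl
  have hκS : ∀ k ∈ S, ∀ l, κ k = l ↔ y k ∈ B l := by
    intro k hk l
    obtain ⟨l', hl'⟩ := (hmS k).1 hk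
    constructor
    · rintro rfl
      rwa [hκ k l' hl']
    · exact hκ k l
  have hcard : ∀ l, (S.filter (κ · = l)).card = {k | y k ∈ B l}.ncard := by
    intro l
    rw [← Set.ncard_coe_finset]
    congr 1
    ext k
    simp only [Finset.coe_filter, mem_ofPred_eq]
    constructor
    · rintro ⟨h1, h2⟩; exact (hκS k h1 l).1 h2
    · intro h
      have h1 : k ∈ S := (hmS k).2 ⟨l, h⟩
      exact ⟨h1, (hκS k h1 l).2 h⟩
  have hterm : ∀ n ∈ S, ∀ m ∈ S.erase n, κ n = i → κ m = j →
      P {ω | n ≠ m ∧ y n ∈ B i ∧ y m ∈ B j ∧ Z n ω ∈ M₁ ∧ Z m ω ∈ M₂ ∧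
        ∀ k, k ≠ n → k ≠ m → (y k, Z k ω) ∉ G}
      = π M₁ * π M₂ * ∏ k ∈ (S.erase n).erase m, v (κ k) := by
    intro n hn m hm hi hj
    have hnm : n ≠ m := (Finset.ne_of_mem_erase hm).symm
    have hmS' := Finset.mem_of_mem_erase hm
    -- One constraint per mark, so that independence of the marks turns the probability into a
    -- product.
    let T : ℕ → Set ℝ := fun k => if k = n then M₁ else if k = m then M₂ else {z | (y k, z) ∉ G}
    have hT : ∀ k, MeasurableSet (T k) := by
      intro k
      simp only [T]
      split_ifs
      · exact hM₁
      · exact hM₂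
      · exact (measurable_prodMk_left hG).compl
    have hset : {ω | n ≠ m ∧ y n ∈ B i ∧ y m ∈ B j ∧ Z n ω ∈ M₁ ∧ Z m ω ∈ M₂ ∧
        ∀ k, k ≠ n → k ≠ m → (y k, Z k ω) ∉ G} = ⋂ k ∈ S, Z k ⁻¹' T k := by
      ext ω
      simp only [mem_ofPred_eq, mem_iInter, mem_preimage]
      constructor
      · rintro ⟨-, -, -, h1, h2, h3⟩ k -
        simp only [T]
        split_ifs with e1 e2
        · rwa [e1]
        · rwa [e2]
        · exact h3 k e1 e2
      · intro h
        refine ⟨hnm, (hκS n hn i).1 hi, (hκS m hmS' j).1 hj, ?_, ?_, ?_⟩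
        · simpa [T] using h n hn
        · simpa [T, hnm.symm] using h m hmS'
        · intro k e1 e2
          by_cases hk : k ∈ S
          · simpa [T, e1, e2] using h k hk
          · exact fun hc => hk ((hmS k).2 (hout _ _ hc))
    rw [hset, hind.measure_inter_preimage_eq_mul S (fun k _ => hT k)]
    have hP : ∀ k, P (Z k ⁻¹' T k) = π (T k) := fun k => by
      rw [← (hlaw k).map_eq, Measure.map_apply (hZ k) (hT k)]
    simp_rw [hP]
    rw [← Finset.mul_prod_erase S _ hn, ← Finset.mul_prod_erase (S.erase n) _ hm, ← mul_assoc]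
    congr 1
    · simp [T, hnm.symm]
    · refine Finset.prod_congr rfl fun k hk => ?_
      have e1 : k ≠ m := Finset.ne_of_mem_erase hk
      have hk' := Finset.mem_of_mem_erase hk
      have e2 : k ≠ n := Finset.ne_of_mem_erase hk'
      have hk'' := Finset.mem_of_mem_erase hk'
      simp only [T, e1, e2, if_false]
      exact hv _ _ ((hκS k hk'' _).1 rfl)
  have hzero : ∀ n m, ¬ (n ∈ S ∧ m ∈ S.erase n ∧ κ n = i ∧ κ m = j) →
      P {ω | n ≠ m ∧ y n ∈ B i ∧ y m ∈ B j ∧ Z n ω ∈ M₁ ∧ Z m ω ∈ M₂ ∧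
        ∀ k, k ≠ n → k ≠ m → (y k, Z k ω) ∉ G} = 0 := by
    intro n m h
    convert measure_empty (μ := P)
    rw [Set.eq_empty_iff_forall_notMem]
    rintro ω ⟨h1, h2, h3, -⟩
    refine h ⟨(hmS n).2 ⟨_, h2⟩, Finset.mem_erase.2 ⟨h1.symm, (hmS m).2 ⟨_, h3⟩⟩, hκ _ _ h2,
      hκ _ _ h3⟩
  have hsum := sum_pairs_prod_weight S κ v i j
  simp_rw [hcard] at hsum
  rw [← hsum, Finset.mul_sum, tsum_eq_sum (s := S)]
  · refine Finset.sum_congr rfl fun n hn => ?_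
    rw [Finset.mul_sum, tsum_eq_sum (s := S.erase n)]
    · refine Finset.sum_congr rfl fun m hm => ?_
      split_ifs with h
      · exact hterm n hn m hm h.1 h.2
      · rw [mul_zero]
        exact hzero n m (fun h' => h h'.2.2)
    · intro m hm
      exact hzero n m (fun h' => hm h'.2.1)
  · intro n hn
    rw [ENNReal.tsum_eq_zero]
    intro m
    exact hzero n m (fun h' => hn h'.1)

end MNNR

/-! ### Poisson counts, and the pair formula on cells -/

namespace MNNR

lemma expNeg_zero : expNeg 0 = 1 := by simp [expNeg]

lemma expNeg_add {a b : ℝ≥0∞} (ha : a ≠ ∞) (hb : b ≠ ∞) :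
    expNeg (a + b) = expNeg a * expNeg b := by
  rw [expNeg, expNeg, expNeg, ENNReal.toReal_add ha hb, neg_add, Real.exp_add,
    ENNReal.ofReal_mul (Real.exp_nonneg _)]

lemma expNeg_sum {ι : Type*} (s : Finset ι) (a : ι → ℝ≥0∞) (ha : ∀ i ∈ s, a i ≠ ∞) :
    expNeg (∑ i ∈ s, a i) = ∏ i ∈ s, expNeg (a i) := by
  classical
  induction s using Finset.induction_on with
  | empty => simp [expNeg_zero]
  | insert i s hi ih =>
    rw [Finset.sum_insert hi, Finset.prod_insert hi, expNeg_add (ha i (by simp)) ?_,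
      ih (fun j hj => ha j (by simp [hj]))]
    exact ENNReal.sum_ne_top.2 fun j hj => ha j (by simp [hj])

variable {Ω : Type u} [MeasurableSpace Ω] {P : Measure Ω}
  {lam : ℝ} {f : ℝ → ℝ} {x : ℕ → Ω → Plane} {Z : ℕ → Ω → ℝ}

/-- The count is a series of indicators in `ℝ≥0∞`; as `ℕ∞` is countable, it is enough to pull
singletons back along the embedding. -/
lemma measurable_pointCount (hx : ∀ n, Measurable (x n)) {B : Set Plane} (hB : MeasurableSet B) :
    Measurable (pointCount x B) := by
  have h1 : Measurable fun ω => ((pointCount x B ω : ℕ∞) : ℝ≥0∞) := by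
    have : (fun ω => ((pointCount x B ω : ℕ∞) : ℝ≥0∞))
        = fun ω => ∑' n, B.indicator (fun _ => (1 : ℝ≥0∞)) (x n ω) := by
      ext ω
      rw [pointCount, ← ENNReal.tsum_set_one, tsum_subtype {n | x n ω ∈ B} (fun _ => (1 : ℝ≥0∞))]
      rfl
    rw [this]
    exact Measurable.tsum fun n => (measurable_const.indicator hB).comp (hx n)
  refine measurable_to_countable' fun c => ?_
  have : pointCount x B ⁻¹' {c} = (fun ω => ((pointCount x B ω : ℕ∞) : ℝ≥0∞)) ⁻¹' {(c : ℝ≥0∞)} := by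
    ext ω; simp
  rw [this]
  exact h1 (measurableSet_singleton _)

lemma IsHomogeneousPPP.lintegral_pointCount (h : IsHomogeneousPPP P lam x) {B : Set Plane}
    (hB : MeasurableSet B) (hb : Bornology.IsBounded B) (g : ℕ∞ → ℝ≥0∞) :
    ∫⁻ ω, g (pointCount x B ω) ∂P
      = ∫⁻ n, g (n : ℕ) ∂(poissonMeasure (ENNReal.ofReal lam * volume B).toNNReal) := by
  rw [(h.poisson B hB hb).lintegral_comp Measurable.of_discrete.aemeasurable,
    lintegral_map .of_discrete .of_discrete]

lemma ofReal_mul_volume_ne_top {B : Set Plane} (hb : Bornology.IsBounded B) :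
    ENNReal.ofReal lam * volume B ≠ ∞ :=
  ENNReal.mul_ne_top ENNReal.ofReal_ne_top hb.measure_lt_top.ne

lemma IsHomogeneousPPP.lintegral_descFactorial (h : IsHomogeneousPPP P lam x) {B : Set Plane}
    (hB : MeasurableSet B) (hb : Bornology.IsBounded B) {v : ℝ≥0∞} (hv : v ≤ 1) (e : ℕ) :
    ∫⁻ ω, (((pointCount x B ω).toNat.descFactorial e : ℕ) : ℝ≥0∞)
        * v ^ ((pointCount x B ω).toNat - e) ∂P
      = (ENNReal.ofReal lam * volume B) ^ e
        * expNeg (ENNReal.ofReal lam * volume B * (1 - v)) := by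
  rw [h.lintegral_pointCount hB hb
    (fun N => ((N.toNat.descFactorial e : ℕ) : ℝ≥0∞) * v ^ (N.toNat - e))]
  lift v to ℝ≥0 using ne_top_of_le_ne_top ENNReal.one_ne_top hv
  simp only [ENat.toNat_natCast]
  rw [lintegral_poisson_descFactorial _ _ (by exact_mod_cast hv),
    ENNReal.coe_toNNReal (ofReal_mul_volume_ne_top hb)]

/-- The law of the count is the image of a law on `ℕ` and so gives no mass to `⊤`. -/
lemma IsHomogeneousPPP.ae_finite (h : IsHomogeneousPPP P lam x) {B : Set Plane}
    (hB : MeasurableSet B) (hb : Bornology.IsBounded B) :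
    ∀ᵐ ω ∂P, {n | x n ω ∈ B}.Finite := by
  have h1 : ∫⁻ ω, (if pointCount x B ω = ⊤ then 1 else 0) ∂P = 0 := by
    rw [h.lintegral_pointCount hB hb (fun N => if N = ⊤ then 1 else 0)]
    simp
  have hm : Measurable fun ω => if pointCount x B ω = ⊤ then (1 : ℝ≥0∞) else 0 :=
    (Measurable.of_discrete (f := fun N : ℕ∞ => if N = ⊤ then (1 : ℝ≥0∞) else 0)).comp
      (measurable_pointCount h.measurable hB)
  rw [lintegral_eq_zero_iff hm] at h1
  filter_upwards [h1] with ω hω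
  by_contra hc
  have : pointCount x B ω = ⊤ := Set.encard_eq_top hc
  simp [this] at hω

/-- The case `e = 1`, `v = 1` of the Poisson moments, where the exponential factor is one. -/
lemma IsHomogeneousPPP.tsum_measure_of_isBounded (h : IsHomogeneousPPP P lam x) {B : Set Plane}
    (hB : MeasurableSet B) (hb : Bornology.IsBounded B) :
    ∑' n, P {ω | x n ω ∈ B} = ENNReal.ofReal lam * volume B := by
  have h1 := h.lintegral_descFactorial hB hb (v := 1) le_rfl 1
  simp only [Nat.descFactorial_one, one_pow, mul_one, pow_one, tsub_self, mul_zero,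
    expNeg_zero] at h1
  rw [← h1]
  have h2 : ∀ᵐ ω ∂P, (((pointCount x B ω).toNat : ℕ) : ℝ≥0∞)
      = ∑' n, B.indicator (fun _ => (1 : ℝ≥0∞)) (x n ω) := by
    filter_upwards [h.ae_finite hB hb] with ω hω
    have h3 : ∑' n, B.indicator (fun _ => (1 : ℝ≥0∞)) (x n ω) = (({n | x n ω ∈ B}.encard : ℕ∞) : ℝ≥0∞) := by
      rw [← ENNReal.tsum_set_one, tsum_subtype {n | x n ω ∈ B} (fun _ => (1 : ℝ≥0∞))]
      rfl
    rw [h3, pointCount, ← Set.Finite.cast_ncard_eq hω]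
    simp
  have hm : ∀ n, Measurable fun ω => B.indicator (fun _ => (1 : ℝ≥0∞)) (x n ω) :=
    fun n => (measurable_const.indicator hB).comp (h.measurable n)
  rw [lintegral_congr_ae h2, lintegral_tsum (fun n => (hm n).aemeasurable)]
  congr 1 with n
  exact (lintegral_indicator_one (h.measurable n hB)).symm

lemma IsHomogeneousPPP.lintegral_prod_descFactorial (h : IsHomogeneousPPP P lam x)
    {ι : Type*} [Fintype ι] {B : ι → Set Plane} (hB : ∀ l, MeasurableSet (B l))
    (hb : ∀ l, Bornology.IsBounded (B l)) (hdisj : Pairwise fun i j => Disjoint (B i) (B j))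
    {v : ι → ℝ≥0∞} (hv : ∀ l, v l ≤ 1) (e : ι → ℕ) :
    ∫⁻ ω, ∏ l, ((({k | x k ω ∈ B l}.ncard.descFactorial (e l) : ℕ) : ℝ≥0∞)
        * v l ^ ({k | x k ω ∈ B l}.ncard - e l)) ∂P
      = (∏ l, (ENNReal.ofReal lam * volume (B l)) ^ e l)
        * expNeg (∑ l, ENNReal.ofReal lam * volume (B l) * (1 - v l)) := by
  have hind : iIndepFun (fun l => pointCount x (B l)) P := by
    refine iIndepFun.of_precomp (g := (Fintype.equivFin ι).symm) (Equiv.surjective _) ?_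
    exact h.indep _ (fun i => B ((Fintype.equivFin ι).symm i)) (fun i => hB _) (fun i => hb _)
      (fun i j hij => hdisj (fun hc => hij ((Fintype.equivFin ι).symm.injective hc)))
  have h1 := lintegral_prod_eq_prod_lintegral_of_indepFun Finset.univ _
    (hind.comp (fun l (N : ℕ∞) => ((N.toNat.descFactorial (e l) : ℕ) : ℝ≥0∞)
      * v l ^ (N.toNat - e l)) (fun l => .of_discrete))
    (fun l => Measurable.of_discrete.comp (measurable_pointCount h.measurable (hB l)))
  refine h1.trans ?_
  simp only [Function.comp_apply, h.lintegral_descFactorial (hB _) (hb _) (hv _)]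
  rw [Finset.prod_mul_distrib, expNeg_sum]
  intro l _
  exact ENNReal.mul_ne_top (ofReal_mul_volume_ne_top (hb l))
    (ne_top_of_le_ne_top ENNReal.one_ne_top tsub_le_self)

/-- The event that no atom except those with indices `n`, `m` lies in `G`. -/
def noOther (x : ℕ → Ω → Plane) (Z : ℕ → Ω → ℝ) (G : Set Atom) (n m : ℕ) : Set Ω :=
  {ω | n ≠ m ∧ ∀ k, k ≠ n → k ≠ m → (x k ω, Z k ω) ∉ G}

/-- The mean measure of ordered pairs of atoms such that no other atom lies in `G`. -/
noncomputable def pairMeasure (P : Measure Ω) (x : ℕ → Ω → Plane) (Z : ℕ → Ω → ℝ) (G : Set Atom) :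
    Measure (Atom × Atom) :=
  Measure.sum fun n => Measure.sum fun m =>
    (P.restrict (noOther x Z G n m)).map (fun ω => ((x n ω, Z n ω), (x m ω, Z m ω)))

lemma pairMeasure_apply (hx : ∀ n, Measurable (x n)) (hZ : ∀ n, Measurable (Z n))
    (G : Set Atom) {C : Set (Atom × Atom)} (hC : MeasurableSet C) :
    pairMeasure P x Z G C = ∑' n, ∑' m,
      P {ω | ((x n ω, Z n ω), (x m ω, Z m ω)) ∈ C ∧ ω ∈ noOther x Z G n m} := by
  rw [pairMeasure, Measure.sum_apply _ hC]
  congr 1 with n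
  rw [Measure.sum_apply _ hC]
  congr 1 with m
  have hm : Measurable fun ω => ((x n ω, Z n ω), (x m ω, Z m ω)) :=
    ((hx n).prodMk (hZ n)).prodMk ((hx m).prodMk (hZ m))
  rw [Measure.map_apply hm hC, Measure.restrict_apply (hm hC)]
  rfl

/-- The intensity measure of the marked process on the space of atoms. -/
noncomputable def intensity (lam : ℝ) (f : ℝ → ℝ) : Measure Atom :=
  (ENNReal.ofReal lam • (volume : Measure Plane)).prod (resourceLaw f)

lemma IsMarkedPPP.isProbabilityMeasure [IsProbabilityMeasure P] (h : IsMarkedPPP P lam f x Z) :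
    IsProbabilityMeasure (resourceLaw f) :=
  (h.mark_law 0).isProbabilityMeasure_iff.1 inferInstance

/-- Positions and marks are independent, so Fubini freezes the positions. `tsum_pairs_marks`
evaluates the average over the marks, and the resulting product over cells is integrated with the
moments of independent Poisson counts. -/
lemma IsMarkedPPP.pairMeasure_cell [IsProbabilityMeasure P] (h : IsMarkedPPP P lam f x Z)
    {ι : Type*} [Fintype ι] {B : ι → Set Plane} (hB : ∀ l, MeasurableSet (B l))
    (hb : ∀ l, Bornology.IsBounded (B l)) (hdisj : Pairwise fun i j => Disjoint (B i) (B j))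
    {G : Set Atom} (hG : MeasurableSet G) (v : ι → ℝ≥0∞)
    (hv : ∀ l, ∀ a ∈ B l, resourceLaw f {z | (a, z) ∉ G} = v l) (hv1 : ∀ l, v l ≤ 1)
    (hout : ∀ a z, (a, z) ∈ G → ∃ l, a ∈ B l)
    (i j : ι) {M₁ M₂ : Set ℝ} (hM₁ : MeasurableSet M₁) (hM₂ : MeasurableSet M₂) :
    pairMeasure P x Z G ((B i ×ˢ M₁) ×ˢ (B j ×ˢ M₂))
      = resourceLaw f M₁ * resourceLaw f M₂
        * ((ENNReal.ofReal lam * volume (B i)) * (ENNReal.ofReal lam * volume (B j))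
        * expNeg (∑ l, ENNReal.ofReal lam * volume (B l) * (1 - v l))) := by
  classical
  have hx := h.positions.measurable
  have hZ := h.mark_measurable
  have hX : Measurable fun ω n => x n ω := measurable_pi_lambda _ hx
  have hZZ : Measurable fun ω n => Z n ω := measurable_pi_lambda _ hZ
  let T : ℕ → ℕ → Set ((ℕ → Plane) × (ℕ → ℝ)) := fun n m =>
    {q | n ≠ m ∧ q.1 n ∈ B i ∧ q.1 m ∈ B j ∧ q.2 n ∈ M₁ ∧ q.2 m ∈ M₂ ∧
        ∀ k, k ≠ n → k ≠ m → (q.1 k, q.2 k) ∉ G}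
  have hT : ∀ n m, MeasurableSet (T n m) := by
    intro n m
    have h1 : ∀ k, Measurable fun q : (ℕ → Plane) × (ℕ → ℝ) => q.1 k := fun k => by fun_prop
    have h2 : ∀ k, Measurable fun q : (ℕ → Plane) × (ℕ → ℝ) => q.2 k := fun k => by fun_prop
    refine (MeasurableSet.const _).inter ((h1 n (hB i)).inter ((h1 m (hB j)).inter
      ((h2 n hM₁).inter ((h2 m hM₂).inter ?_))))
    have : {q : (ℕ → Plane) × (ℕ → ℝ) | ∀ k, k ≠ n → k ≠ m → (q.1 k, q.2 k) ∉ G}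
        = ⋂ k, ⋂ (_ : k ≠ n), ⋂ (_ : k ≠ m), (fun q => (q.1 k, q.2 k)) ⁻¹' Gᶜ := by
      ext; simp
    change MeasurableSet {q : (ℕ → Plane) × (ℕ → ℝ) | ∀ k, k ≠ n → k ≠ m → (q.1 k, q.2 k) ∉ G}
    rw [this]
    exact MeasurableSet.iInter fun k => MeasurableSet.iInter fun _ =>
      MeasurableSet.iInter fun _ => ((h1 k).prodMk (h2 k)) hG.compl
  have hlaw := h.indep_positions.map_prod_eq_prod_map_map hX.aemeasurable hZZ.aemeasurable
  have hterm : ∀ n m, P {ω | ((x n ω, Z n ω), (x m ω, Z m ω)) ∈ ((B i ×ˢ M₁) ×ˢ (B j ×ˢ M₂)) ∧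
      ω ∈ noOther x Z G n m}
      = ∫⁻ ω, P {ω' | n ≠ m ∧ x n ω ∈ B i ∧ x m ω ∈ B j ∧ Z n ω' ∈ M₁ ∧ Z m ω' ∈ M₂ ∧
        ∀ k, k ≠ n → k ≠ m → (x k ω, Z k ω') ∉ G} ∂P := by
    intro n m
    have h1 : {ω | ((x n ω, Z n ω), (x m ω, Z m ω)) ∈ ((B i ×ˢ M₁) ×ˢ (B j ×ˢ M₂)) ∧
      ω ∈ noOther x Z G n m} = (fun ω => ((fun k => x k ω), (fun k => Z k ω))) ⁻¹' T n m := by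
      ext ω
      simp only [noOther, T, mem_ofPred_eq, mem_prod, mem_preimage]
      tauto
    rw [h1, ← Measure.map_apply (hX.prodMk hZZ) (hT n m), hlaw, Measure.prod_apply (hT n m),
      lintegral_map (measurable_measure_prodMk_left (hT n m)) hX]
    refine lintegral_congr fun ω => ?_
    rw [Measure.map_apply hZZ (measurable_prodMk_left (hT n m))]
    rfl
  have hmeas : ∀ n m, Measurable fun ω =>
      P {ω' | n ≠ m ∧ x n ω ∈ B i ∧ x m ω ∈ B j ∧ Z n ω' ∈ M₁ ∧ Z m ω' ∈ M₂ ∧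
        ∀ k, k ≠ n → k ≠ m → (x k ω, Z k ω') ∉ G} := by
    intro n m
    have h1 := (measurable_measure_prodMk_left (ν := P.map fun ω n => Z n ω) (hT n m)).comp hX
    convert h1 using 2 with ω
    simp only [Function.comp_apply]
    rw [Measure.map_apply hZZ (measurable_prodMk_left (hT n m))]
    rfl
  rw [pairMeasure_apply hx hZ G (((hB i).prod hM₁).prod ((hB j).prod hM₂))]
  simp_rw [hterm]
  simp_rw [← lintegral_tsum (fun m => (hmeas _ m).aemeasurable)]
  rw [← lintegral_tsum (fun n => (Measurable.tsum fun m => hmeas n m).aemeasurable)]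
  have hfin : ∀ᵐ ω ∂P, ∀ l, {k | x k ω ∈ B l}.Finite :=
    ae_all_iff.2 fun l => h.positions.ae_finite (hB l) (hb l)
  rw [lintegral_congr_ae (g := fun ω => resourceLaw f M₁ * resourceLaw f M₂ *
    ∏ l, (((({k | x k ω ∈ B l}.ncard).descFactorial
            ((if l = i then 1 else 0) + (if l = j then 1 else 0)) : ℕ) : ℝ≥0∞)
          * v l ^ ({k | x k ω ∈ B l}.ncard
            - ((if l = i then 1 else 0) + (if l = j then 1 else 0)))))]
  · have := h.isProbabilityMeasure
    rw [lintegral_const_mul' _ _ (ENNReal.mul_ne_top (measure_ne_top _ _) (measure_ne_top _ _)),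
      h.positions.lintegral_prod_descFactorial hB hb hdisj hv1]
    congr 2
    -- The exponent at `l` counts how often `l` occurs among `i` and `j`, so only the masses of
    -- these two cells survive (a square if `i = j`).
    simp_rw [pow_add, Finset.prod_mul_distrib]
    simp
  · filter_upwards [hfin] with ω hω
    exact tsum_pairs_marks hZ h.mark_law h.mark_indep (fun k => x k ω) B hdisj hω hG v hv hout
      i j hM₁ hM₂

end MNNR

/-! ### Campbell formula when a fixed finite union of boxes is avoided -/

namespace MNNR

/-- The set of points that belong to exactly those members of the family `E` indexed by `p`. -/
def patternCell {κ : Type*} (E : κ → Set Plane) (p : Finset κ) : Set Plane :=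
  {y | ∀ i, y ∈ E i ↔ i ∈ p}

lemma measurableSet_patternCell {κ : Type*} [Fintype κ] {E : κ → Set Plane}
    (hE : ∀ i, MeasurableSet (E i)) (p : Finset κ) : MeasurableSet (patternCell E p) := by
  have : patternCell E p = ⋂ i, {y | y ∈ E i ↔ i ∈ p} := by ext; simp [patternCell]
  rw [this]
  refine MeasurableSet.iInter fun i => ?_
  by_cases h : i ∈ p
  · simp only [h, iff_true]
    exact hE i
  · simp only [h, iff_false]
    exact (hE i).compl

lemma disjoint_patternCell {κ : Type*} (E : κ → Set Plane) {p q : Finset κ} (h : p ≠ q) :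
    Disjoint (patternCell E p) (patternCell E q) := by
  rw [Set.disjoint_left]
  intro y hp hq
  exact h (Finset.ext fun i => (hp i).symm.trans (hq i))

open scoped Classical in
lemma exists_mem_patternCell {κ : Type*} [Fintype κ] (E : κ → Set Plane) {y : Plane} {i : κ}
    (hy : y ∈ E i) : ∃ p : {p : Finset κ // p.Nonempty}, y ∈ patternCell E p.1 ∧ i ∈ p.1 :=
  ⟨⟨Finset.univ.filter fun i => y ∈ E i, i, by simpa⟩, fun j => by simp, by simpa⟩

variable {Ω : Type u} [MeasurableSpace Ω] {P : Measure Ω}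
  {lam : ℝ} {f : ℝ → ℝ} {x : ℕ → Ω → Plane} {Z : ℕ → Ω → ℝ}

-- The sets `B₁`, `B₂` and all `A j` are refined to the cells of the finite algebra they generate.
-- Over one cell the section of the avoided set is a fixed set of marks, so
-- `IsMarkedPPP.pairMeasure_cell` applies; both sides are additive over pairs of cells.
open scoped Classical in
lemma IsMarkedPPP.pairMeasure_prod [IsProbabilityMeasure P] (h : IsMarkedPPP P lam f x Z)
    {τ : Type*} [Fintype τ] {A : τ → Set Plane} {I : τ → Set ℝ} (hA : ∀ j, MeasurableSet (A j))
    (hAb : ∀ j, Bornology.IsBounded (A j)) (hI : ∀ j, MeasurableSet (I j))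
    {B₁ B₂ : Set Plane} {M₁ M₂ : Set ℝ} (hB₁ : MeasurableSet B₁) (hB₂ : MeasurableSet B₂)
    (hb₁ : Bornology.IsBounded B₁) (hb₂ : Bornology.IsBounded B₂)
    (hM₁ : MeasurableSet M₁) (hM₂ : MeasurableSet M₂) :
    pairMeasure P x Z (⋃ j, A j ×ˢ I j) ((B₁ ×ˢ M₁) ×ˢ (B₂ ×ˢ M₂))
      = expNeg (intensity lam f (⋃ j, A j ×ˢ I j))
        * (intensity lam f (B₁ ×ˢ M₁) * intensity lam f (B₂ ×ˢ M₂)) := by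
  have := h.isProbabilityMeasure
  set G : Set Atom := ⋃ j, A j ×ˢ I j with hGdef
  have hG : MeasurableSet G := MeasurableSet.iUnion fun j => (hA j).prod (hI j)
  let E : Option (Option τ) → Set Plane := fun o => o.elim B₁ fun o' => o'.elim B₂ A
  have hE : ∀ i, MeasurableSet (E i) := by rintro (_ | _ | j); exacts [hB₁, hB₂, hA j]
  have hEb : ∀ i, Bornology.IsBounded (E i) := by rintro (_ | _ | j); exacts [hb₁, hb₂, hAb j]
  -- The empty pattern is excluded: its cell lies outside all the sets and is unbounded.
  let ι := {p : Finset (Option (Option τ)) // p.Nonempty}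
  let B : ι → Set Plane := fun p => patternCell E p.1
  have hB : ∀ l, MeasurableSet (B l) := fun l => measurableSet_patternCell hE _
  have hBsub : ∀ l : ι, ∀ i ∈ l.1, B l ⊆ E i := fun l i hi y hy => (hy i).2 hi
  have hb : ∀ l, Bornology.IsBounded (B l) := by
    intro l
    obtain ⟨i, hi⟩ := l.2
    exact (hEb i).subset (hBsub l i hi)
  have hdisj : Pairwise fun i j => Disjoint (B i) (B j) := fun i j hij =>
    disjoint_patternCell E (fun hc => hij (Subtype.ext hc))
  let V : ι → Set ℝ := fun p => {z | ∃ j, some (some j) ∈ p.1 ∧ z ∈ I j}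
  have hV : ∀ p, MeasurableSet (V p) := by
    intro p
    have : V p = ⋃ j, ⋃ (_ : some (some j) ∈ p.1), I j := by ext; simp [V]
    rw [this]
    exact MeasurableSet.iUnion fun j => MeasurableSet.iUnion fun _ => hI j
  have hGV : ∀ l, ∀ a ∈ B l, ∀ z, (a, z) ∈ G ↔ z ∈ V l := by
    intro l a ha z
    simp only [hGdef, mem_iUnion, mem_prod, V, mem_ofPred_eq]
    refine exists_congr fun j => and_congr_left fun _ => ha (some (some j))
  have hcover : ∀ i, E i = ⋃ p ∈ Finset.univ.filter (fun p : ι => i ∈ p.1), B p := by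
    intro i
    ext y
    simp only [mem_iUnion, Finset.mem_filter, Finset.mem_univ, true_and, exists_prop]
    constructor
    · intro hy
      obtain ⟨p, hp, hi⟩ := exists_mem_patternCell E hy
      exact ⟨p, hi, hp⟩
    · rintro ⟨p, hi, hp⟩
      exact hBsub p i hi hp
  have hcell := fun i j => h.pairMeasure_cell hB hb hdisj hG (fun l => resourceLaw f (V l)ᶜ)
    (fun l a ha => by
      congr 1
      ext z
      simp [hGV l a ha])
    (fun l => prob_le_one)
    (fun a z haz => by
      simp only [hGdef, mem_iUnion, mem_prod] at haz
      obtain ⟨j, hj, -⟩ := haz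
      obtain ⟨p, hp, -⟩ := exists_mem_patternCell E (i := some (some j)) hj
      exact ⟨p, hp⟩) i j hM₁ hM₂
  have hvol : ∀ i, ENNReal.ofReal lam * volume (E i)
      = ∑ p ∈ Finset.univ.filter (fun p : ι => i ∈ p.1), ENNReal.ofReal lam * volume (B p) := by
    intro i
    rw [hcover i, measure_biUnion_finset (fun p _ q _ hpq => hdisj hpq) (fun p _ => hB p),
      Finset.mul_sum]
  have hGint : intensity lam f G = ∑ l, ENNReal.ofReal lam * volume (B l)
      * (1 - resourceLaw f (V l)ᶜ) := by
    have h1 : G = ⋃ l ∈ (Finset.univ : Finset ι), B l ×ˢ V l := by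
      ext ⟨a, z⟩
      simp only [mem_iUnion, mem_prod, Finset.mem_univ, exists_prop, true_and]
      constructor
      · intro haz
        have haz' := haz
        simp only [hGdef, mem_iUnion, mem_prod] at haz
        obtain ⟨j, hj, -⟩ := haz
        obtain ⟨p, hp, -⟩ := exists_mem_patternCell E (i := some (some j)) hj
        exact ⟨p, hp, (hGV p a hp z).1 haz'⟩
      · rintro ⟨p, hp, hz⟩
        exact (hGV p a hp z).2 hz
    rw [h1, measure_biUnion_finset (fun p _ q _ hpq => Set.disjoint_prod.2 (Or.inl (hdisj hpq)))
      (fun p _ => (hB p).prod (hV p))]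
    refine Finset.sum_congr rfl fun l _ => ?_
    rw [intensity, Measure.prod_prod, Measure.smul_apply, smul_eq_mul,
      prob_compl_eq_one_sub (hV l), ENNReal.sub_sub_cancel ENNReal.one_ne_top prob_le_one]
  have hsplit : (B₁ ×ˢ M₁) ×ˢ (B₂ ×ˢ M₂)
      = ⋃ q ∈ (Finset.univ.filter (fun p : ι => none ∈ p.1)) ×ˢ
          (Finset.univ.filter (fun p : ι => some none ∈ p.1)),
          (B q.1 ×ˢ M₁) ×ˢ (B q.2 ×ˢ M₂) := by
    have e1 : B₁ = E none := rfl
    have e2 : B₂ = E (some none) := rfl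
    rw [e1, e2, hcover none, hcover (some none)]
    ext ⟨⟨a, z⟩, ⟨b, w⟩⟩
    simp only [mem_prod, mem_iUnion, Finset.mem_product, exists_prop, Prod.exists]
    constructor
    · rintro ⟨⟨⟨p, hp, hp'⟩, hz⟩, ⟨q, hq, hq'⟩, hw⟩
      exact ⟨p, q, ⟨hp, hq⟩, ⟨hp', hz⟩, hq', hw⟩
    · rintro ⟨p, q, ⟨hp, hq⟩, ⟨hp', hz⟩, hq', hw⟩
      exact ⟨⟨⟨p, hp, hp'⟩, hz⟩, ⟨q, hq, hq'⟩, hw⟩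
  rw [hsplit, measure_biUnion_finset]
  · simp_rw [hcell]
    rw [Finset.sum_product, ← hGint]
    have e1 : intensity lam f (B₁ ×ˢ M₁) = ENNReal.ofReal lam * volume (E none)
        * resourceLaw f M₁ := by
      rw [intensity, Measure.prod_prod, Measure.smul_apply, smul_eq_mul]; rfl
    have e2 : intensity lam f (B₂ ×ˢ M₂) = ENNReal.ofReal lam * volume (E (some none))
        * resourceLaw f M₂ := by
      rw [intensity, Measure.prod_prod, Measure.smul_apply, smul_eq_mul]; rfl
    rw [e1, e2, hvol none, hvol (some none), Finset.sum_mul, Finset.sum_mul, Finset.mul_sum]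
    refine Finset.sum_congr rfl fun p _ => ?_
    rw [Finset.sum_mul, Finset.mul_sum, Finset.mul_sum]
    refine Finset.sum_congr rfl fun q _ => ?_
    ring
  · rintro ⟨p, q⟩ _ ⟨p', q'⟩ _ hne
    rw [Function.onFun, Set.disjoint_prod]
    by_cases hp : p = p'
    · have hq : q ≠ q' := fun hc => hne (by rw [hp, hc])
      exact Or.inr (Set.disjoint_prod.2 (Or.inl (hdisj hq)))
    · exact Or.inl (Set.disjoint_prod.2 (Or.inl (hdisj hp)))
  · rintro ⟨p, q⟩ _
    exact ((hB p).prod hM₁).prod ((hB q).prod hM₂)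

/-- The bounded measurable sets of positions. -/
def boundedMeasurable : Set (Set Plane) := {B | MeasurableSet B ∧ Bornology.IsBounded B}

lemma isPiSystem_boundedMeasurable : IsPiSystem boundedMeasurable :=
  fun _ hs _ ht _ => ⟨hs.1.inter ht.1, hs.2.subset inter_subset_left⟩

lemma iUnion_ball_nat : ⋃ n : ℕ, Metric.ball (0 : Plane) n = univ := Metric.iUnion_ball_nat 0

lemma ball_mem_boundedMeasurable (r : ℝ) : Metric.ball (0 : Plane) r ∈ boundedMeasurable :=
  ⟨measurableSet_ball, Metric.isBounded_ball⟩

lemma isCountablySpanning_boundedMeasurable : IsCountablySpanning boundedMeasurable :=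
  ⟨fun n : ℕ => Metric.ball 0 n, fun _ => ball_mem_boundedMeasurable _, iUnion_ball_nat⟩

lemma generateFrom_boundedMeasurable :
    MeasurableSpace.generateFrom boundedMeasurable = (inferInstance : MeasurableSpace Plane) := by
  refine le_antisymm (MeasurableSpace.generateFrom_le fun s hs => hs.1) fun s hs => ?_
  have : s = ⋃ n : ℕ, s ∩ Metric.ball (0 : Plane) n := by
    rw [← inter_iUnion, iUnion_ball_nat, inter_univ]
  rw [this]
  exact MeasurableSet.iUnion fun n => MeasurableSpace.measurableSet_generateFrom
    ⟨hs.inter measurableSet_ball, Metric.isBounded_ball.subset inter_subset_right⟩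

/-- Second order Campbell formula with an avoided set that is a finite union of bounded boxes. -/
lemma IsMarkedPPP.pairMeasure_eq [IsProbabilityMeasure P] (h : IsMarkedPPP P lam f x Z)
    {τ : Type*} [Fintype τ] {A : τ → Set Plane} {I : τ → Set ℝ} (hA : ∀ j, MeasurableSet (A j))
    (hAb : ∀ j, Bornology.IsBounded (A j)) (hI : ∀ j, MeasurableSet (I j)) :
    pairMeasure P x Z (⋃ j, A j ×ˢ I j)
      = expNeg (intensity lam f (⋃ j, A j ×ˢ I j)) •
        (intensity lam f).prod (intensity lam f) := by
  have := h.isProbabilityMeasure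
  set c := expNeg (intensity lam f (⋃ j, A j ×ˢ I j)) with hc
  have hc0 : c ≠ 0 := by rw [hc, expNeg]; simp [Real.exp_pos]
  have hc1 : c ≠ ∞ := ENNReal.ofReal_ne_top
  let R : Set (Set Atom) := image2 (· ×ˢ ·) boundedMeasurable {M : Set ℝ | MeasurableSet M}
  have hR : MeasurableSpace.generateFrom R = (inferInstance : MeasurableSpace Atom) :=
    generateFrom_eq_prod generateFrom_boundedMeasurable
      MeasurableSpace.generateFrom_measurableSet isCountablySpanning_boundedMeasurable
      isCountablySpanning_measurableSet
  have hRpi : IsPiSystem R :=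
    isPiSystem_boundedMeasurable.prod MeasurableSpace.isPiSystem_measurableSet
  have hspan : (intensity lam f).FiniteSpanningSetsIn R :=
    { set := fun n => Metric.ball 0 n ×ˢ univ
      set_mem := fun n => mem_image2_of_mem (ball_mem_boundedMeasurable _)
        (by simp)
      finite := fun n => by
        rw [intensity, Measure.prod_prod, measure_univ, mul_one]
        exact (ofReal_mul_volume_ne_top Metric.isBounded_ball).lt_top
      spanning := by rw [← iUnion_prod_const, iUnion_ball_nat, univ_prod_univ] }
  -- The uniqueness theorem identifies a plain product measure, so the factor `c`, positive and
  -- finite, is moved to the other side.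
  have key : (intensity lam f).prod (intensity lam f)
      = c⁻¹ • pairMeasure P x Z (⋃ j, A j ×ˢ I j) := by
    refine Measure.prod_eq_generateFrom hR hR hRpi hRpi hspan hspan ?_
    rintro _ ⟨B₁, hB₁, M₁, hM₁, rfl⟩ _ ⟨B₂, hB₂, M₂, hM₂, rfl⟩
    rw [Measure.smul_apply, smul_eq_mul,
      h.pairMeasure_prod hA hAb hI hB₁.1 hB₂.1 hB₁.2 hB₂.2 hM₁ hM₂, ← mul_assoc,
      ENNReal.inv_mul_cancel hc0 hc1, one_mul]
  rw [key, smul_smul, ENNReal.mul_inv_cancel hc0 hc1, one_smul]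

end MNNR

/-! ### Campbell formula when the avoided open set depends on the pair -/

namespace MNNR

lemma measurable_expNeg : Measurable expNeg := by
  unfold expNeg
  exact (Real.measurable_exp.comp ENNReal.measurable_toReal.neg).ennreal_ofReal

lemma expNeg_le_one (t : ℝ≥0∞) : expNeg t ≤ 1 := by
  rw [expNeg, ENNReal.ofReal_le_one]
  exact Real.exp_le_one_iff.2 (neg_nonpos.2 ENNReal.toReal_nonneg)

lemma tendsto_expNeg {ι : Type*} {l : Filter ι} {u : ι → ℝ≥0∞} {t : ℝ≥0∞} (ht : t ≠ ∞)
    (h : Filter.Tendsto u l (nhds t)) :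
    Filter.Tendsto (fun i => expNeg (u i)) l (nhds (expNeg t)) := by
  unfold expNeg
  exact (ENNReal.continuous_ofReal.comp Real.continuous_exp).continuousAt.tendsto.comp
    (((ENNReal.tendsto_toReal ht).comp h).neg)

lemma expNeg_anti {a b : ℝ≥0∞} (hb : b ≠ ∞) (h : a ≤ b) : expNeg b ≤ expNeg a := by
  rw [expNeg, expNeg]
  exact ENNReal.ofReal_le_ofReal (Real.exp_le_exp.2 (neg_le_neg (ENNReal.toReal_mono hb h)))

/-- A countable family of compact boxes such that every open set is the union of those
contained in it. -/
noncomputable def box (n : ℕ) : Set Atom :=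
  Metric.closedBall (TopologicalSpace.denseSeq Atom n.unpair.1) (1 / (n.unpair.2 + 1))

lemma isCompact_box (n : ℕ) : IsCompact (box n) := isCompact_closedBall _ _

lemma box_eq_prod (n : ℕ) : box n =
    Metric.closedBall (TopologicalSpace.denseSeq Atom n.unpair.1).1 (1 / (n.unpair.2 + 1)) ×ˢ
    Metric.closedBall (TopologicalSpace.denseSeq Atom n.unpair.1).2 (1 / (n.unpair.2 + 1)) := by
  rw [closedBall_prod_same]; rfl

lemma exists_box_subset {V : Set Atom} (hV : IsOpen V) {c : Atom} (hc : c ∈ V) :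
    ∃ n, c ∈ box n ∧ box n ⊆ V := by
  obtain ⟨ε, hε, hεV⟩ := Metric.isOpen_iff.1 hV c hc
  -- Half of `ε`, because the radius of the box and the distance of its centre from `c` add up.
  obtain ⟨j, hj⟩ := exists_nat_one_div_lt (half_pos hε)
  obtain ⟨i, hi⟩ := (TopologicalSpace.denseRange_denseSeq Atom).exists_dist_lt c
    (Nat.one_div_pos_of_nat (α := ℝ) (n := j))
  refine ⟨Nat.pair i j, ?_, ?_⟩
  · simp only [box, Nat.unpair_pair]
    exact hi.le
  · intro d hd
    simp only [box, Nat.unpair_pair, Metric.mem_closedBall] at hd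
    refine hεV ?_
    rw [Metric.mem_ball]
    calc dist d c ≤ dist d _ + dist (TopologicalSpace.denseSeq Atom i) c := dist_triangle _ _ _
      _ < ε := by rw [dist_comm _ c]; linarith

/-- The pairs `q` for which the box `n` lies in the section of `U` at `q`. -/
def boxInside (U : Set ((Atom × Atom) × Atom)) (n : ℕ) : Set (Atom × Atom) :=
  {q | ∀ c ∈ box n, (q, c) ∈ U}

/-- Compactness of the box is what matters: by the tube lemma, containment of the box in the section
persists for nearby pairs. -/
lemma isOpen_boxInside {U : Set ((Atom × Atom) × Atom)} (hU : IsOpen U) (n : ℕ) :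
    IsOpen (boxInside U n) := by
  rw [isOpen_iff_mem_nhds]
  intro q hq
  obtain ⟨u, v, hu, hv, hqu, hKv, huv⟩ := generalized_tube_lemma (isCompact_singleton (x := q))
    (isCompact_box n) hU (by 
      rintro ⟨q', c⟩ ⟨h1, h2⟩
      obtain rfl : q' = q := h1
      exact hq c h2)
  exact Filter.mem_of_superset (hu.mem_nhds (hqu rfl)) fun q' hq' c hc => huv ⟨hq', hKv hc⟩

/-- The union of the first `N` boxes contained in the sections of `U`. -/
def innerApprox (U : Set ((Atom × Atom) × Atom)) (N : ℕ) : Set ((Atom × Atom) × Atom) :=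
  {t | ∃ n < N, t.1 ∈ boxInside U n ∧ t.2 ∈ box n}

lemma measurableSet_innerApprox {U : Set ((Atom × Atom) × Atom)} (hU : IsOpen U) (N : ℕ) :
    MeasurableSet (innerApprox U N) := by
  have : innerApprox U N = ⋃ n, ⋃ (_ : n < N), boxInside U n ×ˢ box n := by
    ext; simp [innerApprox, and_left_comm]
  rw [this]
  exact MeasurableSet.iUnion fun n => MeasurableSet.iUnion fun _ =>
    (isOpen_boxInside hU n).measurableSet.prod (isCompact_box n).measurableSet

lemma monotone_innerApprox (U : Set ((Atom × Atom) × Atom)) : Monotone (innerApprox U) :=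
  fun _ _ h _ ⟨n, hn, ht⟩ => ⟨n, hn.trans_le h, ht⟩

lemma iUnion_innerApprox {U : Set ((Atom × Atom) × Atom)} (hU : IsOpen U) :
    ⋃ N, innerApprox U N = U := by
  ext ⟨q, c⟩
  simp only [mem_iUnion]
  constructor
  · rintro ⟨N, n, -, h1, h2⟩
    exact h1 c h2
  · intro h
    obtain ⟨n, hn, hn'⟩ := exists_box_subset (hU.preimage (Continuous.prodMk_right q)) h
    exact ⟨n + 1, n, n.lt_succ_self, fun c hc => hn' hc, hn⟩

variable {Ω : Type u} [MeasurableSpace Ω] {P : Measure Ω}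
  {lam : ℝ} {f : ℝ → ℝ} {x : ℕ → Ω → Plane} {Z : ℕ → Ω → ℝ}

/-- The indexed ordered pairs `(n, m)` of different atoms such that no other atom lies in the
section of `U` at the pair. -/
def avoidEvent (x : ℕ → Ω → Plane) (Z : ℕ → Ω → ℝ) (U : Set ((Atom × Atom) × Atom)) :
    Set ((ℕ × ℕ) × Ω) :=
  {t | t.1.1 ≠ t.1.2 ∧ ∀ k, k ≠ t.1.1 → k ≠ t.1.2 →
    (((x t.1.1 t.2, Z t.1.1 t.2), (x t.1.2 t.2, Z t.1.2 t.2)), (x k t.2, Z k t.2)) ∉ U}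

/-- The pair of atoms with given indices. -/
def atomPair (x : ℕ → Ω → Plane) (Z : ℕ → Ω → ℝ) (t : (ℕ × ℕ) × Ω) : Atom × Atom :=
  ((x t.1.1 t.2, Z t.1.1 t.2), (x t.1.2 t.2, Z t.1.2 t.2))

lemma measurable_atomPair (hx : ∀ n, Measurable (x n)) (hZ : ∀ n, Measurable (Z n)) :
    Measurable (atomPair x Z) := by
  refine measurable_from_prod_countable_right fun q => ?_
  exact ((hx q.1).prodMk (hZ q.1)).prodMk ((hx q.2).prodMk (hZ q.2))

lemma measurableSet_avoidEvent (hx : ∀ n, Measurable (x n)) (hZ : ∀ n, Measurable (Z n))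
    {U : Set ((Atom × Atom) × Atom)} (hU : MeasurableSet U) :
    MeasurableSet (avoidEvent x Z U) := by
  have hat : ∀ k, Measurable fun t : (ℕ × ℕ) × Ω => (x k t.2, Z k t.2) := fun k =>
    ((hx k).comp measurable_snd).prodMk ((hZ k).comp measurable_snd)
  have hN : ∀ p : ℕ × ℕ → Prop, MeasurableSet {t : (ℕ × ℕ) × Ω | p t.1} := fun p =>
    measurable_fst (MeasurableSet.of_discrete (s := {q | p q}))
  have : avoidEvent x Z U = {t | t.1.1 ≠ t.1.2} ∩ ⋂ k, ({t | k = t.1.1} ∪ {t | k = t.1.2} ∪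
      (fun t => (atomPair x Z t, (x k t.2, Z k t.2))) ⁻¹' Uᶜ) := by
    ext t
    simp only [avoidEvent, atomPair, mem_inter_iff, mem_iInter, mem_union, mem_ofPred_eq,
      mem_preimage, mem_compl_iff]
    refine and_congr_right fun _ => forall_congr' fun k => ?_
    tauto
  rw [this]
  refine (hN fun q => q.1 ≠ q.2).inter (MeasurableSet.iInter fun k =>
    ((hN fun q => k = q.1).union (hN fun q => k = q.2)).union ?_)
  exact ((measurable_atomPair hx hZ).prodMk (hat k)) hU.compl

/-- The mean measure of ordered pairs of atoms such that no other atom lies in the section of `U`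
at the pair. -/
noncomputable def avoidMeasure (P : Measure Ω) (x : ℕ → Ω → Plane) (Z : ℕ → Ω → ℝ)
    (U : Set ((Atom × Atom) × Atom)) : Measure (Atom × Atom) :=
  (((Measure.count : Measure (ℕ × ℕ)).prod P).restrict (avoidEvent x Z U)).map (atomPair x Z)

lemma avoidMeasure_apply (hx : ∀ n, Measurable (x n)) (hZ : ∀ n, Measurable (Z n))
    (U : Set ((Atom × Atom) × Atom)) {C : Set (Atom × Atom)} (hC : MeasurableSet C) :
    avoidMeasure P x Z U C = ((Measure.count : Measure (ℕ × ℕ)).prod P)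
      (atomPair x Z ⁻¹' C ∩ avoidEvent x Z U) := by
  have hm := measurable_atomPair hx hZ
  rw [avoidMeasure, Measure.map_apply hm hC, Measure.restrict_apply (hm hC)]

lemma avoidMeasure_apply_tsum [IsProbabilityMeasure P] (hx : ∀ n, Measurable (x n))
    (hZ : ∀ n, Measurable (Z n)) {U : Set ((Atom × Atom) × Atom)} (hU : MeasurableSet U)
    {C : Set (Atom × Atom)} (hC : MeasurableSet C) :
    avoidMeasure P x Z U C = ∑' n, ∑' m,
      P {ω | ((x n ω, Z n ω), (x m ω, Z m ω)) ∈ C ∧ ((n, m), ω) ∈ avoidEvent x Z U} := by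
  rw [avoidMeasure_apply hx hZ U hC, Measure.prod_apply
    ((measurable_atomPair hx hZ hC).inter (measurableSet_avoidEvent hx hZ hU)), lintegral_count]
  exact ENNReal.tsum_prod (f := fun n m =>
    P {ω | ((x n ω, Z n ω), (x m ω, Z m ω)) ∈ C ∧ ((n, m), ω) ∈ avoidEvent x Z U})

lemma avoidMeasure_const [IsProbabilityMeasure P] (hx : ∀ n, Measurable (x n))
    (hZ : ∀ n, Measurable (Z n)) {G : Set Atom} (hG : MeasurableSet G) :
    avoidMeasure P x Z (univ ×ˢ G) = pairMeasure P x Z G := by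
  ext C hC
  rw [avoidMeasure_apply_tsum hx hZ (MeasurableSet.univ.prod hG) hC, pairMeasure_apply hx hZ G hC]
  simp [avoidEvent, noOther]

lemma measurable_expNeg_section [SFinite (intensity lam f)] {U : Set ((Atom × Atom) × Atom)}
    (hU : MeasurableSet U) :
    Measurable fun q => expNeg (intensity lam f {c | (q, c) ∈ U}) :=
  measurable_expNeg.comp (measurable_measure_prodMk_left hU)

lemma measurableSet_fiber_boxes {U : Set ((Atom × Atom) × Atom)} (hU : IsOpen U) (N : ℕ)
    (I : Finset ℕ) :
    MeasurableSet {q : Atom × Atom | ∀ n < N, q ∈ boxInside U n ↔ n ∈ I} := by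
  have : {q : Atom × Atom | ∀ n < N, q ∈ boxInside U n ↔ n ∈ I}
      = ⋂ n, ⋂ (_ : n < N), {q | q ∈ boxInside U n ↔ n ∈ I} := by ext; simp
  rw [this]
  refine MeasurableSet.iInter fun n => MeasurableSet.iInter fun _ => ?_
  by_cases h : n ∈ I
  · simp only [h, iff_true]; exact (isOpen_boxInside hU n).measurableSet
  · simp only [h, iff_false]; exact (isOpen_boxInside hU n).measurableSet.compl

lemma IsMarkedPPP.sigmaFinite_intensity [IsProbabilityMeasure P] (h : IsMarkedPPP P lam f x Z) :
    SigmaFinite (intensity lam f) := by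
  have := h.isProbabilityMeasure
  unfold intensity
  have : SigmaFinite (ENNReal.ofReal lam • (volume : Measure Plane)) :=
    inferInstanceAs (SigmaFinite ((lam.toNNReal : ℝ≥0) • (volume : Measure Plane)))
  infer_instance

-- The section at `q` is determined by which of the first `N` boxes it contains. This splits the
-- pairs into finitely many measurable pieces `S I`, on each of which the avoided set is a fixed
-- union of boxes and `IsMarkedPPP.pairMeasure_eq` applies.
open scoped Classical in
lemma IsMarkedPPP.avoidMeasure_innerApprox [IsProbabilityMeasure P]
    (h : IsMarkedPPP P lam f x Z) {U : Set ((Atom × Atom) × Atom)} (hU : IsOpen U) (N : ℕ)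
    {C : Set (Atom × Atom)} (hC : MeasurableSet C) :
    avoidMeasure P x Z (innerApprox U N) C
      = ∫⁻ q in C, expNeg (intensity lam f {c | (q, c) ∈ innerApprox U N})
          ∂((intensity lam f).prod (intensity lam f)) := by
  have hx := h.positions.measurable
  have hZ := h.mark_measurable
  have := h.sigmaFinite_intensity
  let S : Finset ℕ → Set (Atom × Atom) := fun I => {q | ∀ n < N, q ∈ boxInside U n ↔ n ∈ I}
  have hS : ∀ I, MeasurableSet (S I) := measurableSet_fiber_boxes hU N
  let 𝓘 := (Finset.range N).powerset
  have hcov : C = ⋃ I ∈ 𝓘, C ∩ S I := by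
    ext q
    simp only [mem_iUnion, mem_inter_iff, exists_prop]
    constructor
    · intro hq
      refine ⟨(Finset.range N).filter (q ∈ boxInside U ·), ?_, hq, ?_⟩
      · simp [𝓘, Finset.filter_subset]
      · intro n hn
        simp [hn]
    · rintro ⟨I, -, hq, -⟩
      exact hq
  have hdisj : (↑𝓘 : Set (Finset ℕ)).PairwiseDisjoint fun I => C ∩ S I := by
    intro I hI J hJ hIJ
    refine Set.disjoint_left.2 fun q hq hq' => hIJ ?_
    simp only [𝓘, Finset.coe_powerset, Set.mem_preimage] at hI hJ
    ext n
    constructor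
    · intro hn
      have hnN := Finset.mem_range.1 (hI hn)
      exact (hq'.2 n hnN).1 ((hq.2 n hnN).2 hn)
    · intro hn
      have hnN := Finset.mem_range.1 (hJ hn)
      exact (hq.2 n hnN).1 ((hq'.2 n hnN).2 hn)
  have hsec : ∀ I ∈ 𝓘, ∀ q ∈ S I, ∀ c, (q, c) ∈ innerApprox U N ↔ c ∈ ⋃ j : I, box j := by
    intro I hI q hq c
    simp only [innerApprox, mem_ofPred_eq, mem_iUnion]
    constructor
    · rintro ⟨n, hn, h1, h2⟩
      exact ⟨⟨n, (hq n hn).1 h1⟩, h2⟩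
    · rintro ⟨⟨n, hn⟩, h2⟩
      have hnN := Finset.mem_range.1 (Finset.mem_powerset.1 hI hn)
      exact ⟨n, hnN, (hq n hnN).2 hn, h2⟩
  have hG : ∀ I : Finset ℕ, MeasurableSet (⋃ j : I, box j) := fun I =>
    MeasurableSet.iUnion fun j => (isCompact_box j).measurableSet
  have hpart : ∀ I ∈ 𝓘, avoidMeasure P x Z (innerApprox U N) (C ∩ S I)
      = ∫⁻ q in C ∩ S I, expNeg (intensity lam f {c | (q, c) ∈ innerApprox U N})
          ∂((intensity lam f).prod (intensity lam f)) := by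
    intro I hI
    have e1 : avoidMeasure P x Z (innerApprox U N) (C ∩ S I)
        = avoidMeasure P x Z (univ ×ˢ (⋃ j : I, box j)) (C ∩ S I) := by
      rw [avoidMeasure_apply hx hZ _ (hC.inter (hS I)), avoidMeasure_apply hx hZ _ (hC.inter (hS I))]
      congr 1
      ext t
      simp only [mem_inter_iff, mem_preimage]
      refine and_congr_right fun ht => ?_
      simp only [avoidEvent, mem_ofPred_eq]
      refine and_congr_right fun _ => forall_congr' fun k => forall_congr' fun _ =>
        forall_congr' fun _ => not_congr ?_
      exact (hsec I hI _ ht.2 _).trans (by simp)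
    have e2 : (⋃ j : I, box j) = ⋃ j : I,
        Metric.closedBall (TopologicalSpace.denseSeq Atom (j : ℕ).unpair.1).1
          (1 / ((j : ℕ).unpair.2 + 1)) ×ˢ
        Metric.closedBall (TopologicalSpace.denseSeq Atom (j : ℕ).unpair.1).2
          (1 / ((j : ℕ).unpair.2 + 1)) := iUnion_congr fun j => box_eq_prod j
    have e3 : pairMeasure P x Z (⋃ j : I, box j)
        = expNeg (intensity lam f (⋃ j : I, box j)) •
          (intensity lam f).prod (intensity lam f) := by
      rw [e2]
      exact h.pairMeasure_eq (fun j => Metric.isClosed_closedBall.measurableSet)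
        (fun j => Metric.isBounded_closedBall) (fun j => Metric.isClosed_closedBall.measurableSet)
    rw [e1, avoidMeasure_const hx hZ (hG I), e3, Measure.smul_apply, smul_eq_mul,
      ← setLIntegral_const]
    refine setLIntegral_congr_fun (hC.inter (hS I)) fun q hq => ?_
    congr 2
    ext c
    exact (hsec I hI q hq.2 c).symm
  conv_lhs => rw [hcov]
  conv_rhs => rw [hcov]
  rw [measure_biUnion_finset hdisj (fun I _ => hC.inter (hS I)),
    lintegral_biUnion_finset hdisj (fun I _ => hC.inter (hS I))]
  exact Finset.sum_congr rfl hpart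

/-- Second order Campbell formula: the sections of the open set `U` are to be avoided by all other
atoms. -/
lemma IsMarkedPPP.avoidMeasure_of_isOpen [IsProbabilityMeasure P]
    (h : IsMarkedPPP P lam f x Z) {U : Set ((Atom × Atom) × Atom)} (hU : IsOpen U)
    (hfin : ∀ q, intensity lam f {c | (q, c) ∈ U} ≠ ∞) :
    avoidMeasure P x Z U = ((intensity lam f).prod (intensity lam f)).withDensity
      fun q => expNeg (intensity lam f {c | (q, c) ∈ U}) := by
  have hx := h.positions.measurable
  have hZ := h.mark_measurable
  have := h.sigmaFinite_intensity
  have := h.isProbabilityMeasure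
  set ν := intensity lam f with hν
  -- An exhaustion by sets of finite measure: continuity from above and the dominating constant 1
  -- both require finiteness.
  let T : ℕ → Set (Atom × Atom) := fun i =>
    (Metric.ball 0 i ×ˢ univ) ×ˢ (Metric.ball 0 i ×ˢ univ)
  have hT : ∀ i, MeasurableSet (T i) := fun i =>
    (measurableSet_ball.prod MeasurableSet.univ).prod (measurableSet_ball.prod MeasurableSet.univ)
  have hTfin : ∀ i, (ν.prod ν) (T i) ≠ ∞ := by
    intro i
    have : ν (Metric.ball 0 i ×ˢ univ) ≠ ∞ := by
      rw [hν, intensity, Measure.prod_prod, measure_univ, mul_one]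
      exact ofReal_mul_volume_ne_top Metric.isBounded_ball
    rw [Measure.prod_prod]
    exact ENNReal.mul_ne_top this this
  have hTcov : ⋃ i, T i = univ := by
    rw [eq_univ_iff_forall]
    rintro ⟨⟨a, z⟩, ⟨b, w⟩⟩
    obtain ⟨i, hi⟩ := exists_nat_gt (max (dist a 0) (dist b 0))
    exact mem_iUnion.2 ⟨i, ⟨⟨(le_max_left _ _).trans_lt hi, mem_univ _⟩,
      ⟨(le_max_right _ _).trans_lt hi, mem_univ _⟩⟩⟩
  rw [Measure.ext_iff_of_iUnion_eq_univ hTcov]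
  intro i
  ext C' hC'
  rw [Measure.restrict_apply hC', Measure.restrict_apply hC']
  have hC : MeasurableSet (C' ∩ T i) := hC'.inter (hT i)
  have hCfin : (ν.prod ν) (C' ∩ T i) ≠ ∞ :=
    ne_top_of_le_ne_top (hTfin i) (measure_mono inter_subset_right)
  generalize C' ∩ T i = C at hC hCfin
  rw [withDensity_apply _ hC]
  have hmono := monotone_innerApprox U
  have hlhs : Filter.Tendsto (fun N => avoidMeasure P x Z (innerApprox U N) C) Filter.atTop
      (nhds (avoidMeasure P x Z U C)) := by
    simp_rw [avoidMeasure_apply hx hZ _ hC]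
    have e : atomPair x Z ⁻¹' C ∩ avoidEvent x Z U
        = ⋂ N, (atomPair x Z ⁻¹' C ∩ avoidEvent x Z (innerApprox U N)) := by
      rw [← inter_iInter]
      congr 1
      ext t
      have hmem : ∀ p, p ∈ U ↔ ∃ N, p ∈ innerApprox U N := fun p => by
        rw [← mem_iUnion, iUnion_innerApprox hU]
      simp only [avoidEvent, mem_iInter, mem_ofPred_eq, hmem, not_exists]
      constructor
      · rintro ⟨h1, h2⟩ N
        exact ⟨h1, fun k e1 e2 => h2 k e1 e2 N⟩
      · intro h'
        exact ⟨(h' 0).1, fun k e1 e2 N => (h' N).2 k e1 e2⟩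
    rw [e]
    refine tendsto_measure_iInter_atTop (fun N => ((measurable_atomPair hx hZ hC).inter
      (measurableSet_avoidEvent hx hZ (measurableSet_innerApprox hU N))).nullMeasurableSet) ?_ ?_
    · intro N N' hNN t ht
      exact ⟨ht.1, ht.2.1, fun k e1 e2 hc => ht.2.2 k e1 e2 (hmono hNN hc)⟩
    -- Continuity from above needs one finite term; at `N = 0` the value is at most the measure of
    -- `C`, since `expNeg` is at most one.
    · refine ⟨0, ?_⟩
      rw [← avoidMeasure_apply hx hZ _ hC, h.avoidMeasure_innerApprox hU 0 hC]
      refine ne_top_of_le_ne_top hCfin ?_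
      calc _ ≤ ∫⁻ q in C, 1 ∂(ν.prod ν) := lintegral_mono fun q => expNeg_le_one _
        _ = _ := by simp
  have hrhs : Filter.Tendsto (fun N => ∫⁻ q in C, expNeg (ν {c | (q, c) ∈ innerApprox U N})
      ∂(ν.prod ν)) Filter.atTop (nhds (∫⁻ q in C, expNeg (ν {c | (q, c) ∈ U}) ∂(ν.prod ν))) := by
    refine tendsto_lintegral_of_dominated_convergence (fun _ => 1)
      (fun N => measurable_expNeg_section (measurableSet_innerApprox hU N))
      (fun N => Filter.Eventually.of_forall fun q => expNeg_le_one _) (by simpa using hCfin)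
      (Filter.Eventually.of_forall fun q => tendsto_expNeg (hfin q) ?_)
    have e : {c | (q, c) ∈ U} = ⋃ N, {c | (q, c) ∈ innerApprox U N} := by
      ext c
      rw [mem_ofPred_eq, mem_iUnion]
      conv_lhs => rw [← iUnion_innerApprox hU]
      simp
    rw [e]
    exact tendsto_measure_iUnion_atTop fun N N' hNN c hc => hmono hNN hc
  refine tendsto_nhds_unique hlhs (hrhs.congr fun N => ?_)
  exact (h.avoidMeasure_innerApprox hU N hC).symm

end MNNR

/-! ### Hyperbolic balls and spheres -/

namespace MNNR

/-- The squared Euclidean distance of two points of the half-space. -/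
noncomputable def sqDist (a b : Atom) : ℝ := dist a.1 b.1 ^ 2 + (a.2 - b.2) ^ 2

lemma sqDist_comm (a b : Atom) : sqDist a b = sqDist b a := by
  unfold sqDist; rw [dist_comm]; ring

lemma sqDist_nonneg (a b : Atom) : 0 ≤ sqDist a b := by unfold sqDist; positivity

lemma hypDistOf_eq {s z z' : ℝ} (hz : 0 < z) (hz' : 0 < z') :
    hypDistOf s z z' = Real.arcosh (1 + (s ^ 2 + (z - z') ^ 2) / (2 * z * z')) := by
  unfold hypDistOf
  congr 1
  field_simp
  ring

/-- The inverse hyperbolic cosine is increasing on [1, ∞), and the common factor 2 `a.2` of the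
denominators cancels. This leaves a polynomial condition, from which openness and measurability are
immediate. -/
lemma hypDist_lt_hypDist_iff {a b c : Atom} (ha : 0 < a.2) (hb : 0 < b.2) (hc : 0 < c.2) :
    hypDist a b < hypDist a c ↔ c.2 * sqDist a b < b.2 * sqDist a c := by
  unfold hypDist
  rw [hypDistOf_eq ha hb, hypDistOf_eq ha hc]
  have h1 : 0 ≤ sqDist a b / (2 * a.2 * b.2) := div_nonneg (sqDist_nonneg _ _) (by positivity)
  have h2 : 0 ≤ sqDist a c / (2 * a.2 * c.2) := div_nonneg (sqDist_nonneg _ _) (by positivity)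
  unfold sqDist at h1 h2 ⊢
  rw [Real.arcosh_lt_arcosh (by linarith) (by linarith), add_lt_add_iff_left,
    div_lt_div_iff₀ (by positivity) (by positivity)]
  constructor
  · intro h
    refine lt_of_mul_lt_mul_left (a := 2 * a.2) ?_ (by positivity)
    linarith
  · intro h
    have := mul_lt_mul_of_pos_left h (show 0 < 2 * a.2 by positivity)
    linarith

/-- The triples `((a, b), c)` of points of the half-space such that `c` lies in the open ball around
`a` or `b` for which the hyperbolic cosine of the radius is that of the distance of `a` and `b`,
increased by `ε`. -/
def openBalls (ε : ℝ) : Set ((Atom × Atom) × Atom) :=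
  {t | (0 < t.1.1.2 ∧ 0 < t.1.2.2 ∧ 0 < t.2.2) ∧
    (t.1.2.2 * sqDist t.1.1 t.2 < t.2.2 * (sqDist t.1.1 t.1.2 + 2 * ε * t.1.1.2 * t.1.2.2) ∨
    t.1.1.2 * sqDist t.1.2 t.2 < t.2.2 * (sqDist t.1.1 t.1.2 + 2 * ε * t.1.1.2 * t.1.2.2))}

/-- The triples `((a, b), c)` of points of the half-space such that `c` lies in the closed ball
around `a` or `b` whose radius is the distance of `a` and `b`. -/
def closedBalls : Set ((Atom × Atom) × Atom) :=
  {t | (0 < t.1.1.2 ∧ 0 < t.1.2.2 ∧ 0 < t.2.2) ∧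
    (t.1.2.2 * sqDist t.1.1 t.2 ≤ t.2.2 * sqDist t.1.1 t.1.2 ∨
    t.1.1.2 * sqDist t.1.2 t.2 ≤ t.2.2 * sqDist t.1.1 t.1.2)}

lemma isOpen_openBalls (ε : ℝ) : IsOpen (openBalls ε) := by
  unfold openBalls sqDist
  have h1 : IsOpen {t : (Atom × Atom) × Atom | 0 < t.1.1.2} := isOpen_lt (by fun_prop) (by fun_prop)
  have h2 : IsOpen {t : (Atom × Atom) × Atom | 0 < t.1.2.2} := isOpen_lt (by fun_prop) (by fun_prop)
  have h3 : IsOpen {t : (Atom × Atom) × Atom | 0 < t.2.2} := isOpen_lt (by fun_prop) (by fun_prop)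
  have h4 : IsOpen {t : (Atom × Atom) × Atom | t.1.2.2 * (dist t.1.1.1 t.2.1 ^ 2 +
      (t.1.1.2 - t.2.2) ^ 2) < t.2.2 * (dist t.1.1.1 t.1.2.1 ^ 2 + (t.1.1.2 - t.1.2.2) ^ 2
        + 2 * ε * t.1.1.2 * t.1.2.2)} := isOpen_lt (by fun_prop) (by fun_prop)
  have h5 : IsOpen {t : (Atom × Atom) × Atom | t.1.1.2 * (dist t.1.2.1 t.2.1 ^ 2 +
      (t.1.2.2 - t.2.2) ^ 2) < t.2.2 * (dist t.1.1.1 t.1.2.1 ^ 2 + (t.1.1.2 - t.1.2.2) ^ 2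
        + 2 * ε * t.1.1.2 * t.1.2.2)} := isOpen_lt (by fun_prop) (by fun_prop)
  exact (h1.inter (h2.inter h3)).inter (h4.union h5)

lemma openBalls_mono {ε ε' : ℝ} (h : ε ≤ ε') : openBalls ε ⊆ openBalls ε' := by
  rintro ⟨⟨a, b⟩, c⟩ ⟨⟨ha, hb, hc⟩, ht⟩
  simp only at ha hb hc ht
  have h1 : c.2 * (sqDist a b + 2 * ε * a.2 * b.2) ≤ c.2 * (sqDist a b + 2 * ε' * a.2 * b.2) := by
    gcongr
  exact ⟨⟨ha, hb, hc⟩, ht.imp (fun h => h.trans_le h1) (fun h => h.trans_le h1)⟩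

lemma openBalls_zero_subset : openBalls 0 ⊆ closedBalls := by
  rintro ⟨⟨a, b⟩, c⟩ ⟨hp, ht⟩
  simp only [mul_zero, zero_mul, add_zero] at ht
  exact ⟨hp, ht.imp le_of_lt le_of_lt⟩

lemma closedBalls_subset {ε : ℝ} (hε : 0 < ε) : closedBalls ⊆ openBalls ε := by
  rintro ⟨⟨a, b⟩, c⟩ ⟨⟨ha, hb, hc⟩, ht⟩
  simp only at ha hb hc ht
  have h1 : c.2 * sqDist a b < c.2 * (sqDist a b + 2 * ε * a.2 * b.2) := by
    have : 0 < c.2 * (2 * ε * a.2 * b.2) := by positivity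
    linarith
  exact ⟨⟨ha, hb, hc⟩, ht.imp (fun h => h.trans_lt h1) (fun h => h.trans_lt h1)⟩

lemma iInter_openBalls : ⋂ j : ℕ, openBalls (1 / ((j : ℝ) + 1)) = closedBalls := by
  refine subset_antisymm ?_ (subset_iInter fun j => closedBalls_subset Nat.one_div_pos_of_nat)
  rintro ⟨⟨a, b⟩, c⟩ ht
  rw [mem_iInter] at ht
  have hp := (ht 0).1
  refine ⟨hp, ?_⟩
  obtain ⟨ha, hb, hc⟩ := hp
  simp only at ha hb hc ⊢
  by_contra! hcon
  obtain ⟨h1, h2⟩ := hcon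
  -- The smaller of the two gaps by which `c` misses the closed balls; dividing it by 2 `a.2` `b.2`
  -- `c.2` gives an ε whose enlarged balls still miss `c`.
  set δ := min (b.2 * sqDist a c - c.2 * sqDist a b) (a.2 * sqDist b c - c.2 * sqDist a b)
    with hδ
  have hδ0 : 0 < δ := lt_min (by linarith) (by linarith)
  obtain ⟨j, hj⟩ := exists_nat_one_div_lt (show 0 < δ / (2 * a.2 * b.2 * c.2) by positivity)
  rw [lt_div_iff₀ (by positivity)] at hj
  have h3 := min_le_left (b.2 * sqDist a c - c.2 * sqDist a b)
    (a.2 * sqDist b c - c.2 * sqDist a b)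
  have h4 := min_le_right (b.2 * sqDist a c - c.2 * sqDist a b)
    (a.2 * sqDist b c - c.2 * sqDist a b)
  rw [← hδ] at h3 h4
  have h5 : c.2 * (sqDist a b + 2 * (1 / ((j : ℝ) + 1)) * a.2 * b.2)
      = c.2 * sqDist a b + 1 / ((j : ℝ) + 1) * (2 * a.2 * b.2 * c.2) := by ring
  rcases (ht j).2 with h | h <;> simp only at h <;> rw [h5] at h <;> linarith

lemma measurableSet_closedBalls : MeasurableSet closedBalls := by
  rw [← iInter_openBalls]
  exact MeasurableSet.iInter fun j => (isOpen_openBalls _).measurableSet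

/-- A strict sublevel set of the squared distance to `a` relative to the height has bounded
projection to the plane. -/
lemma dist_le_of_mul_sqDist_lt {a c : Atom} {w K : ℝ} (hw : 0 < w)
    (h : w * sqDist a c < c.2 * K) :
    dist c.1 a.1 ≤ Real.sqrt ((K ^ 2 / (4 * w) + K * a.2) / w) := by
  refine Real.le_sqrt_of_sq_le ?_
  rw [le_div_iff₀ hw]
  unfold sqDist at h
  -- Completing the square in the height: K²/(4w) + K `a.2` is the maximum over u of uK - w(`a.2` -
  -- u)².
  have h1 : K ^ 2 / (4 * w) - (c.2 - a.2) * K + w * (a.2 - c.2) ^ 2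
      = w * (a.2 - c.2 + K / (2 * w)) ^ 2 := by
    field_simp
    ring
  have h2 : 0 ≤ w * (a.2 - c.2 + K / (2 * w)) ^ 2 := by positivity
  rw [dist_comm]
  nlinarith

variable {lam : ℝ} {f : ℝ → ℝ}

lemma intensity_openBalls_ne_top [IsProbabilityMeasure (resourceLaw f)] (ε : ℝ) (q : Atom × Atom) :
    intensity lam f {c | (q, c) ∈ openBalls ε} ≠ ∞ := by
  obtain ⟨a, b⟩ := q
  by_cases hab : 0 < a.2 ∧ 0 < b.2
  · obtain ⟨ha, hb⟩ := hab
    set K := sqDist a b + 2 * ε * a.2 * b.2 with hK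
    have hsub : {c | ((a, b), c) ∈ openBalls ε} ⊆
        (Metric.closedBall a.1 (Real.sqrt ((K ^ 2 / (4 * b.2) + K * a.2) / b.2)) ∪
        Metric.closedBall b.1 (Real.sqrt ((K ^ 2 / (4 * a.2) + K * b.2) / a.2))) ×ˢ univ := by
      rintro c ⟨-, h | h⟩
      · exact ⟨Or.inl (dist_le_of_mul_sqDist_lt hb h), mem_univ _⟩
      · exact ⟨Or.inr (dist_le_of_mul_sqDist_lt ha h), mem_univ _⟩
    refine ne_top_of_le_ne_top ?_ (measure_mono hsub)
    rw [intensity, Measure.prod_prod, measure_univ, mul_one]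
    exact ofReal_mul_volume_ne_top (Metric.isBounded_closedBall.union Metric.isBounded_closedBall)
  · convert ENNReal.zero_ne_top
    convert measure_empty (μ := intensity lam f)
    rw [Set.eq_empty_iff_forall_notMem]
    rintro c ⟨⟨h1, h2, -⟩, -⟩
    exact hab ⟨h1, h2⟩

/-- Hyperbolic spheres are null sets of the intensity measure. -/
lemma intensity_sphere [IsProbabilityMeasure (resourceLaw f)] (a : Atom) {w : ℝ} (hw : 0 < w)
    (K : ℝ) : intensity lam f {c | w * sqDist a c = c.2 * K} = 0 := by
  have hm : MeasurableSet {c : Atom | w * sqDist a c = c.2 * K} := by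
    unfold sqDist
    exact (isClosed_eq (by fun_prop) (by fun_prop)).measurableSet
  have : SFinite (ENNReal.ofReal lam • (volume : Measure Plane)) := inferInstance
  rw [intensity, Measure.prod_apply_symm hm, lintegral_eq_zero_iff (measurable_measure_prodMk_right hm)]
  refine Filter.Eventually.of_forall fun z => ?_
  -- A horizontal slice of the sphere lies in a circle, which is null in the plane.
  have hsub : (fun y : Plane => (y, z)) ⁻¹' {c : Atom | w * sqDist a c = c.2 * K}
      ⊆ Metric.sphere a.1 (Real.sqrt (z * K / w - (a.2 - z) ^ 2)) := by
    intro y hy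
    have hy' : w * (dist a.1 y ^ 2 + (a.2 - z) ^ 2) = z * K := hy
    rw [Metric.mem_sphere, dist_comm, ← hy', mul_div_cancel_left₀ _ hw.ne', add_sub_cancel_right,
      Real.sqrt_sq dist_nonneg]
  refine measure_mono_null hsub ?_
  rw [Measure.smul_apply, Measure.addHaar_sphere, smul_zero]

/-- The two sections differ only by points of two spheres, or are both empty if a mark of the pair
is not positive. -/
lemma intensity_closedBalls [IsProbabilityMeasure (resourceLaw f)] (q : Atom × Atom) :
    intensity lam f {c | (q, c) ∈ closedBalls} = intensity lam f {c | (q, c) ∈ openBalls 0} := by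
  obtain ⟨a, b⟩ := q
  refine le_antisymm ?_ (measure_mono fun c hc => openBalls_zero_subset hc)
  by_cases hab : 0 < a.2 ∧ 0 < b.2
  · obtain ⟨ha, hb⟩ := hab
    have hsub : {c | ((a, b), c) ∈ closedBalls} ⊆ {c | ((a, b), c) ∈ openBalls 0} ∪
        ({c | b.2 * sqDist a c = c.2 * sqDist a b} ∪ {c | a.2 * sqDist b c = c.2 * sqDist a b}) := by
      rintro c ⟨hp, h⟩
      simp only at h
      by_cases h1 : b.2 * sqDist a c = c.2 * sqDist a b
      · exact Or.inr (Or.inl h1)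
      by_cases h2 : a.2 * sqDist b c = c.2 * sqDist a b
      · exact Or.inr (Or.inr h2)
      refine Or.inl ⟨hp, ?_⟩
      simp only [mul_zero, zero_mul, add_zero]
      exact h.imp (fun h => lt_of_le_of_ne h h1) (fun h => lt_of_le_of_ne h h2)
    refine (measure_mono hsub).trans ((measure_union_le _ _).trans ?_)
    rw [measure_union_null (intensity_sphere a hb _) (intensity_sphere b ha _), add_zero]
  · refine measure_mono ?_
    rintro c ⟨⟨h1, h2, -⟩, -⟩
    exact absurd ⟨h1, h2⟩ hab

end MNNR

/-! ### Mutually nearest pairs, cooperating atoms and singles -/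

set_option linter.unusedSectionVars false

namespace MNNR

variable {Ω : Type u} [MeasurableSpace Ω] {P : Measure Ω}
  {lam : ℝ} {f : ℝ → ℝ} {x : ℕ → Ω → Plane} {Z : ℕ → Ω → ℝ}

/-- The density of ordered pairs of atoms that are mutually nearest neighbours. -/
noncomputable def pairWeight (lam : ℝ) (f : ℝ → ℝ) (q : Atom × Atom) : ℝ≥0∞ :=
  expNeg (intensity lam f {c | (q, c) ∈ openBalls 0})

lemma measurable_pairWeight [SFinite (intensity lam f)] : Measurable (pairWeight lam f) :=
  measurable_expNeg_section (isOpen_openBalls 0).measurableSet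

lemma avoidEvent_anti {U V : Set ((Atom × Atom) × Atom)} (h : U ⊆ V) :
    avoidEvent x Z V ⊆ avoidEvent x Z U :=
  fun _ ht => ⟨ht.1, fun k e1 e2 hc => ht.2 k e1 e2 (h hc)⟩

lemma avoidMeasure_anti (hx : ∀ n, Measurable (x n)) (hZ : ∀ n, Measurable (Z n))
    {U V : Set ((Atom × Atom) × Atom)} (h : U ⊆ V) {C : Set (Atom × Atom)}
    (hC : MeasurableSet C) : avoidMeasure P x Z V C ≤ avoidMeasure P x Z U C := by
  rw [avoidMeasure_apply hx hZ _ hC, avoidMeasure_apply hx hZ _ hC]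
  exact measure_mono (inter_subset_inter_right _ (avoidEvent_anti h))

/-- Mean number of ordered pairs of mutually nearest neighbours. -/
lemma IsMarkedPPP.avoidMeasure_closedBalls [IsProbabilityMeasure P]
    (h : IsMarkedPPP P lam f x Z) {C : Set (Atom × Atom)} (hC : MeasurableSet C) :
    avoidMeasure P x Z closedBalls C
      = ∫⁻ q in C, pairWeight lam f q ∂((intensity lam f).prod (intensity lam f)) := by
  have hx := h.positions.measurable
  have hZ := h.mark_measurable
  have := h.sigmaFinite_intensity
  have := h.isProbabilityMeasure
  have hopen : ∀ ε, avoidMeasure P x Z (openBalls ε) C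
      = ∫⁻ q in C, expNeg (intensity lam f {c | (q, c) ∈ openBalls ε})
        ∂((intensity lam f).prod (intensity lam f)) := fun ε => by
    rw [h.avoidMeasure_of_isOpen (isOpen_openBalls ε) (intensity_openBalls_ne_top ε),
      withDensity_apply _ hC]
  -- Avoiding the closed balls is harder than avoiding the open ones of radius R and easier than
  -- avoiding slightly larger open ones. The larger ones shrink to the closed balls, whose intensity
  -- equals that of the open balls.
  refine le_antisymm ?_ ?_
  · exact (avoidMeasure_anti hx hZ openBalls_zero_subset hC).trans_eq (hopen 0)
  · have hanti : Antitone fun j : ℕ => openBalls (1 / ((j : ℝ) + 1)) := fun i j hij =>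
      openBalls_mono (Nat.one_div_le_one_div hij)
    have hlim : Filter.Tendsto (fun j : ℕ => ∫⁻ q in C,
        expNeg (intensity lam f {c | (q, c) ∈ openBalls (1 / ((j : ℝ) + 1))})
        ∂((intensity lam f).prod (intensity lam f))) Filter.atTop
        (nhds (∫⁻ q in C, pairWeight lam f q ∂((intensity lam f).prod (intensity lam f)))) := by
      refine lintegral_tendsto_of_tendsto_of_monotone
        (fun j => (measurable_expNeg_section (isOpen_openBalls _).measurableSet).aemeasurable)
        (Filter.Eventually.of_forall fun q i j hij => expNeg_anti (intensity_openBalls_ne_top _ q)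
          (measure_mono fun c hc => hanti hij hc))
        (Filter.Eventually.of_forall fun q => ?_)
      refine tendsto_expNeg (intensity_openBalls_ne_top _ q) ?_
      rw [← intensity_closedBalls]
      have e : {c | (q, c) ∈ closedBalls}
          = ⋂ j : ℕ, {c | (q, c) ∈ openBalls (1 / ((j : ℝ) + 1))} := by
        ext c
        rw [← iInter_openBalls]
        simp
      rw [e]
      refine tendsto_measure_iInter_atTop (fun j => ?_) (fun i j hij c hc => hanti hij hc)
        ⟨0, intensity_openBalls_ne_top _ q⟩
      exact (measurable_prodMk_left (isOpen_openBalls _).measurableSet).nullMeasurableSet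
    refine le_of_tendsto' hlim fun j => ?_
    rw [← hopen]
    exact avoidMeasure_anti hx hZ (closedBalls_subset Nat.one_div_pos_of_nat) hC

/-- The positions of the atoms are almost surely pairwise different. -/
lemma IsMarkedPPP.ae_injective [IsProbabilityMeasure P] (h : IsMarkedPPP P lam f x Z) :
    ∀ᵐ ω ∂P, Function.Injective fun n => x n ω := by
  have hx := h.positions.measurable
  have hZ := h.mark_measurable
  have := h.sigmaFinite_intensity
  have := h.isProbabilityMeasure
  have hC : MeasurableSet {q : Atom × Atom | q.1.1 = q.2.1} :=
    (isClosed_eq (by fun_prop) (by fun_prop)).measurableSet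
  -- With nothing to avoid, the formula gives the product measure Λ ⊗ Λ, under which pairs with
  -- equal positions are null.
  have h0 : avoidMeasure P x Z ∅ {q : Atom × Atom | q.1.1 = q.2.1} = 0 := by
    rw [h.avoidMeasure_of_isOpen isOpen_empty (by simp)]
    refine withDensity_absolutelyContinuous _ _ ?_
    rw [Measure.measure_prod_null hC]
    refine Filter.Eventually.of_forall fun a => ?_
    have : Prod.mk a ⁻¹' {q : Atom × Atom | q.1.1 = q.2.1} = {a.1} ×ˢ univ := by
      ext b
      simp [eq_comm]
    simp only [this, Pi.zero_apply]
    rw [intensity, Measure.prod_prod, Measure.smul_apply, measure_singleton, smul_zero,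
      zero_mul]
  rw [avoidMeasure_apply_tsum hx hZ MeasurableSet.empty hC, ENNReal.tsum_eq_zero] at h0
  have h1 : ∀ n m, ∀ᵐ ω ∂P, ¬ (x n ω = x m ω ∧ n ≠ m) := by
    intro n m
    have := ENNReal.tsum_eq_zero.1 (h0 n) m
    rw [ae_iff]
    refine measure_mono_null (fun ω hω => ?_) this
    simp only [mem_ofPred_eq, not_not] at hω
    exact ⟨hω.1, hω.2, fun _ _ _ => id⟩
  filter_upwards [ae_all_iff.2 fun n => ae_all_iff.2 (h1 n)] with ω hω n m hnm
  by_contra hne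
  exact hω n m ⟨hnm, hne⟩

/-- The event that the atoms with indices `n` and `m` cooperate, for pairwise different
positions. -/
def coopEvent (D : Set (ℝ × ℝ)) (x : ℕ → Ω → Plane) (Z : ℕ → Ω → ℝ) (n m : ℕ) : Set Ω :=
  {ω | (Z n ω, Z m ω) ∈ D ∧ ((n, m), ω) ∈ avoidEvent x Z closedBalls}

lemma measurableSet_coopEvent (hx : ∀ n, Measurable (x n)) (hZ : ∀ n, Measurable (Z n))
    {D : Set (ℝ × ℝ)} (hD : MeasurableSet D) (n m : ℕ) :
    MeasurableSet (coopEvent D x Z n m) :=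
  (((hZ n).prodMk (hZ m)) hD).inter
    (measurable_prodMk_left (measurableSet_avoidEvent hx hZ measurableSet_closedBalls))

/-- A nearest neighbour is a strict minimiser, so ties must be excluded; this is why the balls to be
avoided are closed. -/
lemma mem_avoidEvent_closedBalls_iff (hpos : ∀ n ω, 0 < Z n ω) (n m : ℕ) (ω : Ω) :
    ((n, m), ω) ∈ avoidEvent x Z closedBalls ↔ n ≠ m ∧ ∀ k, k ≠ n → k ≠ m →
      hypDist (x n ω, Z n ω) (x m ω, Z m ω) < hypDist (x n ω, Z n ω) (x k ω, Z k ω) ∧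
      hypDist (x m ω, Z m ω) (x n ω, Z n ω) < hypDist (x m ω, Z m ω) (x k ω, Z k ω) := by
  simp only [avoidEvent, closedBalls, mem_ofPred_eq, hpos, true_and, and_true, not_or, not_le]
  refine and_congr_right fun _ => forall_congr' fun k => forall_congr' fun _ =>
    forall_congr' fun _ => ?_
  rw [hypDist_lt_hypDist_iff (hpos _ _) (hpos _ _) (hpos _ _),
    hypDist_lt_hypDist_iff (hpos _ _) (hpos _ _) (hpos _ _),
    sqDist_comm (x m ω, Z m ω) (x n ω, Z n ω)]

/-- Injectivity of the positions allows passing from points of the configuration to indices: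
distinct indices are then distinct atoms. -/
lemma cooperate_iff (hpos : ∀ n ω, 0 < Z n ω) {D : Set (ℝ × ℝ)} {ω : Ω}
    (hinj : Function.Injective fun n => x n ω) (n m : ℕ) :
    Cooperate D (configuration x Z ω) (x n ω, Z n ω) (x m ω, Z m ω) ↔ ω ∈ coopEvent D x Z n m := by
  have hne : ∀ i j, (x i ω, Z i ω) ≠ (x j ω, Z j ω) ↔ i ≠ j := fun i j =>
    not_congr ⟨fun h => hinj (Prod.ext_iff.1 h).1, fun h => by rw [h]⟩
  have hmem : ∀ n, (x n ω, Z n ω) ∈ configuration x Z ω := fun n => ⟨n, rfl⟩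
  have hforall : ∀ p : Atom → Prop, (∀ c ∈ configuration x Z ω, p c) ↔ ∀ k, p (x k ω, Z k ω) :=
    fun p => forall_mem_range
  unfold coopEvent
  rw [mem_ofPred_eq, mem_avoidEvent_closedBalls_iff hpos]
  unfold Cooperate IsNearestNeighbor
  simp only [hforall, hne, hmem, true_and]
  constructor
  · rintro ⟨h1, ⟨-, h2⟩, ⟨-, h3⟩, h4⟩
    exact ⟨h4, h1, fun k e1 e2 => ⟨h2 k e1 e2, h3 k e2 e1⟩⟩
  · rintro ⟨h4, h1, h2⟩
    exact ⟨h1, ⟨h1.symm, fun k e1 e2 => (h2 k e1 e2).1⟩, ⟨h1, fun k e1 e2 => (h2 k e2 e1).2⟩, h4⟩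

/-- Of two different partners each would be strictly nearer than the other. -/
lemma coopEvent_unique (hpos : ∀ n ω, 0 < Z n ω) {D : Set (ℝ × ℝ)} {ω : Ω} {n m m' : ℕ}
    (h : ω ∈ coopEvent D x Z n m) (h' : ω ∈ coopEvent D x Z n m') : m = m' := by
  by_contra hne
  have h1 := (mem_avoidEvent_closedBalls_iff hpos n m ω).1 h.2
  have h2 := (mem_avoidEvent_closedBalls_iff hpos n m' ω).1 h'.2
  exact lt_asymm (h1.2 m' h2.1.symm (Ne.symm hne)).1 (h2.2 m h1.1.symm hne).1

open scoped Classical in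
lemma countIn_eq_tsum {ω : Ω} (hinj : Function.Injective fun n => x n ω) (ψ : Set Atom)
    (hψ : ψ ⊆ configuration x Z ω) (A : Set Plane) :
    countIn ψ A = ∑' n, if (x n ω, Z n ω) ∈ ψ ∧ x n ω ∈ A then 1 else 0 := by
  have hinj' : Function.Injective fun n => (x n ω, Z n ω) := fun i j hij =>
    hinj (Prod.ext_iff.1 hij).1
  have e : {a ∈ ψ | a.1 ∈ A} = (fun n => (x n ω, Z n ω)) ''
      {n | (x n ω, Z n ω) ∈ ψ ∧ x n ω ∈ A} := by
    ext a
    simp only [mem_ofPred_eq, mem_image]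
    constructor
    · rintro ⟨h1, h2⟩
      obtain ⟨n, rfl⟩ := hψ h1
      exact ⟨n, ⟨h1, h2⟩, rfl⟩
    · rintro ⟨n, h, rfl⟩
      exact h
  rw [countIn, e, hinj'.encard_image, ← ENNReal.tsum_set_one,
    tsum_subtype {n | (x n ω, Z n ω) ∈ ψ ∧ x n ω ∈ A} (fun _ => (1 : ℝ≥0∞))]
  exact tsum_congr fun n => indicator_apply _ _ _

lemma mem_cooperating_iff (hpos : ∀ n ω, 0 < Z n ω) {D : Set (ℝ × ℝ)} {ω : Ω}
    (hinj : Function.Injective fun n => x n ω) (n : ℕ) :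
    (x n ω, Z n ω) ∈ cooperating D (configuration x Z ω) ↔ ∃ m, ω ∈ coopEvent D x Z n m := by
  simp only [← cooperate_iff hpos hinj]
  constructor
  · rintro ⟨-, b, ⟨m, rfl⟩, h⟩
    exact ⟨m, h⟩
  · rintro ⟨m, h⟩
    exact ⟨⟨n, rfl⟩, _, ⟨m, rfl⟩, h⟩

/-- The event that the atom with index `n` cooperates. -/
def someCoop (D : Set (ℝ × ℝ)) (x : ℕ → Ω → Plane) (Z : ℕ → Ω → ℝ) (n : ℕ) : Set Ω :=
  ⋃ m, coopEvent D x Z n m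

lemma measurableSet_someCoop (hx : ∀ n, Measurable (x n)) (hZ : ∀ n, Measurable (Z n))
    {D : Set (ℝ × ℝ)} (hD : MeasurableSet D) (n : ℕ) : MeasurableSet (someCoop D x Z n) :=
  MeasurableSet.iUnion fun m => measurableSet_coopEvent hx hZ hD n m

lemma IsMarkedPPP.ae_countIn_cooperating [IsProbabilityMeasure P] (h : IsMarkedPPP P lam f x Z)
    (D : Set (ℝ × ℝ)) (A : Set Plane) :
    ∀ᵐ ω ∂P, countIn (cooperating D (configuration x Z ω)) A
      = ∑' n, (x n ⁻¹' A ∩ someCoop D x Z n).indicator 1 ω := by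
  classical
  filter_upwards [h.ae_injective] with ω hω
  rw [countIn_eq_tsum hω _ (fun a ha => ha.1)]
  refine tsum_congr fun n => ?_
  rw [indicator_apply, mem_cooperating_iff h.mark_pos hω]
  simp [someCoop, and_comm]

lemma IsMarkedPPP.ae_countIn_singles [IsProbabilityMeasure P] (h : IsMarkedPPP P lam f x Z)
    (D : Set (ℝ × ℝ)) (A : Set Plane) :
    ∀ᵐ ω ∂P, countIn (singles D (configuration x Z ω)) A
      = ∑' n, (x n ⁻¹' A ∩ (someCoop D x Z n)ᶜ).indicator 1 ω := by
  classical
  filter_upwards [h.ae_injective] with ω hω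
  rw [countIn_eq_tsum hω _ (fun a ha => ha.1)]
  refine tsum_congr fun n => ?_
  have hs : (x n ω, Z n ω) ∈ singles D (configuration x Z ω) ↔
      ¬ (x n ω, Z n ω) ∈ cooperating D (configuration x Z ω) := by
    have hmem : (x n ω, Z n ω) ∈ configuration x Z ω := ⟨n, rfl⟩
    simp [singles, cooperating, hmem]
  rw [indicator_apply, hs, mem_cooperating_iff h.mark_pos hω]
  simp [someCoop, and_comm]

/-- The mean measure of the positions of the atoms whose index `n` belongs to the event `E n`. -/
noncomputable def positionMeasure (P : Measure Ω) (x : ℕ → Ω → Plane) (E : ℕ → Set Ω) :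
    Measure Plane :=
  Measure.sum fun n => (P.restrict (E n)).map (x n)

lemma positionMeasure_apply (hx : ∀ n, Measurable (x n)) (E : ℕ → Set Ω) {A : Set Plane}
    (hA : MeasurableSet A) : positionMeasure P x E A = ∑' n, P (x n ⁻¹' A ∩ E n) := by
  rw [positionMeasure, Measure.sum_apply _ hA]
  refine tsum_congr fun n => ?_
  rw [Measure.map_apply (hx n) hA, Measure.restrict_apply (hx n hA)]

lemma lintegral_tsum_indicator {E : ℕ → Set Ω} (hE : ∀ n, MeasurableSet (E n)) :
    ∫⁻ ω, ∑' n, (E n).indicator 1 ω ∂P = ∑' n, P (E n) := by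
  rw [lintegral_tsum fun n => (measurable_one.indicator (hE n)).aemeasurable]
  exact tsum_congr fun n => lintegral_indicator_one (hE n)

/-- Poisson counts are prescribed on bounded sets only, hence the localisation to balls. -/
lemma IsMarkedPPP.positionMeasure_univ [IsProbabilityMeasure P] (h : IsMarkedPPP P lam f x Z) :
    positionMeasure P x (fun _ => univ) = ENNReal.ofReal lam • volume := by
  have hx := h.positions.measurable
  rw [Measure.ext_iff_of_iUnion_eq_univ (Metric.iUnion_ball_nat (0 : Plane))]
  intro i
  ext A hA
  rw [Measure.restrict_apply hA, Measure.restrict_apply hA,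
    positionMeasure_apply hx _ (hA.inter measurableSet_ball)]
  simp only [inter_univ]
  exact h.positions.tsum_measure_of_isBounded (hA.inter measurableSet_ball)
    (Metric.isBounded_ball.subset inter_subset_right)

lemma IsMarkedPPP.meanCooperating_eq [IsProbabilityMeasure P] (h : IsMarkedPPP P lam f x Z)
    {D : Set (ℝ × ℝ)} (hD : MeasurableSet D) {A : Set Plane} (hA : MeasurableSet A) :
    AEMeasurable (fun ω => countIn (cooperating D (configuration x Z ω)) A) P ∧
    meanCooperating P D x Z A = positionMeasure P x (someCoop D x Z) A := by
  have hx := h.positions.measurable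
  have hE : ∀ n, MeasurableSet (x n ⁻¹' A ∩ someCoop D x Z n) := fun n =>
    (hx n hA).inter (measurableSet_someCoop hx h.mark_measurable hD n)
  refine ⟨⟨_, Measurable.tsum fun n => measurable_one.indicator (hE n),
    h.ae_countIn_cooperating D A⟩, ?_⟩
  rw [meanCooperating, lintegral_congr_ae (h.ae_countIn_cooperating D A),
    lintegral_tsum_indicator hE, positionMeasure_apply hx _ hA]

lemma IsMarkedPPP.meanSingles_eq [IsProbabilityMeasure P] (h : IsMarkedPPP P lam f x Z)
    {D : Set (ℝ × ℝ)} (hD : MeasurableSet D) {A : Set Plane} (hA : MeasurableSet A) :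
    AEMeasurable (fun ω => countIn (singles D (configuration x Z ω)) A) P ∧
    meanSingles P D x Z A = positionMeasure P x (fun n => (someCoop D x Z n)ᶜ) A := by
  have hx := h.positions.measurable
  have hE : ∀ n, MeasurableSet (x n ⁻¹' A ∩ (someCoop D x Z n)ᶜ) := fun n =>
    (hx n hA).inter (measurableSet_someCoop hx h.mark_measurable hD n).compl
  refine ⟨⟨_, Measurable.tsum fun n => measurable_one.indicator (hE n),
    h.ae_countIn_singles D A⟩, ?_⟩
  rw [meanSingles, lintegral_congr_ae (h.ae_countIn_singles D A),
    lintegral_tsum_indicator hE, positionMeasure_apply hx _ hA]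

lemma IsMarkedPPP.positionMeasure_add [IsProbabilityMeasure P] (h : IsMarkedPPP P lam f x Z)
    {D : Set (ℝ × ℝ)} (hD : MeasurableSet D) :
    positionMeasure P x (fun n => (someCoop D x Z n)ᶜ) + positionMeasure P x (someCoop D x Z)
      = ENNReal.ofReal lam • volume := by
  have hx := h.positions.measurable
  rw [← h.positionMeasure_univ]
  ext A hA
  rw [Measure.add_apply, positionMeasure_apply hx _ hA, positionMeasure_apply hx _ hA,
    positionMeasure_apply hx _ hA, ← ENNReal.tsum_add]
  refine tsum_congr fun n => ?_
  rw [add_comm, inter_univ, ← sdiff_eq]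
  exact measure_inter_add_sdiff _ (measurableSet_someCoop hx h.mark_measurable hD n)

/-- Since a partner is unique, the events over different `m` are disjoint. Counting cooperating
atoms is therefore counting ordered cooperating pairs by their first member. -/
lemma IsMarkedPPP.positionMeasure_someCoop [IsProbabilityMeasure P] (h : IsMarkedPPP P lam f x Z)
    {D : Set (ℝ × ℝ)} (hD : MeasurableSet D) {A : Set Plane} (hA : MeasurableSet A) :
    positionMeasure P x (someCoop D x Z) A
      = ∫⁻ q in {q : Atom × Atom | q.1.1 ∈ A ∧ (q.1.2, q.2.2) ∈ D}, pairWeight lam f q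
        ∂((intensity lam f).prod (intensity lam f)) := by
  have hx := h.positions.measurable
  have hZ := h.mark_measurable
  have hC : MeasurableSet {q : Atom × Atom | q.1.1 ∈ A ∧ (q.1.2, q.2.2) ∈ D} :=
    ((measurable_fst.comp measurable_fst) hA).inter
      (((measurable_snd.comp measurable_fst).prodMk (measurable_snd.comp measurable_snd)) hD)
  rw [← h.avoidMeasure_closedBalls hC, avoidMeasure_apply_tsum hx hZ measurableSet_closedBalls hC,
    positionMeasure_apply hx _ hA]
  refine tsum_congr fun n => ?_
  rw [someCoop, inter_iUnion, measure_iUnion]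
  · refine tsum_congr fun m => ?_
    congr 1
    ext ω
    simp [coopEvent, and_assoc]
  · intro m m' hne
    exact Set.disjoint_left.2 fun ω hω hω' => hne (coopEvent_unique h.mark_pos hω.2 hω'.2)
  · exact fun m => (hx n hA).inter (measurableSet_coopEvent hx hZ hD n m)

end MNNR

/-! ### Orthonormal coordinates along the line of centres -/

namespace MNNR

/-- The linear map of the coordinate plane with the given coefficients. -/
def planeMap (a b c d : ℝ) : ℝ × ℝ → ℝ × ℝ := fun p => (a * p.1 + b * p.2, c * p.1 + d * p.2)

lemma measurePreserving_planeMap {a b c d : ℝ} (h : |a * d - b * c| = 1) :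
    MeasurePreserving (planeMap a b c d) := by
  let L := Matrix.toLin (Module.Basis.finTwoProd ℝ) (Module.Basis.finTwoProd ℝ) !![a, b; c, d]
  have hL : ⇑L = planeMap a b c d := by
    ext p <;> simp [L, planeMap, Matrix.toLin_finTwoProd_apply]
  have hdet : LinearMap.det L = a * d - b * c := by
    simp only [L, LinearMap.det_toLin]
    rw [Matrix.det_fin_two_of]
  refine ⟨by unfold planeMap; fun_prop, ?_⟩
  have h0 : LinearMap.det L ≠ 0 := by
    rw [hdet]
    intro hc
    rw [hc] at h
    simp at h
  rw [← hL, Measure.map_linearMap_addHaar_eq_smul_addHaar _ h0, hdet, abs_inv, h]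
  simp

/-- The point of the plane with given coordinates. -/
noncomputable def toPlane (p : ℝ × ℝ) : Plane := !₂[p.1, p.2]

lemma measurePreserving_toPlane : MeasurePreserving toPlane := by
  have h1 := (volume_preserving_finTwoArrow ℝ).symm
  exact (PiLp.volume_preserving_toLp (Fin 2)).comp h1

lemma exists_unit_coords {y₁ y₂ : Plane} {s : ℝ} (hs : 0 < s) (h : dist y₁ y₂ = s) :
    ∃ p q : ℝ, p ^ 2 + q ^ 2 = 1 ∧ y₂ 0 = y₁ 0 + s * p ∧ y₂ 1 = y₁ 1 + s * q := by
  refine ⟨(y₂ 0 - y₁ 0) / s, (y₂ 1 - y₁ 1) / s, ?_, ?_, ?_⟩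
  · rw [EuclideanSpace.dist_eq, Fin.sum_univ_two, Real.dist_eq, Real.dist_eq, sq_abs, sq_abs] at h
    rw [div_pow, div_pow, ← add_div, div_eq_one_iff_eq (by positivity), ← h,
      Real.sq_sqrt (by positivity)]
    ring
  · field_simp
    ring
  · field_simp
    ring

lemma dist_sq_plane (y y' : Plane) : dist y y' ^ 2 = (y 0 - y' 0) ^ 2 + (y 1 - y' 1) ^ 2 := by
  rw [EuclideanSpace.dist_eq, Fin.sum_univ_two, Real.dist_eq, Real.dist_eq, sq_abs, sq_abs,
    Real.sq_sqrt (by positivity)]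

/-- Orthonormal coordinates `(w, (α, β))` with origin `(y₁, c₁)`, first axis towards `(y₂, c₂)`,
and third axis horizontal. -/
lemma exists_adapted_coordinates {y₁ y₂ : Plane} {c₁ c₂ s d : ℝ} (hs : 0 < s)
    (h : dist y₁ y₂ = s) (hd : 0 < d) (hd2 : d ^ 2 = s ^ 2 + (c₂ - c₁) ^ 2) :
    ∃ T : ℝ × (ℝ × ℝ) → Atom, MeasurePreserving T ∧
      (∀ w p, (T (w, p)).2 = c₁ + w * ((c₂ - c₁) / d) - p.1 * (s / d)) ∧
      (∀ w p, dist y₁ (T (w, p)).1 ^ 2 + ((T (w, p)).2 - c₁) ^ 2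
        = w ^ 2 + (p.1 ^ 2 + p.2 ^ 2)) ∧
      (∀ w p, dist y₂ (T (w, p)).1 ^ 2 + ((T (w, p)).2 - c₂) ^ 2
        = (w - d) ^ 2 + (p.1 ^ 2 + p.2 ^ 2)) := by
  obtain ⟨p, q, hpq, h0, h1⟩ := exists_unit_coords hs h
  set co := (c₂ - c₁) / d with hco
  set si := s / d with hsi
  have hcd : co * d = c₂ - c₁ := div_mul_cancel₀ _ hd.ne'
  have hsd : si * d = s := div_mul_cancel₀ _ hd.ne'
  have hcs : co ^ 2 + si ^ 2 = 1 := by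
    rw [hco, hsi, div_pow, div_pow, ← add_div, div_eq_one_iff_eq (by positivity)]
    linarith
  -- Acts in the vertical plane through both centres, sending (w, α) to (horizontal, vertical)
  -- components; it is a reflection, of determinant -1.
  let R : ℝ × ℝ → ℝ × ℝ := planeMap si co co (-si)
  have hR : MeasurePreserving R := measurePreserving_planeMap (by
    rw [show si * -si - co * co = -1 by linarith]; simp)
  -- Rotates the horizontal plane so that the first axis points from `y₁` to `y₂`.
  let Q : ℝ × ℝ → ℝ × ℝ := planeMap p (-q) q p
  have hQ : MeasurePreserving Q := measurePreserving_planeMap (by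
    rw [show p * p - -q * q = 1 by linarith]; simp)
  have m1 : MeasurePreserving (MeasurableEquiv.prodAssoc.symm : ℝ × (ℝ × ℝ) ≃ᵐ (ℝ × ℝ) × ℝ) :=
    volume_preserving_prodAssoc.symm _
  have m2 : MeasurePreserving (Prod.map R (id : ℝ → ℝ)) := hR.prod (MeasurePreserving.id _)
  have m3 : MeasurePreserving (MeasurableEquiv.prodAssoc : (ℝ × ℝ) × ℝ ≃ᵐ ℝ × (ℝ × ℝ)) :=
    volume_preserving_prodAssoc
  have m4 : MeasurePreserving (Prod.map (id : ℝ → ℝ) (Prod.swap : ℝ × ℝ → ℝ × ℝ)) :=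
    (MeasurePreserving.id _).prod Measure.measurePreserving_swap
  have m5 : MeasurePreserving (Prod.map Q (id : ℝ → ℝ)) := hQ.prod (MeasurePreserving.id _)
  have m6 : MeasurePreserving (Prod.map (fun p => y₁ + toPlane p) (fun z : ℝ => c₁ + z)) :=
    ((measurePreserving_add_left volume y₁).comp measurePreserving_toPlane).prod
      (measurePreserving_add_left volume c₁)
  have hT := m6.comp (m5.comp (m1.comp (m4.comp (m3.comp (m2.comp m1)))))
  refine ⟨_, hT, ?_, ?_, ?_⟩
  · rintro w ⟨α, β⟩
    simp [R, planeMap, MeasurableEquiv.prodAssoc]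
    ring
  · rintro w ⟨α, β⟩
    rw [dist_sq_plane]
    simp [R, Q, planeMap, MeasurableEquiv.prodAssoc, toPlane]
    linear_combination (w ^ 2 + α ^ 2) * hcs + ((si * w + co * α) ^ 2 + β ^ 2) * hpq
  · rintro w ⟨α, β⟩
    rw [dist_sq_plane, h0, h1]
    simp [R, Q, planeMap, MeasurableEquiv.prodAssoc, toPlane]
    have hc2 : c₂ = c₁ + co * d := by linarith
    rw [hc2, ← hsd]
    linear_combination ((w - d) ^ 2 + α ^ 2) * hcs
      + ((si * w + co * α - si * d) ^ 2 + β ^ 2) * hpq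

end MNNR

/-! ### Measures of Euclidean balls and of caps -/

namespace MNNR

/-- The measure with density `g` of the third coordinate on `ℝ² × ℝ`. -/
noncomputable def heightMeasure (g : ℝ → ℝ) : Measure Atom :=
  (volume : Measure Plane).prod (volume.withDensity fun z => ENNReal.ofReal (g z))

variable {g : ℝ → ℝ}

lemma heightMeasure_apply_slices (hg : Measurable g) {C : Set Atom} (hC : MeasurableSet C) :
    heightMeasure g C = ∫⁻ z, ENNReal.ofReal (g z) * volume ((fun y : Plane => (y, z)) ⁻¹' C) := by
  rw [heightMeasure, Measure.prod_apply_symm hC,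
    lintegral_withDensity_eq_lintegral_mul _ hg.ennreal_ofReal (measurable_measure_prodMk_right hC)]
  rfl

lemma heightMeasure_apply (hg : Measurable g) {C : Set Atom} (hC : MeasurableSet C) :
    heightMeasure g C = ∫⁻ p, C.indicator (fun p => ENNReal.ofReal (g p.2)) p := by
  have hgm : Measurable fun p : Atom => ENNReal.ofReal (g p.2) :=
    (hg.comp measurable_snd).ennreal_ofReal
  rw [heightMeasure_apply_slices hg hC, Measure.volume_eq_prod, lintegral_prod_symm _
    (hgm.indicator hC).aemeasurable]
  refine lintegral_congr fun z => ?_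
  have : ∀ y : Plane, C.indicator (fun p => ENNReal.ofReal (g p.2)) (y, z)
      = ((fun y : Plane => (y, z)) ⁻¹' C).indicator (fun _ => ENNReal.ofReal (g z)) y :=
    fun y => rfl
  simp_rw [this]
  rw [lintegral_indicator_const (measurable_prodMk_right hC)]

/-- The slice at height z is a disc of area π(r² - (z - c)²), or empty; `ENNReal.ofReal` truncates
the negative values to zero in the latter case. -/
lemma heightMeasure_ball (hg : Measurable g) (hg0 : ∀ z, 0 ≤ g z) (hgi : Integrable g)
    (y : Plane) (c : ℝ) {r : ℝ} (hr : 0 < r) :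
    heightMeasure g {p | dist y p.1 ^ 2 + (p.2 - c) ^ 2 < r ^ 2}
      = ENNReal.ofReal (Real.pi * ∫ w in (-r)..r, g (w + c) * (r ^ 2 - w ^ 2)) := by
  have hm : MeasurableSet {p : Atom | dist y p.1 ^ 2 + (p.2 - c) ^ 2 < r ^ 2} :=
    (isOpen_lt (by fun_prop) (by fun_prop)).measurableSet
  have hvol : ∀ z, volume ((fun y : Plane => (y, z)) ⁻¹'
      {p : Atom | dist y p.1 ^ 2 + (p.2 - c) ^ 2 < r ^ 2})
      = ENNReal.ofReal (Real.pi * (r ^ 2 - (z - c) ^ 2)) := by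
    intro z
    have : (fun y : Plane => (y, z)) ⁻¹' {p : Atom | dist y p.1 ^ 2 + (p.2 - c) ^ 2 < r ^ 2}
        = Metric.ball y (Real.sqrt (r ^ 2 - (z - c) ^ 2)) := by
      ext y'
      simp only [mem_preimage, mem_ofPred_eq, Metric.mem_ball]
      rw [Real.lt_sqrt dist_nonneg, dist_comm, lt_sub_iff_add_lt]
    rw [this, EuclideanSpace.volume_ball_fin_two]
    by_cases h : 0 ≤ r ^ 2 - (z - c) ^ 2
    · rw [← ENNReal.ofReal_pow (Real.sqrt_nonneg _), Real.sq_sqrt h, mul_comm,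
        ENNReal.ofReal_mul Real.pi_pos.le]
    · rw [Real.sqrt_eq_zero_of_nonpos (not_le.1 h).le, ENNReal.ofReal_of_nonpos
        (mul_nonpos_of_nonneg_of_nonpos Real.pi_pos.le (not_le.1 h).le)]
      simp
  rw [heightMeasure_apply_slices hg hm]
  simp_rw [hvol, ← ENNReal.ofReal_mul (hg0 _)]
  rw [← lintegral_add_right_eq_self _ c, ← intervalIntegral.integral_const_mul,
    intervalIntegral.integral_of_le (by linarith), ofReal_integral_eq_lintegral_ofReal]
  · rw [← lintegral_indicator measurableSet_Ioc]
    refine lintegral_congr fun w => ?_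
    rw [indicator_apply, add_sub_cancel_right]
    split_ifs with h
    · congr 1; ring
    · refine ENNReal.ofReal_of_nonpos ?_
      refine mul_nonpos_of_nonneg_of_nonpos (hg0 _)
        (mul_nonpos_of_nonneg_of_nonpos Real.pi_pos.le ?_)
      rw [mem_Ioc, not_and_or, not_lt, not_le] at h
      rcases h with h | h <;> nlinarith
  · refine Integrable.const_mul ?_ _
    refine ((hgi.comp_add_right c).integrableOn (s := Ioc (-r) r)).mul_bdd (c := r ^ 2)
      (Continuous.aestronglyMeasurable (by fun_prop)) ?_
    rw [ae_restrict_iff' measurableSet_Ioc]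
    refine Filter.Eventually.of_forall fun w hw => ?_
    rw [Real.norm_eq_abs, abs_le]
    constructor <;> nlinarith [hw.1, hw.2]
  · rw [Filter.EventuallyLE, ae_restrict_iff' measurableSet_Ioc]
    refine Filter.Eventually.of_forall fun w hw => ?_
    refine mul_nonneg Real.pi_pos.le (mul_nonneg (hg0 _) ?_)
    nlinarith [hw.1, hw.2]

lemma heightMeasure_ball_ne_top (hg : Measurable g) (hg0 : ∀ z, 0 ≤ g z) (hgi : Integrable g)
    (y : Plane) (c : ℝ) {r : ℝ} (hr : 0 < r) :
    heightMeasure g {p | dist y p.1 ^ 2 + (p.2 - c) ^ 2 < r ^ 2} ≠ ∞ := by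
  rw [heightMeasure_ball hg hg0 hgi y c hr]
  exact ENNReal.ofReal_ne_top

/-- Polar coordinates for a function supported on a disc and depending on the first coordinate. -/
lemma integral_disc_polar {ρ : ℝ} (hρ : 0 ≤ ρ) (k : ℝ → ℝ)
    (hk : Integrable (fun p : ℝ × ℝ =>
      {p : ℝ × ℝ | p.1 ^ 2 + p.2 ^ 2 < ρ ^ 2}.indicator (fun p => k p.1) p)) 
    (hk0 : ∀ z, 0 ≤ k z) (hkm : Measurable k) :
    ∫ p : ℝ × ℝ, {p : ℝ × ℝ | p.1 ^ 2 + p.2 ^ 2 < ρ ^ 2}.indicator (fun p => k p.1) p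
      = ∫ θ in (0 : ℝ)..(2 * Real.pi), ∫ t in (0 : ℝ)..ρ, k (t * Real.cos θ) * t := by
  set G : ℝ × ℝ → ℝ := {p : ℝ × ℝ | p.1 ^ 2 + p.2 ^ 2 < ρ ^ 2}.indicator (fun p => k p.1) with hG
  have hGm : Measurable G := (hkm.comp measurable_fst).indicator
    (isOpen_lt (by fun_prop) (by fun_prop)).measurableSet
  have hG0 : ∀ p, 0 ≤ G p := fun p => indicator_nonneg (fun _ _ => hk0 _) p
  -- Polar coordinates use angles in (-π, π), the statement (0, 2π); periodicity reconciles them.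
  have hper : Function.Periodic (fun θ => ∫ t in (0 : ℝ)..ρ, k (t * Real.cos θ) * t)
      (2 * Real.pi) := fun θ => by simp [Real.cos_add_two_pi]
  have h1 := hper.intervalIntegral_add_eq 0 (-Real.pi)
  rw [zero_add, show -Real.pi + 2 * Real.pi = Real.pi by ring] at h1
  have htarget : (polarCoord.target : Set (ℝ × ℝ)) = Ioi 0 ×ˢ Ioo (-Real.pi) Real.pi := rfl
  have hint : Integrable (fun p : ℝ × ℝ => p.1 • G (polarCoord.symm p))
      ((volume.restrict (Ioi 0)).prod (volume.restrict (Ioo (-Real.pi) Real.pi))) := by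
    rw [Measure.prod_restrict, ← htarget, ← Measure.volume_eq_prod]
    refine ⟨(measurable_fst.smul
      (hGm.comp continuous_polarCoord_symm.measurable)).aestronglyMeasurable, ?_⟩
    rw [hasFiniteIntegral_iff_ofReal]
    · have h2 := lintegral_comp_polarCoord_symm fun p => ENNReal.ofReal (G p)
      have h3 : ∫⁻ p, ENNReal.ofReal (G p) < ∞ := by
        rw [← hasFiniteIntegral_iff_ofReal (Filter.Eventually.of_forall hG0)]
        exact hk.2
      rw [← h2] at h3
      refine lt_of_le_of_lt (le_of_eq ?_) h3
      refine setLIntegral_congr_fun polarCoord.open_target.measurableSet fun p hp => ?_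
      exact ENNReal.ofReal_mul (le_of_lt hp.1)
    · rw [Filter.EventuallyLE, ae_restrict_iff' polarCoord.open_target.measurableSet]
      exact Filter.Eventually.of_forall fun p hp => mul_nonneg (le_of_lt hp.1) (hG0 _)
  rw [h1, ← integral_comp_polarCoord_symm, htarget, Measure.volume_eq_prod, ← Measure.prod_restrict,
    integral_prod_symm _ hint, intervalIntegral.integral_of_le (by linarith [Real.pi_pos]),
    integral_Ioc_eq_integral_Ioo]
  refine integral_congr_ae (Filter.Eventually.of_forall fun θ => ?_)
  simp only
  rw [intervalIntegral.integral_of_le hρ, integral_Ioc_eq_integral_Ioo,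
    ← integral_indicator measurableSet_Ioo, ← integral_indicator measurableSet_Ioi]
  refine integral_congr_ae (Filter.Eventually.of_forall fun t => ?_)
  have hsq : (t * Real.cos θ) ^ 2 + (t * Real.sin θ) ^ 2 = t ^ 2 := by
    linear_combination t ^ 2 * Real.cos_sq_add_sin_sq θ
  simp only [indicator_apply, mem_Ioi, mem_Ioo, hG, polarCoord_symm_apply, mem_ofPred_eq, hsq,
    smul_eq_mul]
  by_cases ht : 0 < t
  · by_cases ht' : t < ρ
    · simp [ht, ht', pow_lt_pow_left₀ ht' ht.le, mul_comm]
    · have : ¬ t ^ 2 < ρ ^ 2 := not_lt.2 (pow_le_pow_left₀ hρ (not_lt.1 ht') 2)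
      simp [ht, ht', this]
  · simp [ht]

/-- In adapted coordinates the cap is the part of the first ball with w > r₁ - h, and its slices are
discs. `hC2` is a weak and `hC3` a strict inequality, so that the result covers both a cap cut off
by an open half-space and one cut off by the complementary closed half-space. -/
lemma heightMeasure_cap (hg : Measurable g) (hg0 : ∀ z, 0 ≤ g z) (hgi : Integrable g)
    {y₁ y₂ : Plane} {c₁ c₂ s d r₁ r₂ h δ : ℝ} (hs : 0 < s) (hdist : dist y₁ y₂ = s) (hd : 0 < d)
    (hd2 : d ^ 2 = s ^ 2 + (c₂ - c₁) ^ 2) (hr₁ : 0 < r₁) (hh0 : 0 ≤ h) (hh1 : h ≤ 2 * r₁)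
    (hh : 2 * d * (r₁ - h) = d ^ 2 + r₁ ^ 2 - r₂ ^ 2)
    (hcos : Real.cos δ = (c₂ - c₁) / d) (hsin : Real.sin δ = s / d)
    {C : Set Atom} (hC : MeasurableSet C)
    (hC1 : ∀ p ∈ C, dist y₁ p.1 ^ 2 + (p.2 - c₁) ^ 2 < r₁ ^ 2)
    (hC2 : ∀ p ∈ C, dist y₂ p.1 ^ 2 + (p.2 - c₂) ^ 2 - r₂ ^ 2
      ≤ dist y₁ p.1 ^ 2 + (p.2 - c₁) ^ 2 - r₁ ^ 2)
    (hC3 : ∀ p : Atom, dist y₁ p.1 ^ 2 + (p.2 - c₁) ^ 2 < r₁ ^ 2 →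
      dist y₂ p.1 ^ 2 + (p.2 - c₂) ^ 2 - r₂ ^ 2 < dist y₁ p.1 ^ 2 + (p.2 - c₁) ^ 2 - r₁ ^ 2 →
      p ∈ C) :
    heightMeasure g C = ENNReal.ofReal (capIntegral g c₁ r₁ h δ) := by
  obtain ⟨T, hT, hT2, hTd1, hTd2⟩ := exists_adapted_coordinates hs hdist hd hd2
  set w₀ := r₁ - h with hw₀
  have hfin : heightMeasure g C ≠ ∞ := ne_top_of_le_ne_top
    (heightMeasure_ball_ne_top hg hg0 hgi y₁ c₁ hr₁) (measure_mono hC1)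
  let Φ : ℝ × (ℝ × ℝ) → ℝ := fun q => C.indicator (fun p => g p.2) (T q)
  have hΦm : Measurable Φ :=
    ((hg.comp measurable_snd).indicator hC).comp hT.measurable
  have hΦ0 : ∀ q, 0 ≤ Φ q := fun q => indicator_nonneg (fun _ _ => hg0 _) _
  have hlin : ∫⁻ q, ENNReal.ofReal (Φ q) = heightMeasure g C := by
    have hgm : Measurable fun p : Atom => ENNReal.ofReal (g p.2) :=
      (hg.comp measurable_snd).ennreal_ofReal
    rw [heightMeasure_apply hg hC, ← hT.lintegral_comp (hgm.indicator hC)]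
    refine lintegral_congr fun q => ?_
    by_cases hq : T q ∈ C
    · simp only [Φ, indicator_of_mem hq]
    · simp only [Φ, indicator_of_notMem hq, ENNReal.ofReal_zero]
  have hΦi : Integrable Φ := by
    refine ⟨hΦm.aestronglyMeasurable, ?_⟩
    rw [hasFiniteIntegral_iff_ofReal (Filter.Eventually.of_forall hΦ0), hlin]
    exact hfin.lt_top
  rw [← hlin, ← ofReal_integral_eq_lintegral_ofReal hΦi (Filter.Eventually.of_forall hΦ0)]
  congr 1
  have hΦi' : Integrable Φ ((volume : Measure ℝ).prod (volume : Measure (ℝ × ℝ))) := hΦi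
  rw [Measure.volume_eq_prod, integral_prod _ hΦi', capIntegral,
    intervalIntegral.integral_of_le (by linarith), ← integral_indicator measurableSet_Ioc]
  -- Null values of `w` are discarded; at `w₀`, on the cutting plane, membership in `C` is left open
  -- by the hypotheses.
  have hne : ∀ v : ℝ, ∀ᵐ w : ℝ, w ≠ v := fun v => by simp [ae_iff]
  refine integral_congr_ae ?_
  filter_upwards [hΦi'.prod_right_ae, hne w₀, hne r₁] with w hw hw0 hw1
  have hmem : ∀ p : ℝ × ℝ, T (w, p) ∈ C ↔ w₀ < w ∧ p.1 ^ 2 + p.2 ^ 2 < r₁ ^ 2 - w ^ 2 := by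
    intro p
    have e1 := hTd1 w p
    have e2 := hTd2 w p
    constructor
    · intro hp
      have h1 := hC1 _ hp
      have h2 := hC2 _ hp
      rw [e1] at h1 h2
      rw [e2] at h2
      refine ⟨lt_of_le_of_ne ?_ (Ne.symm hw0), by linarith⟩
      refine le_of_mul_le_mul_left (a := 2 * d) ?_ (by positivity)
      rw [hh]
      nlinarith
    · rintro ⟨h1, h2⟩
      refine hC3 _ (by rw [e1]; linarith) ?_
      rw [e1, e2]
      have := mul_lt_mul_of_pos_left h1 (show 0 < 2 * d by positivity)
      rw [hh] at this
      nlinarith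
  have hΦeq : ∀ p, Φ (w, p) = if w₀ < w then
      {p : ℝ × ℝ | p.1 ^ 2 + p.2 ^ 2 < (Real.sqrt (r₁ ^ 2 - w ^ 2)) ^ 2}.indicator
        (fun p => g (c₁ + w * Real.cos δ - p.1 * Real.sin δ)) p else 0 := by
    intro p
    have hsq : p.1 ^ 2 + p.2 ^ 2 < (Real.sqrt (r₁ ^ 2 - w ^ 2)) ^ 2 ↔
        p.1 ^ 2 + p.2 ^ 2 < r₁ ^ 2 - w ^ 2 := by
      by_cases hn : 0 ≤ r₁ ^ 2 - w ^ 2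
      · rw [Real.sq_sqrt hn]
      · rw [Real.sqrt_eq_zero_of_nonpos (not_le.1 hn).le]
        have : 0 ≤ p.1 ^ 2 + p.2 ^ 2 := by positivity
        constructor <;> intro <;> nlinarith
    by_cases hp : T (w, p) ∈ C
    · have hp' := (hmem p).1 hp
      rw [if_pos hp'.1, indicator_of_mem (show p ∈ {p : ℝ × ℝ | p.1 ^ 2 + p.2 ^ 2 <
        (Real.sqrt (r₁ ^ 2 - w ^ 2)) ^ 2} from hsq.2 hp'.2)]
      simp only [Φ, indicator_of_mem hp, hT2, hcos, hsin]
    · simp only [Φ, indicator_of_notMem hp]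
      split_ifs with h1
      · rw [indicator_of_notMem]
        exact fun hc => hp ((hmem p).2 ⟨h1, hsq.1 hc⟩)
      · rfl
  simp_rw [hΦeq] at hw ⊢
  by_cases h1 : w₀ < w
  · simp only [h1, if_true] at hw ⊢
    by_cases h2 : w ≤ r₁
    · rw [indicator_of_mem (show w ∈ Ioc w₀ r₁ from ⟨h1, h2⟩),
        integral_disc_polar (Real.sqrt_nonneg _)
        (fun u => g (c₁ + w * Real.cos δ - u * Real.sin δ)) hw (fun _ => hg0 _) (by fun_prop)]
    · rw [indicator_of_notMem (fun hc => h2 hc.2)]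
      have h3 : Real.sqrt (r₁ ^ 2 - w ^ 2) = 0 :=
        Real.sqrt_eq_zero_of_nonpos (by nlinarith [not_le.1 h2])
      rw [h3]
      have : {p : ℝ × ℝ | p.1 ^ 2 + p.2 ^ 2 < (0 : ℝ) ^ 2} = ∅ := by
        rw [Set.eq_empty_iff_forall_notMem]
        intro p (hp : p.1 ^ 2 + p.2 ^ 2 < (0 : ℝ) ^ 2)
        nlinarith [sq_nonneg p.1, sq_nonneg p.2]
      rw [this]
      simp
  · rw [indicator_of_notMem (fun hc => h1 hc.1)]
    simp [h1]

end MNNR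

/-! ### The union of two hyperbolic balls has measure `F` -/

namespace MNNR

variable {g : ℝ → ℝ}

lemma capIntegral_nonneg (hg0 : ∀ z, 0 ≤ g z) (c ρ δ : ℝ) {h : ℝ} (hh : 0 ≤ h) :
    0 ≤ capIntegral g c ρ h δ := by
  refine intervalIntegral.integral_nonneg (by linarith) fun w _ => ?_
  refine intervalIntegral.integral_nonneg (by positivity) fun θ _ => ?_
  exact intervalIntegral.integral_nonneg (Real.sqrt_nonneg _) fun t ht => mul_nonneg (hg0 _) ht.1

lemma cos_sin_cap_angle {s d e : ℝ} (hs : 0 < s) (hd : 0 < d) (hd2 : d ^ 2 = s ^ 2 + e ^ 2) :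
    Real.cos (Real.pi / 2 - Real.arcsin (e / d)) = e / d ∧
    Real.sin (Real.pi / 2 - Real.arcsin (e / d)) = s / d := by
  have habs : |e / d| ≤ 1 := by
    rw [abs_div, abs_of_pos hd, div_le_one hd]
    exact abs_le_of_sq_le_sq (by nlinarith) hd.le
  rw [abs_le] at habs
  rw [Real.cos_pi_div_two_sub, Real.sin_pi_div_two_sub, Real.sin_arcsin habs.1 habs.2,
    Real.cos_arcsin]
  refine ⟨rfl, ?_⟩
  rw [show 1 - (e / d) ^ 2 = (s / d) ^ 2 by field_simp; linarith, Real.sqrt_sq (by positivity)]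

lemma ball_integral_nonneg (hg0 : ∀ z, 0 ≤ g z) (c : ℝ) {r : ℝ} (hr : 0 < r) :
    0 ≤ Real.pi * ∫ w in (-r)..r, g (w + c) * (r ^ 2 - w ^ 2) := by
  refine mul_nonneg Real.pi_pos.le (intervalIntegral.integral_nonneg (by linarith) fun w hw => ?_)
  exact mul_nonneg (hg0 _) (sub_nonneg.2 (sq_le_sq' hw.1 hw.2))

/-- Each ball keeps only the points on its own side of the cut; what it gives up belongs to the
other ball. -/
lemma union_eq_union_sdiff_inter {α : Type*} {B₁ B₂ H : Set α} (h₁ : B₁ ∩ H ⊆ B₂)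
    (h₂ : B₂ ∩ Hᶜ ⊆ B₁) : B₁ ∪ B₂ = (B₁ \ (B₁ ∩ H)) ∪ (B₂ \ (B₂ ∩ Hᶜ)) := by
  ext p
  simp only [mem_union, mem_sdiff, mem_inter_iff, mem_compl_iff, not_and, not_not]
  have h1 : p ∈ B₁ → p ∈ H → p ∈ B₂ := fun h h' => h₁ ⟨h, h'⟩
  have h2 : p ∈ B₂ → p ∉ H → p ∈ B₁ := fun h h' => h₂ ⟨h, h'⟩
  tauto

lemma measure_union_sdiff_eq_ofReal {α : Type*} [MeasurableSpace α] {μ : Measure α}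
    {B₁ B₂ C₁ C₂ : Set α} (hB₂ : MeasurableSet B₂) (hC₁ : MeasurableSet C₁) (hC₂ : MeasurableSet C₂)
    (h₁ : C₁ ⊆ B₁) (h₂ : C₂ ⊆ B₂) (hdisj : Disjoint (B₁ \ C₁) (B₂ \ C₂)) {x₁ x₂ k₁ k₂ : ℝ}
    (hx₁ : 0 ≤ x₁) (hx₂ : 0 ≤ x₂) (hk₁ : 0 ≤ k₁) (hk₂ : 0 ≤ k₂)
    (hμB₁ : μ B₁ = ENNReal.ofReal x₁) (hμB₂ : μ B₂ = ENNReal.ofReal x₂)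
    (hμC₁ : μ C₁ = ENNReal.ofReal k₁) (hμC₂ : μ C₂ = ENNReal.ofReal k₂) :
    0 ≤ x₁ + x₂ - k₁ - k₂ ∧
      μ ((B₁ \ C₁) ∪ (B₂ \ C₂)) = ENNReal.ofReal (x₁ + x₂ - k₁ - k₂) := by
  have hle₁ := measure_mono (μ := μ) h₁
  have hle₂ := measure_mono (μ := μ) h₂
  rw [hμC₁, hμB₁, ENNReal.ofReal_le_ofReal_iff hx₁] at hle₁
  rw [hμC₂, hμB₂, ENNReal.ofReal_le_ofReal_iff hx₂] at hle₂
  refine ⟨by linarith, ?_⟩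
  rw [measure_union hdisj (hB₂.diff hC₂),
    measure_sdiff h₁ hC₁.nullMeasurableSet (by rw [hμC₁]; exact ENNReal.ofReal_ne_top),
    measure_sdiff h₂ hC₂.nullMeasurableSet (by rw [hμC₂]; exact ENNReal.ofReal_ne_top),
    hμC₁, hμC₂, hμB₁, hμB₂, ← ENNReal.ofReal_sub _ hk₁, ← ENNReal.ofReal_sub _ hk₂,
    ← ENNReal.ofReal_add (by linarith) (by linarith)]
  congr 1
  ring

/-- The measure of the union of two balls of which neither contains the other, in terms of balls
and caps. -/
lemma heightMeasure_union_balls (hg : Measurable g) (hg0 : ∀ z, 0 ≤ g z) (hgi : Integrable g)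
    {y₁ y₂ : Plane} {c₁ c₂ s d r₁ r₂ : ℝ} (hs : 0 < s) (hdist : dist y₁ y₂ = s) (hd : 0 < d)
    (hd2 : d ^ 2 = s ^ 2 + (c₁ - c₂) ^ 2) (hr₁ : 0 < r₁) (hr₂ : 0 < r₂)
    (h12 : r₁ ≤ r₂ + d) (h21 : r₂ ≤ r₁ + d) (hdr : d ≤ r₁ + r₂) {E : ℝ}
    (hE : E = Real.pi * (∫ w in (-r₁)..r₁, g (w + c₁) * (r₁ ^ 2 - w ^ 2))
      + Real.pi * (∫ w in (-r₂)..r₂, g (w + c₂) * (r₂ ^ 2 - w ^ 2))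
      - capIntegral g c₁ r₁ ((r₂ - r₁ + d) * (r₁ + r₂ - d) / (2 * d))
        (Real.pi / 2 - Real.arcsin ((c₂ - c₁) / d))
      - capIntegral g c₂ r₂ ((r₁ - r₂ + d) * (r₁ + r₂ - d) / (2 * d))
        (Real.pi / 2 - Real.arcsin ((c₁ - c₂) / d))) :
    0 ≤ E ∧ heightMeasure g ({p | dist y₁ p.1 ^ 2 + (p.2 - c₁) ^ 2 < r₁ ^ 2} ∪
        {p | dist y₂ p.1 ^ 2 + (p.2 - c₂) ^ 2 < r₂ ^ 2})
      = ENNReal.ofReal E := by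
  have hd2' : d ^ 2 = s ^ 2 + (c₂ - c₁) ^ 2 := by rw [hd2]; ring
  set B₁ : Set Atom := {p | dist y₁ p.1 ^ 2 + (p.2 - c₁) ^ 2 < r₁ ^ 2} with hB₁
  set B₂ : Set Atom := {p | dist y₂ p.1 ^ 2 + (p.2 - c₂) ^ 2 < r₂ ^ 2} with hB₂
  set h₁ := (r₂ - r₁ + d) * (r₁ + r₂ - d) / (2 * d) with hh₁
  set h₂ := (r₁ - r₂ + d) * (r₁ + r₂ - d) / (2 * d) with hh₂
  have hh₁0 : 0 ≤ h₁ :=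
    div_nonneg (mul_nonneg (by linarith) (by linarith)) (by positivity)
  have hh₂0 : 0 ≤ h₂ :=
    div_nonneg (mul_nonneg (by linarith) (by linarith)) (by positivity)
  have hh₁1 : h₁ ≤ 2 * r₁ := by
    rw [hh₁, div_le_iff₀ (by positivity)]
    nlinarith [mul_nonneg (show 0 ≤ r₁ + d - r₂ by linarith) (show 0 ≤ r₁ + d + r₂ by linarith)]
  have hh₂1 : h₂ ≤ 2 * r₂ := by
    rw [hh₂, div_le_iff₀ (by positivity)]
    nlinarith [mul_nonneg (show 0 ≤ r₂ + d - r₁ by linarith) (show 0 ≤ r₂ + d + r₁ by linarith)]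
  -- On the line of centres the radical plane is at w with w² - r₁² = (w - d)² - r₂², that is w = r₁
  -- - h₁.
  have hw₁ : 2 * d * (r₁ - h₁) = d ^ 2 + r₁ ^ 2 - r₂ ^ 2 := by
    rw [hh₁, mul_sub, mul_div_cancel₀ _ (by positivity)]; ring
  have hw₂ : 2 * d * (r₂ - h₂) = d ^ 2 + r₂ ^ 2 - r₁ ^ 2 := by
    rw [hh₂, mul_sub, mul_div_cancel₀ _ (by positivity)]; ring
  have hmB₁ : MeasurableSet B₁ := (isOpen_lt (by fun_prop) (by fun_prop)).measurableSet
  have hmB₂ : MeasurableSet B₂ := (isOpen_lt (by fun_prop) (by fun_prop)).measurableSet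
  -- The points of smaller power with respect to the second ball: an open half-space bounded by the
  -- radical plane.
  let H : Set Atom := {p | dist y₂ p.1 ^ 2 + (p.2 - c₂) ^ 2 - r₂ ^ 2
    < dist y₁ p.1 ^ 2 + (p.2 - c₁) ^ 2 - r₁ ^ 2}
  have hmH : MeasurableSet H := (isOpen_lt (by fun_prop) (by fun_prop)).measurableSet
  obtain ⟨hcos₁, hsin₁⟩ := cos_sin_cap_angle hs hd hd2'
  obtain ⟨hcos₂, hsin₂⟩ := cos_sin_cap_angle hs hd hd2
  have hC₁ := heightMeasure_cap hg hg0 hgi hs hdist hd hd2' hr₁ hh₁0 hh₁1 hw₁ hcos₁ hsin₁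
    (hmB₁.inter hmH) (fun p hp => hp.1) (fun p hp => le_of_lt hp.2) (fun p h1 h2 => ⟨h1, h2⟩)
  have hC₂ := heightMeasure_cap hg hg0 hgi hs ((dist_comm _ _).trans hdist) hd hd2 hr₂ hh₂0 hh₂1
    hw₂ hcos₂ hsin₂ (hmB₂.inter hmH.compl) (fun p hp => hp.1) (fun p hp => not_lt.1 hp.2)
    (fun p h1 h2 => ⟨h1, not_lt.2 h2.le⟩)
  have hμ₁ := heightMeasure_ball hg hg0 hgi y₁ c₁ hr₁
  have hμ₂ := heightMeasure_ball hg hg0 hgi y₂ c₂ hr₂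
  rw [← hB₁] at hμ₁
  rw [← hB₂] at hμ₂
  have hU : B₁ ∪ B₂ = (B₁ \ (B₁ ∩ H)) ∪ (B₂ \ (B₂ ∩ Hᶜ)) := by
    refine union_eq_union_sdiff_inter (fun p hp => ?_) fun p hp => ?_
    · have h1 : dist y₁ p.1 ^ 2 + (p.2 - c₁) ^ 2 < r₁ ^ 2 := hp.1
      have h2 : dist y₂ p.1 ^ 2 + (p.2 - c₂) ^ 2 - r₂ ^ 2
        < dist y₁ p.1 ^ 2 + (p.2 - c₁) ^ 2 - r₁ ^ 2 := hp.2
      exact sub_neg.1 (h2.trans (sub_neg.2 h1))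
    · have h1 : dist y₂ p.1 ^ 2 + (p.2 - c₂) ^ 2 < r₂ ^ 2 := hp.1
      have h2 : dist y₁ p.1 ^ 2 + (p.2 - c₁) ^ 2 - r₁ ^ 2
        ≤ dist y₂ p.1 ^ 2 + (p.2 - c₂) ^ 2 - r₂ ^ 2 := not_lt.1 hp.2
      exact sub_neg.1 (h2.trans_lt (sub_neg.2 h1))
  have hdisj : Disjoint (B₁ \ (B₁ ∩ H)) (B₂ \ (B₂ ∩ Hᶜ)) := by
    rw [Set.disjoint_left]
    rintro p ⟨h1, h2⟩ ⟨h3, h4⟩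
    exact h4 ⟨h3, fun hp => h2 ⟨h1, hp⟩⟩
  have hk₁ := capIntegral_nonneg hg0 c₁ r₁ (Real.pi / 2 - Real.arcsin ((c₂ - c₁) / d)) hh₁0
  have hk₂ := capIntegral_nonneg hg0 c₂ r₂ (Real.pi / 2 - Real.arcsin ((c₁ - c₂) / d)) hh₂0
  obtain ⟨hE0, hE1⟩ := measure_union_sdiff_eq_ofReal hmB₂ (hmB₁.inter hmH) (hmB₂.inter hmH.compl)
    inter_subset_left inter_subset_left hdisj (ball_integral_nonneg hg0 _ hr₁) (ball_integral_nonneg hg0 _ hr₂) hk₁ hk₂ hμ₁ hμ₂ hC₁ hC₂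
  rw [hU, hE]
  exact ⟨hE0, hE1⟩

/-- Completing the square in the height u: the hyperbolic ball about height z with radius R is the
Euclidean ball with centre at height z cosh R and radius z sinh R. -/
lemma ball_iff_of_cosh {z z' K u D C r : ℝ} (hz : 0 < z) (hz' : 0 < z')
    (hC : C = 1 + K / (2 * z * z')) (hr : r ^ 2 = z ^ 2 * (C ^ 2 - 1)) :
    z' * (D + (z - u) ^ 2) < u * K ↔ D + (u - z * C) ^ 2 < r ^ 2 := by
  have h1 : K = 2 * z * z' * (C - 1) := by rw [hC]; field_simp; ring
  rw [hr, h1]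
  constructor
  · intro h
    have : z' * (D + (z - u) ^ 2) < z' * (u * (2 * z * (C - 1))) := by linarith
    nlinarith [lt_of_mul_lt_mul_left this hz'.le]
  · intro h
    have : D + (z - u) ^ 2 < u * (2 * z * (C - 1)) := by nlinarith
    nlinarith [mul_lt_mul_of_pos_left this hz']

/-- `F` is nonnegative and computes the measure of the union of the two hyperbolic balls. -/
lemma heightMeasure_openBalls (hg : Measurable g) (hg0 : ∀ z, 0 ≤ g z) (hgi : Integrable g)
    {a b : Atom} {s : ℝ} (hs : 0 < s) (hdist : dist a.1 b.1 = s) (ha : 0 < a.2) (hb : 0 < b.2) :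
    0 ≤ F g s a.2 b.2 ∧
      heightMeasure g {c | ((a, b), c) ∈ openBalls 0} = ENNReal.ofReal (F g s a.2 b.2) := by
  obtain ⟨y₁, z⟩ := a
  obtain ⟨y₂, z'⟩ := b
  simp only at hdist ha hb ⊢
  set K := s ^ 2 + (z - z') ^ 2 with hK
  have hKpos : 0 < K := by positivity
  set R := hypDistOf s z z' with hR
  have hx1 : 1 ≤ 1 + K / (2 * z * z') := by
    have : 0 ≤ K / (2 * z * z') := by positivity
    linarith
  have hcosh : Real.cosh R = 1 + K / (2 * z * z') := by
    rw [hR, hypDistOf_eq ha hb, Real.cosh_arcosh hx1]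
  have hRpos : 0 < R := by
    rw [hR, hypDistOf_eq ha hb]
    refine Real.arcosh_pos ?_
    have : 0 < K / (2 * z * z') := by positivity
    linarith
  have hS : 0 < Real.sinh R := Real.sinh_pos_iff.2 hRpos
  have hSC : Real.sinh R ^ 2 = Real.cosh R ^ 2 - 1 := by
    have := Real.cosh_sq R
    linarith
  set C := Real.cosh R with hCdef
  set S := Real.sinh R with hSdef
  set d := Real.sqrt (s ^ 2 + (z - z') ^ 2 * C ^ 2) with hd
  have hd2 : d ^ 2 = s ^ 2 + (z * C - z' * C) ^ 2 := by
    rw [hd, Real.sq_sqrt (by positivity)]; ring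
  have hdpos : 0 < d := Real.sqrt_pos.2 (by positivity)
  have hC1 : 1 ≤ C := by rw [hcosh]; exact hx1
  have hKC : K = 2 * z * z' * (C - 1) := by rw [hcosh]; field_simp; ring
  have hsq : s ^ 2 = 2 * z * z' * (C - 1) - (z - z') ^ 2 := by rw [← hKC, hK]; ring
  -- The centres are at least as far apart as the radii differ, since sinh² ≤ cosh².
  have hdiff : (z * S - z' * S) ^ 2 ≤ d ^ 2 := by
    rw [hd2, ← sub_mul, ← sub_mul, mul_pow, mul_pow, hSC]
    nlinarith [sq_nonneg (z - z'), sq_nonneg s]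
  have habs := abs_le.1 (abs_le_of_sq_le_sq hdiff hdpos.le)
  -- The squares of the two sides differ by 2zz'(2C + 1)(C - 1), which is nonnegative.
  have hdr : d ≤ z * S + z' * S := by
    refine le_of_sq_le_sq ?_ (by positivity)
    rw [hd2, ← add_mul, mul_pow, hSC, hsq]
    have : 0 ≤ 2 * (z * z') * ((2 * C + 1) * (C - 1)) :=
      mul_nonneg (by positivity) (mul_nonneg (by linarith) (by linarith))
    nlinarith
  have hr₁ : (z * S) ^ 2 = z ^ 2 * (C ^ 2 - 1) := by rw [mul_pow, hSC]
  have hr₂ : (z' * S) ^ 2 = z' ^ 2 * (C ^ 2 - 1) := by rw [mul_pow, hSC]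
  have hset : {c | (((y₁, z), (y₂, z')), c) ∈ openBalls 0}
      = {p : Atom | dist y₁ p.1 ^ 2 + (p.2 - z * C) ^ 2 < (z * S) ^ 2} ∪
        {p : Atom | dist y₂ p.1 ^ 2 + (p.2 - z' * C) ^ 2 < (z' * S) ^ 2} := by
    ext ⟨y, u⟩
    have e1 := ball_iff_of_cosh (u := u) (D := dist y₁ y ^ 2) ha hb hcosh hr₁
    have e2 := ball_iff_of_cosh (u := u) (D := dist y₂ y ^ 2) hb ha
      (show C = 1 + K / (2 * z' * z) by rw [hcosh]; ring) hr₂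
    simp only [openBalls, sqDist, mem_ofPred_eq, mem_union, mul_zero, zero_mul, add_zero, ← e1,
      ← e2, hdist, ← hK]
    refine ⟨fun h => h.2, fun h => ⟨⟨ha, hb, ?_⟩, h⟩⟩
    -- Positivity of the height need not be assumed for a point of the Euclidean balls: u K exceeds
    -- a nonnegative number.
    refine pos_of_mul_pos_left ?_ hKpos.le
    rcases h with h | h
    · exact lt_of_le_of_lt (by positivity) h
    · exact lt_of_le_of_lt (by positivity) h
  rw [hset]
  exact heightMeasure_union_balls hg hg0 hgi hs hdist hdpos hd2 (mul_pos ha hS) (mul_pos hb hS)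
    (by linarith) (by linarith) hdr rfl

end MNNR

/-! ### From `F` to the density of cooperating pairs -/

namespace MNNR

variable {lam : ℝ} {f g : ℝ → ℝ}

/-- A ball whose radius is less than the height of its centre stays above height zero, so values of
the density elsewhere never enter. -/
lemma capIntegral_congr (hfg : ∀ z, 0 < z → f z = g z) {c ρ : ℝ} (hρ : |ρ| < c) (h δ : ℝ) :
    capIntegral f c ρ h δ = capIntegral g c ρ h δ := by
  unfold capIntegral
  refine intervalIntegral.integral_congr fun w _ => ?_
  refine intervalIntegral.integral_congr fun θ _ => ?_
  rcases le_or_gt (ρ ^ 2 - w ^ 2) 0 with hw | hw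
  · simp [Real.sqrt_eq_zero_of_nonpos hw]
  · refine intervalIntegral.integral_congr fun t ht => ?_
    rw [uIcc_of_le (Real.sqrt_nonneg _)] at ht
    have ht2 : t ^ 2 ≤ ρ ^ 2 - w ^ 2 := by
      have := pow_le_pow_left₀ ht.1 ht.2 2
      rwa [Real.sq_sqrt hw.le] at this
    have hcs : (w * Real.cos δ - t * Real.cos θ * Real.sin δ) ^ 2 ≤ ρ ^ 2 := by
      have h1 := Real.sin_sq_add_cos_sq δ
      have h2 : (t * Real.cos θ) ^ 2 ≤ t ^ 2 := by
        nlinarith [Real.cos_sq_le_one θ, sq_nonneg t]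
      -- Rotation by δ preserves the sum of squares, so the height differs from that of the centre
      -- by at most ρ.
      have h3 : (w * Real.cos δ - t * Real.cos θ * Real.sin δ) ^ 2
          + (w * Real.sin δ + t * Real.cos θ * Real.cos δ) ^ 2
          = (w ^ 2 + (t * Real.cos θ) ^ 2) * (Real.sin δ ^ 2 + Real.cos δ ^ 2) := by ring
      rw [h1] at h3
      nlinarith [sq_nonneg (w * Real.sin δ + t * Real.cos θ * Real.cos δ)]
    have := (abs_le.1 (sq_le_sq.1 hcs)).1
    rw [hfg _ (by linarith)]

/-- `F` depends only on the density on the positive half-line. -/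
lemma F_congr (hfg : ∀ z, 0 < z → f z = g z) (s : ℝ) {z z' : ℝ} (hz : 0 < z) (hz' : 0 < z') :
    F f s z z' = F g s z z' := by
  have key : ∀ R y : ℝ, 0 < y → |y * Real.sinh R| < y * Real.cosh R := fun R y hy => by
    rw [abs_mul, abs_of_pos hy]
    refine mul_lt_mul_of_pos_left (abs_lt_of_sq_lt_sq ?_ (Real.cosh_pos R).le) hy
    rw [Real.cosh_sq]
    linarith
  have hball : ∀ r c : ℝ, |r| < c → ∫ w in (-r)..r, f (w + c) * (r ^ 2 - w ^ 2)
      = ∫ w in (-r)..r, g (w + c) * (r ^ 2 - w ^ 2) := fun r c hr => by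
    refine intervalIntegral.integral_congr fun w hw => ?_
    have hw' : -|r| ≤ w := by
      rcases mem_uIcc.1 hw with h | h
      · exact (neg_le_neg (le_abs_self r)).trans h.1
      · exact (neg_abs_le r).trans h.1
    rw [hfg _ (by linarith)]
  simp only [F]
  rw [hball _ _ (key _ z hz), hball _ _ (key _ z' hz'), capIntegral_congr hfg (key _ z hz),
    capIntegral_congr hfg (key _ z' hz')]

/-- The law of the marks in terms of the density extended by zero. -/
lemma resourceLaw_eq (f : ℝ → ℝ) : resourceLaw f
    = volume.withDensity fun z => ENNReal.ofReal ((Ioi (0 : ℝ)).indicator f z) := by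
  rw [resourceLaw, ← withDensity_indicator measurableSet_Ioi]
  congr 1
  ext z
  by_cases hz : z ∈ Ioi (0 : ℝ)
  · rw [indicator_of_mem hz, indicator_of_mem hz]
  · rw [indicator_of_notMem hz, indicator_of_notMem hz, ENNReal.ofReal_zero]

lemma integrableOn_of_integral_eq_one (hf_one : ∫ z in Ioi (0 : ℝ), f z = 1) :
    IntegrableOn f (Ioi 0) := by
  by_contra hcon
  rw [integral_undef hcon] at hf_one
  exact zero_ne_one hf_one

lemma isProbabilityMeasure_resourceLaw (hf_nonneg : ∀ z, 0 < z → 0 ≤ f z)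
    (hf_one : ∫ z in Ioi (0 : ℝ), f z = 1) : IsProbabilityMeasure (resourceLaw f) := by
  have hi := integrableOn_of_integral_eq_one hf_one
  constructor
  rw [resourceLaw, withDensity_apply _ MeasurableSet.univ, Measure.restrict_univ,
    ← ofReal_integral_eq_lintegral_ofReal hi
      ((ae_restrict_iff' measurableSet_Ioi).2 (Filter.Eventually.of_forall hf_nonneg)), hf_one,
    ENNReal.ofReal_one]

lemma resourceLaw_pos (f : ℝ → ℝ) : ∀ᵐ z ∂resourceLaw f, 0 < z :=
  (withDensity_absolutelyContinuous _ _).ae_le (ae_restrict_mem measurableSet_Ioi)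

/-- The function `f` is unrestricted in sign and size off the positive half-line. The measure
computation is made for its extension by zero, and `F_congr` transfers the result to `f`. -/
lemma pairWeight_eq_ofReal (hlam : 0 < lam) (hf_meas : Measurable f)
    (hf_nonneg : ∀ z, 0 < z → 0 ≤ f z) (hf_one : ∫ z in Ioi (0 : ℝ), f z = 1) {a b : Atom}
    (hab : a.1 ≠ b.1) (ha : 0 < a.2) (hb : 0 < b.2) :
    pairWeight lam f (a, b)
      = ENNReal.ofReal (Real.exp (-lam * F f (dist a.1 b.1) a.2 b.2)) := by
  have hg : Measurable ((Ioi (0 : ℝ)).indicator f) := hf_meas.indicator measurableSet_Ioi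
  have hg0 : ∀ z, 0 ≤ (Ioi (0 : ℝ)).indicator f z := fun z => indicator_nonneg hf_nonneg z
  have hi := integrableOn_of_integral_eq_one hf_one
  have hgi : Integrable ((Ioi (0 : ℝ)).indicator f) := (integrable_indicator_iff measurableSet_Ioi).2 hi
  have hFF := heightMeasure_openBalls hg hg0 hgi (dist_pos.2 hab) rfl ha hb
  have hFe : F f (dist a.1 b.1) a.2 b.2 = F ((Ioi (0 : ℝ)).indicator f) (dist a.1 b.1) a.2 b.2 :=
    F_congr (fun z hz => (indicator_of_mem (show z ∈ Ioi (0 : ℝ) from hz) f).symm) _ ha hb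
  have hint : intensity lam f = ENNReal.ofReal lam • heightMeasure ((Ioi (0 : ℝ)).indicator f) := by
    rw [intensity, resourceLaw_eq, Measure.prod_smul_left, heightMeasure]
  rw [pairWeight, expNeg, hint, Measure.smul_apply, hFF.2, hFe, smul_eq_mul, ENNReal.toReal_mul,
    ENNReal.toReal_ofReal hlam.le, ENNReal.toReal_ofReal hFF.1, neg_mul]

end MNNR

/-! ### At most one mutually nearest neighbour in the mean -/

namespace MNNR

/-- The values `m {q ≤ q b}` are stochastically larger than Lebesgue measure on the half-line. -/
lemma measure_sublevel_measure_lt_le {α : Type*} [MeasurableSpace α] (m : Measure α) (q : α → ℝ)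
    (u : ℝ≥0∞) : m {b | m {c | q c ≤ q b} < u} ≤ u := by
  -- If `q` has a maximum on the set, the set lies in one sublevel set of measure below `u`.
  -- Otherwise it is covered by a directed union of rational sublevel sets of measure at most `u`.
  by_cases hmax : ∃ b, m {c | q c ≤ q b} < u ∧ ∀ b', m {c | q c ≤ q b'} < u → q b' ≤ q b
  · obtain ⟨b, hb, hb'⟩ := hmax
    exact (measure_mono hb').trans hb.le
  · push Not at hmax
    let s : {r : ℚ // m {c | q c ≤ r} ≤ u} → Set α := fun r => {c | q c ≤ (r : ℚ)}
    have hsub : {b | m {c | q c ≤ q b} < u} ⊆ ⋃ r, s r := by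
      intro b hb
      obtain ⟨b', hb', hlt⟩ := hmax b hb
      obtain ⟨r, hr1, hr2⟩ := exists_rat_btwn hlt
      refine mem_iUnion.2 ⟨⟨r, (measure_mono fun c hc => ?_).trans hb'.le⟩, hr1.le⟩
      exact (show q c ≤ r from hc).trans hr2.le
    have hdir : Directed (· ⊆ ·) s := by
      intro r r'
      rcases le_total r.1 r'.1 with h | h
      · exact ⟨r', fun c hc => (show q c ≤ (r : ℚ) from hc).trans (by exact_mod_cast h),
          subset_rfl⟩
      · exact ⟨r, subset_rfl,
          fun c hc => (show q c ≤ (r' : ℚ) from hc).trans (by exact_mod_cast h)⟩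
    refine (measure_mono hsub).trans ?_
    rw [hdir.measure_iUnion]
    exact iSup_le fun r => r.2

lemma lintegral_neg_log : ∫⁻ t in Ioc (0 : ℝ) 1, ENNReal.ofReal (-Real.log t) = 1 := by
  have hi : IntegrableOn (fun t => -Real.log t) (Ioc (0 : ℝ) 1) :=
    (intervalIntegral.intervalIntegrable_log' (a := 0) (b := 1)).1.neg
  rw [← ofReal_integral_eq_lintegral_ofReal hi ((ae_restrict_iff' measurableSet_Ioc).2
      (Filter.Eventually.of_forall fun t ht => neg_nonneg.2 (Real.log_nonpos ht.1.le ht.2))),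
    ← intervalIntegral.integral_of_le zero_le_one, intervalIntegral.integral_neg, integral_log]
  simp

/-- In mean, at most one point of a Poisson process is the nearest neighbour of a given one. -/
lemma lintegral_expNeg_sublevel_le_one {α : Type*} [MeasurableSpace α] (m : Measure α) {q : α → ℝ}
    (hq : Measurable q) (hfin : ∀ᵐ b ∂m, m {c | q c ≤ q b} ≠ ∞) :
    ∫⁻ b, expNeg (m {c | q c ≤ q b}) ∂m ≤ 1 := by
  have hmono : Monotone fun t : ℝ => m {c | q c ≤ t} := fun t t' h =>
    measure_mono fun c hc => (show q c ≤ t from hc).trans h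
  have hmeas : Measurable fun b => m {c | q c ≤ q b} := hmono.measurable.comp hq
  have hexp : Measurable fun b => Real.exp (-(m {c | q c ≤ q b}).toReal) :=
    Real.measurable_exp.comp hmeas.ennreal_toReal.neg
  unfold expNeg
  -- Layer cake: the integrand exceeds t exactly where the sublevel measure is below -log t, a set
  -- of measure at most -log t; and -log has integral one over (0, 1].
  rw [lintegral_eq_lintegral_meas_lt m (Filter.Eventually.of_forall fun b => (Real.exp_pos _).le)
    hexp.aemeasurable]
  rw [← lintegral_neg_log, ← lintegral_indicator measurableSet_Ioi,
    ← lintegral_indicator measurableSet_Ioc]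
  refine lintegral_mono fun t => ?_
  by_cases ht0 : 0 < t
  · rw [indicator_of_mem (show t ∈ Ioi 0 from ht0)]
    by_cases ht1 : t ≤ 1
    · rw [indicator_of_mem (show t ∈ Ioc 0 1 from ⟨ht0, ht1⟩)]
      refine (measure_mono_ae ?_).trans (measure_sublevel_measure_lt_le m q _)
      filter_upwards [hfin] with b hb hlt
      have h1 : t < Real.exp (-(m {c | q c ≤ q b}).toReal) := hlt
      have h2 : (m {c | q c ≤ q b}).toReal < -Real.log t := by
        have := (Real.log_lt_iff_lt_exp ht0).2 h1
        linarith
      exact (ENNReal.lt_ofReal_iff_toReal_lt hb).2 h2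
    · have : {b | t < Real.exp (-(m {c | q c ≤ q b}).toReal)} = ∅ := by
        rw [eq_empty_iff_forall_notMem]
        intro b hb
        refine ht1 ((show t < _ from hb).le.trans (Real.exp_le_one_iff.2 ?_))
        exact neg_nonpos.2 ENNReal.toReal_nonneg
      rw [this, measure_empty]
      exact zero_le
  · rw [indicator_of_notMem (show t ∉ Ioi 0 from ht0)]
    exact zero_le

variable {lam : ℝ} {f : ℝ → ℝ}

lemma sFinite_intensity [IsProbabilityMeasure (resourceLaw f)] : SFinite (intensity lam f) := by
  unfold intensity
  infer_instance

lemma intensity_pos [IsProbabilityMeasure (resourceLaw f)] : ∀ᵐ c ∂intensity lam f, 0 < c.2 :=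
  Measure.quasiMeasurePreserving_snd.ae (resourceLaw_pos f)

/-- A given atom has, in mean, at most one mutually nearest neighbour. -/
lemma lintegral_pairWeight_le_one [IsProbabilityMeasure (resourceLaw f)] {a : Atom} (ha : 0 < a.2) :
    ∫⁻ b, pairWeight lam f (a, b) ∂intensity lam f ≤ 1 := by
  -- Only the ball about `a` is kept. Up to its null sphere it is the sublevel set through `b` of
  -- squared distance over height.
  have hball : ∀ b : Atom, 0 < b.2 →
      intensity lam f {c | sqDist a c / c.2 ≤ sqDist a b / b.2}
        ≤ intensity lam f {c | ((a, b), c) ∈ openBalls 0} := fun b hb => by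
    have hne : ∀ᵐ c ∂intensity lam f, ¬ (b.2 * sqDist a c = c.2 * sqDist a b) :=
      measure_eq_zero_iff_ae_notMem.1 (intensity_sphere a hb (sqDist a b))
    refine measure_mono_ae ?_
    filter_upwards [intensity_pos, hne] with c hc hcb hle
    have h1 : sqDist a c / c.2 ≤ sqDist a b / b.2 := hle
    rw [div_le_div_iff₀ hc hb] at h1
    refine ⟨⟨ha, hb, hc⟩, Or.inl ?_⟩
    simp only [mul_zero, zero_mul, add_zero]
    exact lt_of_le_of_ne (by linarith) hcb
  have hq : Measurable fun c : Atom => sqDist a c / c.2 := by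
    unfold sqDist
    fun_prop
  refine le_trans (lintegral_mono_ae ?_)
    (lintegral_expNeg_sublevel_le_one (intensity lam f) hq ?_)
  · filter_upwards [intensity_pos] with b hb
    exact expNeg_anti (intensity_openBalls_ne_top 0 (a, b)) (hball b hb)
  · filter_upwards [intensity_pos] with b hb
    exact ne_top_of_le_ne_top (intensity_openBalls_ne_top 0 (a, b)) (hball b hb)

/-- The density of ordered pairs of positions at which there are cooperating atoms. -/
noncomputable def positionPairWeight (lam : ℝ) (f : ℝ → ℝ) (D : Set (ℝ × ℝ)) (y : Plane × Plane) :
    ℝ≥0∞ :=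
  ∫⁻ z, D.indicator (fun z => pairWeight lam f ((y.1, z.1), (y.2, z.2))) z
    ∂((resourceLaw f).prod (resourceLaw f))

variable {D : Set (ℝ × ℝ)}

lemma measurable_indicator_pairWeight [IsProbabilityMeasure (resourceLaw f)]
    (hD : MeasurableSet D) : Measurable fun t : (Plane × Plane) × (ℝ × ℝ) =>
      D.indicator (fun z => pairWeight lam f ((t.1.1, z.1), (t.1.2, z.2))) t.2 := by
  have := sFinite_intensity (lam := lam) (f := f)
  have h1 : Measurable fun t : (Plane × Plane) × (ℝ × ℝ) =>
      pairWeight lam f ((t.1.1, t.2.1), (t.1.2, t.2.2)) :=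
    measurable_pairWeight.comp (by fun_prop)
  exact h1.indicator (measurable_snd hD)

lemma measurable_positionPairWeight [IsProbabilityMeasure (resourceLaw f)]
    (hD : MeasurableSet D) : Measurable (positionPairWeight lam f D) :=
  (measurable_indicator_pairWeight hD).lintegral_prod_right'

/-- The measure of cooperating pairs, after integration over the marks. -/
lemma setLIntegral_pairWeight [IsProbabilityMeasure (resourceLaw f)] (hD : MeasurableSet D)
    {A : Set Plane} (hA : MeasurableSet A) :
    ∫⁻ q in {q : Atom × Atom | q.1.1 ∈ A ∧ (q.1.2, q.2.2) ∈ D}, pairWeight lam f q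
        ∂((intensity lam f).prod (intensity lam f))
      = ENNReal.ofReal lam * ∫⁻ y₁ in A, ENNReal.ofReal lam *
        ∫⁻ y₂, positionPairWeight lam f D (y₁, y₂) := by
  have := sFinite_intensity (lam := lam) (f := f)
  have hm := measurable_indicator_pairWeight (lam := lam) (f := f) hD
  have hpre : MeasurableSet {q : Atom × Atom | q.1.1 ∈ A ∧ (q.1.2, q.2.2) ∈ D} :=
    ((measurable_fst.comp measurable_fst) hA).inter
      ((by fun_prop : Measurable fun q : Atom × Atom => (q.1.2, q.2.2)) hD)
  rw [← lintegral_indicator hpre]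
  let G : Atom × Atom → ℝ≥0∞ := fun q => A.indicator (fun _ =>
    D.indicator (fun z => pairWeight lam f ((q.1.1, z.1), (q.2.1, z.2))) (q.1.2, q.2.2)) q.1.1
  have hG : ({q : Atom × Atom | q.1.1 ∈ A ∧ (q.1.2, q.2.2) ∈ D}.indicator (pairWeight lam f)) = G := by
    ext q
    by_cases h1 : q.1.1 ∈ A
    · by_cases h2 : (q.1.2, q.2.2) ∈ D
      · simp only [G, indicator_of_mem h1, indicator_of_mem h2]
        exact indicator_of_mem (s := {q : Atom × Atom | q.1.1 ∈ A ∧ (q.1.2, q.2.2) ∈ D}) ⟨h1, h2⟩ _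
      · simp only [G, indicator_of_mem h1, indicator_of_notMem h2]
        exact indicator_of_notMem (fun h => h2 h.2) _
    · simp only [G, indicator_of_notMem h1]
      exact indicator_of_notMem (fun h => h1 h.1) _
  have hGm : Measurable G := hG ▸ (measurable_pairWeight.indicator hpre)
  have hm1 : ∀ y₁ : Plane, Measurable fun t : ℝ × Plane =>
      ∫⁻ z', D.indicator (fun z => pairWeight lam f ((y₁, z.1), (t.2, z.2))) (t.1, z')
        ∂resourceLaw f := fun y₁ => by
    have h1 : Measurable fun t : (ℝ × Plane) × ℝ =>
        D.indicator (fun z => pairWeight lam f ((y₁, z.1), (t.1.2, z.2))) (t.1.1, t.2) :=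
      hm.comp (by fun_prop : Measurable fun t : (ℝ × Plane) × ℝ => ((y₁, t.1.2), (t.1.1, t.2)))
    exact h1.lintegral_prod_right'
  have hGm2 : Measurable fun a : Atom => ∫⁻ b, G (a, b) ∂intensity lam f := hGm.lintegral_prod_right'
  rw [hG, lintegral_prod _ hGm.aemeasurable, intensity, lintegral_prod _ (by
    rw [← intensity]; exact hGm2.aemeasurable), lintegral_smul_measure, smul_eq_mul]
  congr 1
  rw [← lintegral_indicator hA]
  refine lintegral_congr fun y₁ => ?_
  by_cases h1 : y₁ ∈ A
  · rw [indicator_of_mem h1]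
    have h2 : ∀ z : ℝ, ∫⁻ b, G ((y₁, z), b)
        ∂((ENNReal.ofReal lam • (volume : Measure Plane)).prod (resourceLaw f))
        = ENNReal.ofReal lam * ∫⁻ y₂, ∫⁻ z',
          D.indicator (fun z => pairWeight lam f ((y₁, z.1), (y₂, z.2))) (z, z')
          ∂resourceLaw f := fun z => by
      have hGz : Measurable fun b : Atom => G ((y₁, z), b) := hGm.comp (by fun_prop)
      rw [lintegral_prod _ hGz.aemeasurable, lintegral_smul_measure, smul_eq_mul]
      simp only [G, indicator_of_mem h1]
    simp_rw [h2]
    rw [lintegral_const_mul _ (hm1 y₁).lintegral_prod_right', lintegral_lintegral_swap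
      (hm1 y₁).aemeasurable]
    congr 1
    refine lintegral_congr fun y₂ => ?_
    have h3 : Measurable fun z : ℝ × ℝ =>
        D.indicator (fun z => pairWeight lam f ((y₁, z.1), (y₂, z.2))) z :=
      hm.comp (by fun_prop : Measurable fun z : ℝ × ℝ => ((y₁, y₂), z))
    rw [positionPairWeight, lintegral_prod _ h3.aemeasurable]
  · rw [indicator_of_notMem h1]
    simp only [G, indicator_of_notMem h1, lintegral_zero]

/-- The mean number of cooperating partners of an atom at a given position is at most one. -/
lemma lintegral_positionPairWeight_le_one [IsProbabilityMeasure (resourceLaw f)] (y₁ : Plane) :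
    ENNReal.ofReal lam * ∫⁻ y₂, positionPairWeight lam f D (y₁, y₂) ≤ 1 := by
  have := sFinite_intensity (lam := lam) (f := f)
  have hm1 : Measurable fun t : Plane × ℝ =>
      ∫⁻ z', pairWeight lam f ((y₁, t.2), (t.1, z')) ∂resourceLaw f := by
    have h1 : Measurable fun t : (Plane × ℝ) × ℝ =>
        pairWeight lam f ((y₁, t.1.2), (t.1.1, t.2)) := measurable_pairWeight.comp (by fun_prop)
    exact h1.lintegral_prod_right'
  have hpw : ∀ y₂, positionPairWeight lam f D (y₁, y₂)
      ≤ ∫⁻ z, ∫⁻ z', pairWeight lam f ((y₁, z), (y₂, z')) ∂resourceLaw f ∂resourceLaw f := by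
    intro y₂
    have h3 : Measurable fun z : ℝ × ℝ => pairWeight lam f ((y₁, z.1), (y₂, z.2)) :=
      measurable_pairWeight.comp (by fun_prop)
    rw [← lintegral_prod _ h3.aemeasurable]
    exact lintegral_mono fun z => indicator_le_self _ _ _
  calc ENNReal.ofReal lam * ∫⁻ y₂, positionPairWeight lam f D (y₁, y₂)
      ≤ ENNReal.ofReal lam * ∫⁻ y₂, ∫⁻ z, ∫⁻ z', pairWeight lam f ((y₁, z), (y₂, z'))
          ∂resourceLaw f ∂resourceLaw f := by gcongr; exact hpw _
    _ = ∫⁻ z, ∫⁻ b, pairWeight lam f ((y₁, z), b) ∂intensity lam f ∂resourceLaw f := by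
        rw [← smul_eq_mul, ← lintegral_smul_measure, lintegral_lintegral_swap hm1.aemeasurable]
        refine lintegral_congr fun z => ?_
        have h4 : Measurable fun b : Atom => pairWeight lam f ((y₁, z), b) :=
          measurable_pairWeight.comp (by fun_prop)
        rw [intensity, lintegral_prod _ h4.aemeasurable]
    _ ≤ ∫⁻ _, 1 ∂resourceLaw f := by
        refine lintegral_mono_ae ?_
        filter_upwards [resourceLaw_pos f] with z hz
        exact lintegral_pairWeight_le_one hz
    _ = 1 := by simp

end MNNR

/-! ### Reduction to the radial integral -/

namespace MNNR

variable {lam : ℝ} {f : ℝ → ℝ} {D : Set (ℝ × ℝ)}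

lemma cooperationWeight_nonneg (s : ℝ) (z : ℝ × ℝ) : 0 ≤ cooperationWeight lam f D s z :=
  indicator_nonneg (fun _ _ => (Real.exp_pos _).le) _

lemma meanWeight_nonneg (s : ℝ) : 0 ≤ meanWeight lam f D s :=
  integral_nonneg fun z => cooperationWeight_nonneg s z

lemma ofReal_cooperationWeight (hlam : 0 < lam) (hf_meas : Measurable f)
    (hf_nonneg : ∀ z, 0 < z → 0 ≤ f z) (hf_one : ∫ z in Ioi (0 : ℝ), f z = 1)
    (hD_sub : D ⊆ Ioi (0 : ℝ) ×ˢ Ioi (0 : ℝ)) {y₁ y₂ : Plane} (hy : y₁ ≠ y₂) (z : ℝ × ℝ) :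
    ENNReal.ofReal (cooperationWeight lam f D (dist y₁ y₂) z)
      = D.indicator (fun z => pairWeight lam f ((y₁, z.1), (y₂, z.2))) z := by
  unfold cooperationWeight
  by_cases hz : z ∈ D
  · rw [indicator_of_mem hz, indicator_of_mem hz]
    have hpos := hD_sub hz
    exact (pairWeight_eq_ofReal hlam hf_meas hf_nonneg hf_one (a := (y₁, z.1)) (b := (y₂, z.2))
      hy hpos.1 hpos.2).symm
  · rw [indicator_of_notMem hz, indicator_of_notMem hz, ENNReal.ofReal_zero]

/-- Measurability is not read off from the formula for `F`: the weight is the pair density at the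
origin and a point of norm `s`, which is measurable by Fubini and at most one. -/
lemma integrable_cooperationWeight (hlam : 0 < lam) (hf_meas : Measurable f)
    (hf_nonneg : ∀ z, 0 < z → 0 ≤ f z) (hf_one : ∫ z in Ioi (0 : ℝ), f z = 1)
    (hD_sub : D ⊆ Ioi (0 : ℝ) ×ˢ Ioi (0 : ℝ)) (hD : MeasurableSet D) {s : ℝ} (hs : 0 < s) :
    Integrable (cooperationWeight lam f D s) ((resourceLaw f).prod (resourceLaw f)) := by
  have := isProbabilityMeasure_resourceLaw hf_nonneg hf_one
  obtain ⟨y, hy⟩ := exists_norm_eq Plane hs.le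
  have hy0 : (0 : Plane) ≠ y := by
    rintro rfl
    rw [norm_zero] at hy
    exact hs.ne hy
  have hds : dist (0 : Plane) y = s := by rw [dist_zero_left, hy]
  have key := ofReal_cooperationWeight hlam hf_meas hf_nonneg hf_one hD_sub hy0
  rw [hds] at key
  have hm : Measurable (cooperationWeight lam f D s) := by
    have h1 : Measurable fun z : ℝ × ℝ => (ENNReal.ofReal (cooperationWeight lam f D s z)).toReal := by
      simp_rw [key]
      exact ((measurable_indicator_pairWeight (lam := lam) (f := f) hD).comp
        (by fun_prop : Measurable fun z : ℝ × ℝ => (((0 : Plane), y), z))).ennreal_toReal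
    simpa only [ENNReal.toReal_ofReal (cooperationWeight_nonneg s _)] using h1
  refine Integrable.of_bound hm.aestronglyMeasurable 1 (Filter.Eventually.of_forall fun z => ?_)
  rw [Real.norm_of_nonneg (cooperationWeight_nonneg s z), ← ENNReal.ofReal_le_one, key]
  exact (indicator_le_self _ _ _).trans (expNeg_le_one _)

lemma positionPairWeight_eq_ofReal (hlam : 0 < lam) (hf_meas : Measurable f)
    (hf_nonneg : ∀ z, 0 < z → 0 ≤ f z) (hf_one : ∫ z in Ioi (0 : ℝ), f z = 1)
    (hD_sub : D ⊆ Ioi (0 : ℝ) ×ˢ Ioi (0 : ℝ)) (hD : MeasurableSet D) {y₁ y₂ : Plane}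
    (hy : y₁ ≠ y₂) :
    positionPairWeight lam f D (y₁, y₂) = ENNReal.ofReal (meanWeight lam f D (dist y₁ y₂)) := by
  rw [meanWeight, ofReal_integral_eq_lintegral_ofReal
    (integrable_cooperationWeight hlam hf_meas hf_nonneg hf_one hD_sub hD (dist_pos.2 hy))
    (Filter.Eventually.of_forall fun z => cooperationWeight_nonneg _ z), positionPairWeight]
  exact lintegral_congr fun z =>
    (ofReal_cooperationWeight hlam hf_meas hf_nonneg hf_one hD_sub hy z).symm

/-- The weight depends on the positions through their distance only, so translation removes `y₁`;
the single point `y₁`, where the distance is zero, is null. -/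
lemma lintegral_positionPairWeight (hlam : 0 < lam) (hf_meas : Measurable f)
    (hf_nonneg : ∀ z, 0 < z → 0 ≤ f z) (hf_one : ∫ z in Ioi (0 : ℝ), f z = 1)
    (hD_sub : D ⊆ Ioi (0 : ℝ) ×ˢ Ioi (0 : ℝ)) (hD : MeasurableSet D) (y₁ : Plane) :
    ∫⁻ y₂, positionPairWeight lam f D (y₁, y₂)
      = ∫⁻ y : Plane, ENNReal.ofReal (meanWeight lam f D ‖y‖) := by
  rw [← lintegral_sub_left_eq_self (fun y : Plane => ENNReal.ofReal (meanWeight lam f D ‖y‖)) y₁]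
  refine lintegral_congr_ae ?_
  filter_upwards [measure_eq_zero_iff_ae_notMem.1 (measure_singleton (μ := volume) y₁)] with y hy
  rw [positionPairWeight_eq_ofReal hlam hf_meas hf_nonneg hf_one hD_sub hD (fun h => hy h.symm),
    dist_eq_norm]

/-- Finiteness comes from the bound by one on the mean number of partners, divided by `lam` > 0. -/
lemma integrable_meanWeight_norm (hlam : 0 < lam) (hf_meas : Measurable f)
    (hf_nonneg : ∀ z, 0 < z → 0 ≤ f z) (hf_one : ∫ z in Ioi (0 : ℝ), f z = 1)
    (hD_sub : D ⊆ Ioi (0 : ℝ) ×ˢ Ioi (0 : ℝ)) (hD : MeasurableSet D) :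
    Integrable fun y : Plane => meanWeight lam f D ‖y‖ := by
  have := isProbabilityMeasure_resourceLaw hf_nonneg hf_one
  have hm : Measurable fun y : Plane => (positionPairWeight lam f D (0, y)).toReal :=
    ((measurable_positionPairWeight hD).comp
      (by fun_prop : Measurable fun y : Plane => ((0 : Plane), y))).ennreal_toReal
  refine ⟨hm.aestronglyMeasurable.congr ?_, ?_⟩
  · filter_upwards [measure_eq_zero_iff_ae_notMem.1 (measure_singleton (μ := volume) (0 : Plane))]
      with y hy
    rw [positionPairWeight_eq_ofReal hlam hf_meas hf_nonneg hf_one hD_sub hD (fun h => hy h.symm),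
      dist_zero_left, ENNReal.toReal_ofReal (meanWeight_nonneg _)]
  · rw [hasFiniteIntegral_iff_ofReal (Filter.Eventually.of_forall fun y => meanWeight_nonneg _)]
    have h1 := lintegral_positionPairWeight_le_one (lam := lam) (f := f) (D := D) 0
    rw [lintegral_positionPairWeight hlam hf_meas hf_nonneg hf_one hD_sub hD] at h1
    refine lt_top_iff_ne_top.2 fun htop => ?_
    rw [htop, ENNReal.mul_top (ENNReal.ofReal_pos.2 hlam).ne'] at h1
    exact absurd h1 (by simp)

lemma integrableOn_meanWeight (hlam : 0 < lam) (hf_meas : Measurable f)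
    (hf_nonneg : ∀ z, 0 < z → 0 ≤ f z) (hf_one : ∫ z in Ioi (0 : ℝ), f z = 1)
    (hD_sub : D ⊆ Ioi (0 : ℝ) ×ˢ Ioi (0 : ℝ)) (hD : MeasurableSet D) :
    IntegrableOn (fun s => meanWeight lam f D s * s) (Ioi (0 : ℝ)) := by
  have h := (integrable_fun_norm_addHaar (volume : Measure Plane)).1
    (integrable_meanWeight_norm hlam hf_meas hf_nonneg hf_one hD_sub hD)
  simpa [finrank_euclideanSpace, mul_comm] using h

lemma integral_meanWeight_norm (lam : ℝ) (f : ℝ → ℝ) (D : Set (ℝ × ℝ)) :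
    ∫ y : Plane, meanWeight lam f D ‖y‖
      = 2 * Real.pi * ∫ s in Ioi (0 : ℝ), meanWeight lam f D s * s := by
  rw [integral_fun_norm_addHaar (volume : Measure Plane) (meanWeight lam f D)]
  have hv : (volume : Measure Plane).real (Metric.ball 0 1) = Real.pi := by
    simp [measureReal_def, Real.pi_pos.le]
  simp [hv, finrank_euclideanSpace, mul_comm, mul_assoc, mul_left_comm]

variable {Ω : Type u} [MeasurableSpace Ω] {P : Measure Ω} {x : ℕ → Ω → Plane} {Z : ℕ → Ω → ℝ}

lemma IsMarkedPPP.positionMeasure_someCoop_eq [IsProbabilityMeasure P]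
    (h : IsMarkedPPP P lam f x Z) (hlam : 0 < lam) (hf_meas : Measurable f)
    (hf_nonneg : ∀ z, 0 < z → 0 ≤ f z) (hf_one : ∫ z in Ioi (0 : ℝ), f z = 1)
    (hD_sub : D ⊆ Ioi (0 : ℝ) ×ˢ Ioi (0 : ℝ)) (hD : MeasurableSet D) :
    positionMeasure P x (someCoop D x Z)
      = ENNReal.ofReal (lam * (∫ y : Plane, meanWeight lam f D ‖y‖) * lam) • volume := by
  have := isProbabilityMeasure_resourceLaw hf_nonneg hf_one
  ext A hA
  rw [h.positionMeasure_someCoop hD hA, setLIntegral_pairWeight hD hA]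
  simp_rw [lintegral_positionPairWeight hlam hf_meas hf_nonneg hf_one hD_sub hD]
  rw [setLIntegral_const, ← ofReal_integral_eq_lintegral_ofReal
    (integrable_meanWeight_norm hlam hf_meas hf_nonneg hf_one hD_sub hD)
    (Filter.Eventually.of_forall fun y => meanWeight_nonneg _), ← ENNReal.ofReal_mul hlam.le,
    ← mul_assoc, ← ENNReal.ofReal_mul hlam.le, Measure.smul_apply, smul_eq_mul, mul_comm lam]

/-- Measures on the plane that complement a multiple of Lebesgue measure. -/
lemma eq_smul_volume_of_add_eq {μ : Measure Plane} {a b : ℝ} (ha : 0 ≤ a)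
    (hadd : μ + ENNReal.ofReal a • volume = ENNReal.ofReal b • (volume : Measure Plane)) :
    μ = ENNReal.ofReal (b - a) • (volume : Measure Plane) := by
  -- Localised to balls, so that the subtracted masses are finite.
  refine Measure.ext_of_iUnion_eq_univ (s := fun n : ℕ => Metric.ball (0 : Plane) n)
    iUnion_ball_nat fun n => ?_
  ext A hA
  rw [Measure.restrict_apply hA, Measure.restrict_apply hA]
  set B := A ∩ Metric.ball (0 : Plane) n
  have hfin : volume B ≠ ∞ :=
    ne_top_of_le_ne_top measure_ball_lt_top.ne (measure_mono inter_subset_right)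
  have h1 : μ B + ENNReal.ofReal a * volume B = ENNReal.ofReal b * volume B := by
    have := congrArg (fun m : Measure Plane => m B) hadd
    simpa using this
  rw [Measure.smul_apply, smul_eq_mul, ENNReal.ofReal_sub _ ha, ENNReal.sub_mul fun _ _ => hfin,
    ← h1, ENNReal.add_sub_cancel_right (ENNReal.mul_ne_top ENNReal.ofReal_ne_top hfin)]

lemma IsMarkedPPP.positionMeasure_compl_someCoop_eq [IsProbabilityMeasure P]
    (h : IsMarkedPPP P lam f x Z) (hlam : 0 < lam) (hf_meas : Measurable f)
    (hf_nonneg : ∀ z, 0 < z → 0 ≤ f z) (hf_one : ∫ z in Ioi (0 : ℝ), f z = 1)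
    (hD_sub : D ⊆ Ioi (0 : ℝ) ×ˢ Ioi (0 : ℝ)) (hD : MeasurableSet D) :
    positionMeasure P x (fun n => (someCoop D x Z n)ᶜ)
      = ENNReal.ofReal ((1 - lam * ∫ y : Plane, meanWeight lam f D ‖y‖) * lam) • volume := by
  have hI : 0 ≤ ∫ y : Plane, meanWeight lam f D ‖y‖ := integral_nonneg fun y => meanWeight_nonneg _
  have hadd := h.positionMeasure_add hD
  rw [h.positionMeasure_someCoop_eq hlam hf_meas hf_nonneg hf_one hD_sub hD] at hadd
  rw [eq_smul_volume_of_add_eq (by positivity) hadd]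
  congr 2
  ring

lemma mul_integral_meanWeight_le_one (hlam : 0 < lam) (hf_meas : Measurable f)
    (hf_nonneg : ∀ z, 0 < z → 0 ≤ f z) (hf_one : ∫ z in Ioi (0 : ℝ), f z = 1)
    (hD_sub : D ⊆ Ioi (0 : ℝ) ×ˢ Ioi (0 : ℝ)) (hD : MeasurableSet D) :
    lam * ∫ y : Plane, meanWeight lam f D ‖y‖ ≤ 1 := by
  have := isProbabilityMeasure_resourceLaw hf_nonneg hf_one
  have h1 := lintegral_positionPairWeight_le_one (lam := lam) (f := f) (D := D) 0
  rwa [lintegral_positionPairWeight hlam hf_meas hf_nonneg hf_one hD_sub hD,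
    ← ofReal_integral_eq_lintegral_ofReal
    (integrable_meanWeight_norm hlam hf_meas hf_nonneg hf_one hD_sub hD)
    (Filter.Eventually.of_forall fun y => meanWeight_nonneg _), ← ENNReal.ofReal_mul hlam.le,
    ENNReal.ofReal_le_one] at h1

end MNNR

theorem theorem3 (lam : ℝ) (hlam : 0 < lam)
    (f : ℝ → ℝ) (hf_meas : Measurable f) (hf_nonneg : ∀ z, 0 < z → 0 ≤ f z)
    (hf_one : ∫ z in Ioi (0 : ℝ), f z = 1)
    (D : Set (ℝ × ℝ)) (hD_sub : D ⊆ Ioi (0 : ℝ) ×ˢ Ioi (0 : ℝ)) (hD_meas : MeasurableSet D)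
    (hD_symm : ∀ z z', (z, z') ∈ D → (z', z) ∈ D) :
    ∃ p ∈ Icc (0 : ℝ) 1,
      (∀ (Ω : Type u) [MeasurableSpace Ω] (P : Measure Ω) [IsProbabilityMeasure P]
        (x : ℕ → Ω → MNNR.Plane) (Z : ℕ → Ω → ℝ), MNNR.IsMarkedPPP P lam f x Z →
        ∀ A : Set MNNR.Plane, MeasurableSet A →
          AEMeasurable
            (fun ω => MNNR.countIn (MNNR.singles D (MNNR.configuration x Z ω)) A) P ∧
          AEMeasurable
            (fun ω => MNNR.countIn (MNNR.cooperating D (MNNR.configuration x Z ω)) A) P ∧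
          MNNR.meanSingles P D x Z A = ENNReal.ofReal ((1 - p) * lam) * volume A ∧
          MNNR.meanCooperating P D x Z A = ENNReal.ofReal (p * lam) * volume A) ∧
      (∀ s : ℝ, 0 < s → Integrable (MNNR.cooperationWeight lam f D s)
        ((MNNR.resourceLaw f).prod (MNNR.resourceLaw f))) ∧
      IntegrableOn (fun s => MNNR.meanWeight lam f D s * s) (Ioi (0 : ℝ)) ∧
      p = 2 * Real.pi * lam * ∫ s in Ioi (0 : ℝ), MNNR.meanWeight lam f D s * s := by
  -- The mean number of cooperating partners of an atom at the origin, expressed without reference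
  -- to a process and hence the same for all of them.
  refine ⟨lam * ∫ y : MNNR.Plane, MNNR.meanWeight lam f D ‖y‖,
    ⟨mul_nonneg hlam.le (integral_nonneg fun y => MNNR.meanWeight_nonneg _),
      MNNR.mul_integral_meanWeight_le_one hlam hf_meas hf_nonneg hf_one hD_sub hD_meas⟩,
    fun Ω _ P _ x Z h A hA => ?_,
    fun s hs => MNNR.integrable_cooperationWeight hlam hf_meas hf_nonneg hf_one hD_sub hD_meas hs,
    MNNR.integrableOn_meanWeight hlam hf_meas hf_nonneg hf_one hD_sub hD_meas, ?_⟩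
  · obtain ⟨hS, hS'⟩ := h.meanSingles_eq hD_meas hA
    obtain ⟨hC, hC'⟩ := h.meanCooperating_eq hD_meas hA
    refine ⟨hS, hC, ?_, ?_⟩
    · rw [hS', h.positionMeasure_compl_someCoop_eq hlam hf_meas hf_nonneg hf_one hD_sub hD_meas,
        Measure.smul_apply, smul_eq_mul]
    · rw [hC', h.positionMeasure_someCoop_eq hlam hf_meas hf_nonneg hf_one hD_sub hD_meas,
        Measure.smul_apply, smul_eq_mul]
  · rw [MNNR.integral_meanWeight_norm]
    ring
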